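/- Let $\alpha_*=\{a_+,a_-,b_+,b_-\}$ and $\alpha_1=\{1,-1\}$, with involution $\tau(\pm1)=\mp1$ on $\alpha_1$, and let $\alpha_*\to\alpha_1$ be the projection sending $a_\pm,b_\pm$ to $\pm1$. A nanophrase over a set $\alpha$ is a finite alphabet $\mathcal A$ with a map $\mathcal A\to\alpha$, $A\mapsto|A|$, and a finite sequence $(w_1|\cdots|w_k)$ of words in $\mathcal A$ such that every letter occurs exactly twice in $w_1\cdots w_k$. A nanophrase over $\alpha_*$ determines an oriented link diagram on an oriented surface: the components are the words, the crossings are the letters, $a_\pm,b_\pm$ are the letters of crossings of sign $\pm$ (a crossing is positive if its over-branch crosses its under-branch from left to right), and the letter is of type $a$ iff the tangent vectors of the first and second passages form a positively oriented pair. The bracket $\langle P\rangle\in\mathbb Z[t,t^{-1}]$ of a nanophrase $P$ over $\alpha_*$ is the Kauffman bracket of this diagram, where $d\ge 1$ circles without crossings contribute $(-(t^2+t^{-2}))^{d-1}$ (and the empty diagram contributes $1$). A pseudo-link is a nanophrase over $\alpha_1$ up to isomorphism and permutations and cyclic shifts of words. Let $S_1=\{(1,1,1),(1,1,-1),(-1,1,1),(-1,-1,-1),(-1,-1,1),(1,-1,-1)\}$.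 The $S_1$-homotopy moves on nanophrases over $\alpha_1$ are (1) $xAAy\mapsto xy$; (2) $xAByBAz\mapsto xyz$ if $|B|=\tau(|A|)$; (3) $xAByACzBCt\mapsto xBAyCAzCBt$ if $(|A|,|B|,|C|)\in S_1$ (the displayed two-letter sub-words may lie in different words of the phrase), and their inverses. Inversion of a word $w$ of a nanophrase over $\alpha_1$ reverses $w$ and replaces $|A|$ by $-|A|$ for every letter $A$ that occurs exactly once in $w$. For a phrase $Q$ and a word $w$, $Q_w$ denotes $Q$ with $|A|$ replaced by $-|A|$ for all letters $A$ that occur exactly once in $w$. (a) The bracket of a nanophrase over $\alpha_*$ depends only on its projection to $\alpha_1$. Moreover, every pseudo-link $p$ has a well-defined bracket $\langle p\rangle=\langle\tilde p\rangle$, where $\tilde p$ is any nanophrase over $\alpha_*$ whose projection represents $p$. (b) $\langle p\rangle$ is invariant under shifts, permutations and inversions of words and under the second and third $S_1$-homotopy moves, and it is multiplied by $-t^{-3|A|}$ under the move deleting $AA$. It satisfies $$\langle (P_1|AwAz|P_2)\rangle=t^{|A|}\langle(P_1|w|z|P_2)\rangle+t^{-|A|}\langle (P_1|w^-z|P_2)_w\rangle,$$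 $$\langle (P_1|Aw|Az|P_2)\rangle=t^{|A|}\langle(P_1|wz|P_2)\rangle+t^{-|A|}\langle (P_1|w^-z|P_2)_w\rangle,$$ where $w^-$ is $w$ read backwards; deleting an empty word from a phrase with at least two words divides the bracket by $-(t^2+t^{-2})$; and $\langle(\emptyset)\rangle=1$. (c) Let $|p|=\sum_A|A|$ be the writhe and $J(p)=(-t)^{-3|p|}\langle p\rangle$. Then $J$ is invariant under all $S_1$-homotopy moves and under shifts and permutations of words. Under inversion of a word $w$ it is multiplied by $t^{6\lambda}$, where $\lambda$ is the sum of $|A|$ over the letters $A$ that occur exactly once in $w$ (so it is invariant under inversions when $\lambda=0$, in particular for nanowords). (d) Every oriented link diagram $D$ on the sphere is the diagram of some nanophrase over $\alpha_*$, and for every such nanophrase the underlying pseudo-link $p$ satisfies $J(p)=V_D|_{q^{1/2}=t^{-2}}$, where $V_D\in\mathbb Z[q^{1/2},q^{-1/2}]$ is the Jones polynomial of the link presented by $D$, defined by Kauffman's state sum. -/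

import Mathlib

open scoped LaurentPolynomial

universe u

/-! ### Nanophrases -/

/-- A nanophrase over `α`: a (finite) alphabet `Letter` with a projection to `α`, and a finite
sequence of words in this alphabet (some of them possibly empty) whose concatenation contains every
letter exactly twice. -/
structure Nanophrase (α : Type) where
  Letter : Type u
  [fintypeLetter : Fintype Letter]
  [decEqLetter : DecidableEq Letter]
  proj : Letter → α
  words : List (List Letter)
  gauss : ∀ A : Letter, words.flatten.count A = 2

attribute [instance] Nanophrase.fintypeLetter Nanophrase.decEqLetter

namespace Nanophrase

variable {α β : Type}

/-- Change of the projection along a map `α → β`. -/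
def map (g : α → β) (P : Nanophrase.{u} α) : Nanophrase.{u} β where
  Letter := P.Letter
  proj := fun A => g (P.proj A)
  words := P.words
  gauss := P.gauss

/-- The phrase as a single list, every word being followed by the separator `none`. Sub-words of
a phrase "possibly belonging to different words" are sub-words of this list. -/
def code {L : Type u} (words : List (List L)) : List (Option L) :=
  words.flatMap fun w => w.map some ++ [none]

/-- Isomorphism of nanophrases. -/
def IsIsomorphic (P Q : Nanophrase.{u} α) : Prop :=
  ∃ f : Q.Letter ≃ P.Letter,
    Q.words.map (List.map f) = P.words ∧ ∀ B, Q.proj B = P.proj (f B)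

/-! In the relations below `f` identifies the alphabet of `Q` with (a part of) the alphabet of `P`;
so each relation is the corresponding operation followed by an isomorphism. -/

/-- First homotopy move: `Q` is obtained from `P` by deleting `A A`, that is `x A A y ↦ x y`. -/
def IsFirstMove (P Q : Nanophrase.{u} α) (A : P.Letter) : Prop :=
  ∃ (f : Q.Letter ↪ P.Letter) (x y : List (Option P.Letter)),
    code P.words = x ++ [some A, some A] ++ y ∧
    code (Q.words.map (List.map f)) = x ++ y ∧
    ∀ B, Q.proj B = P.proj (f B)

/-- Second homotopy move: `x A B y B A z ↦ x y z`, where `|B| = τ |A|`. -/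
def IsSecondMove (τ : α → α) (P Q : Nanophrase.{u} α) : Prop :=
  ∃ (f : Q.Letter ↪ P.Letter) (A B : P.Letter) (x y z : List (Option P.Letter)),
    A ≠ B ∧ P.proj B = τ (P.proj A) ∧
    code P.words = x ++ [some A, some B] ++ y ++ [some B, some A] ++ z ∧
    code (Q.words.map (List.map f)) = x ++ y ++ z ∧
    ∀ D, Q.proj D = P.proj (f D)

/-- Third homotopy move: `x A B y A C z B C t ↦ x B A y C A z C B t`,
where `(|A|, |B|, |C|) ∈ S`. -/
def IsThirdMove (S : Set (α × α × α)) (P Q : Nanophrase.{u} α) : Prop :=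
  ∃ (f : Q.Letter ≃ P.Letter) (A B C : P.Letter) (x y z t : List (Option P.Letter)),
    A ≠ B ∧ A ≠ C ∧ B ≠ C ∧ (P.proj A, P.proj B, P.proj C) ∈ S ∧
    code P.words =
      x ++ [some A, some B] ++ y ++ [some A, some C] ++ z ++ [some B, some C] ++ t ∧
    code (Q.words.map (List.map f)) =
      x ++ [some B, some A] ++ y ++ [some C, some A] ++ z ++ [some C, some B] ++ t ∧
    ∀ D, Q.proj D = P.proj (f D)

/-- A single homotopy move or an isomorphism. -/
inductive HomotopyStep (τ : α → α) (S : Set (α × α × α)) :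
    Nanophrase.{u} α → Nanophrase.{u} α → Prop
  | iso (P Q : Nanophrase.{u} α) : IsIsomorphic P Q → HomotopyStep τ S P Q
  | first (P Q : Nanophrase.{u} α) (A : P.Letter) : IsFirstMove P Q A → HomotopyStep τ S P Q
  | second (P Q : Nanophrase.{u} α) : IsSecondMove τ P Q → HomotopyStep τ S P Q
  | third (P Q : Nanophrase.{u} α) : IsThirdMove S P Q → HomotopyStep τ S P Q

/-- `S`-homotopy: a finite sequence of isomorphisms, homotopy moves and inverse moves. -/
def Homotopic (τ : α → α) (S : Set (α × α × α)) (P Q : Nanophrase.{u} α) : Prop :=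
  Relation.EqvGen (HomotopyStep τ S) P Q

/-- `Q` is obtained from `P` by the `ν`-shift of one of the words, `A w ↦ w A`; the projection
of `A` changes by `ν` if `A` occurs twice in the word. -/
def IsShift (ν : α → α) (P Q : Nanophrase.{u} α) : Prop :=
  ∃ (f : Q.Letter ≃ P.Letter) (U V : List (List P.Letter)) (A : P.Letter) (w : List P.Letter),
    P.words = U ++ (A :: w) :: V ∧
    Q.words.map (List.map f) = U ++ (w ++ [A]) :: V ∧
    ∀ B, Q.proj B = if f B = A ∧ A ∈ w then ν (P.proj (f B)) else P.proj (f B)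

/-- `Q` is obtained from `P` by the `ν`-permutation of two consecutive words. -/
def IsPermutation (ν : α → α) (P Q : Nanophrase.{u} α) : Prop :=
  ∃ (f : Q.Letter ≃ P.Letter) (U V : List (List P.Letter)) (v w : List P.Letter),
    P.words = U ++ v :: w :: V ∧
    Q.words.map (List.map f) = U ++ w :: v :: V ∧
    ∀ B, Q.proj B = if f B ∈ v ∧ f B ∈ w then ν (P.proj (f B)) else P.proj (f B)

/-- The projection `|·|_w` on the alphabet of `P`: `τ |A|` if `A` occurs once in `w`, `ν |A|` if
`A` occurs twice in `w`, and `|A|` otherwise. -/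
def twist (τ ν : α → α) (P : Nanophrase.{u} α) (w : List P.Letter) (A : P.Letter) : α :=
  if w.count A = 1 then τ (P.proj A)
  else if w.count A = 2 then ν (P.proj A)
  else P.proj A

/-- `Q` is obtained from `P` by the `ν`-inversion of one of the words, equal to `w`. -/
def IsInversion (τ ν : α → α) (P Q : Nanophrase.{u} α) (w : List P.Letter) : Prop :=
  ∃ (f : Q.Letter ≃ P.Letter) (U V : List (List P.Letter)),
    P.words = U ++ w :: V ∧
    Q.words.map (List.map f) = U ++ w.reverse :: V ∧
    ∀ B, Q.proj B = P.twist τ ν w (f B)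

/-- `Q` is obtained from `P` by deleting an empty word, and `Q` has length at least one. -/
def IsEmptyWordDeletion (P Q : Nanophrase.{u} α) : Prop :=
  ∃ (f : Q.Letter ≃ P.Letter) (U V : List (List P.Letter)),
    U ++ V ≠ [] ∧ P.words = U ++ [] :: V ∧ Q.words.map (List.map f) = U ++ V ∧
    ∀ B, Q.proj B = P.proj (f B)

/-- `P = (P₁ | A w A z | P₂)`, `Q = (P₁ | w | z | P₂)` and `R = (P₁ | w⁻ z | P₂)_w`. -/
def IsSelfExpansion (τ ν : α → α) (P Q R : Nanophrase.{u} α) (A : P.Letter) : Prop :=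
  ∃ (f : Q.Letter ↪ P.Letter) (g : R.Letter ↪ P.Letter)
    (U V : List (List P.Letter)) (w z : List P.Letter),
    P.words = U ++ (A :: w ++ A :: z) :: V ∧
    Q.words.map (List.map f) = U ++ w :: z :: V ∧
    R.words.map (List.map g) = U ++ (w.reverse ++ z) :: V ∧
    (∀ B, Q.proj B = P.proj (f B)) ∧ ∀ B, R.proj B = P.twist τ ν w (g B)

/-- `P = (P₁ | A w | A z | P₂)`, `Q = (P₁ | w z | P₂)` and `R = (P₁ | w⁻ z | P₂)_w`. -/
def IsMixedExpansion (τ ν : α → α) (P Q R : Nanophrase.{u} α) (A : P.Letter) : Prop :=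
  ∃ (f : Q.Letter ↪ P.Letter) (g : R.Letter ↪ P.Letter)
    (U V : List (List P.Letter)) (w z : List P.Letter),
    P.words = U ++ (A :: w) :: (A :: z) :: V ∧
    Q.words.map (List.map f) = U ++ (w ++ z) :: V ∧
    R.words.map (List.map g) = U ++ (w.reverse ++ z) :: V ∧
    (∀ B, Q.proj B = P.proj (f B)) ∧ ∀ B, R.proj B = P.twist τ ν w (g B)

end Nanophrase

/-! ### Oriented link diagrams on oriented surfaces -/

/-- An oriented link diagram on an oriented surface, up to orientation preserving homeomorphism of
regular neighbourhoods. `Crossing × Bool` is the set of passages through crossings: `(c, true)` is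
the over-passage and `(c, false)` the under-passage of `c`. Following the orientation of the diagram
after the passage `x`, the next passage one meets is `next x`. `sign` gives the signs of the
crossings and `circles` is the number of components without crossings. -/
structure LinkDiagram where
  Crossing : Type u
  [fintypeCrossing : Fintype Crossing]
  [decEqCrossing : DecidableEq Crossing]
  sign : Crossing → ℤˣ
  next : Equiv.Perm (Crossing × Bool)
  circles : ℕ

attribute [instance] LinkDiagram.fintypeCrossing LinkDiagram.decEqCrossing

namespace LinkDiagram

/-- Orientation preserving homeomorphism of (regular neighbourhoods of) diagrams. -/
def IsHomeomorphic (D E : LinkDiagram.{u}) : Prop :=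
  ∃ e : D.Crossing ≃ E.Crossing,
    (∀ c, E.sign (e c) = D.sign c) ∧
    (∀ c o, E.next (e c, o) = (e (D.next (c, o)).1, (D.next (c, o)).2)) ∧
    E.circles = D.circles

/-- The four half-edges at every crossing: `(c, o, d)` lies on the over-strand of `c` if `o` is
true and on the under-strand otherwise; it is the outgoing half of the strand if `d` is true and
the incoming half otherwise. -/
abbrev HalfEdge (D : LinkDiagram.{u}) : Type u := D.Crossing × Bool × Bool

/-- The next half-edge at the same crossing in the counterclockwise cyclic order. At a positive
crossing (the over-strand crosses the under-strand from left to right) this order is: over out,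
under out, over in, under in. At a negative crossing it is: under out, over out, under in,
over in. -/
def rot (D : LinkDiagram.{u}) (h : D.HalfEdge) : D.HalfEdge :=
  if (h.2.1 = true ↔ D.sign h.1 = 1) then (h.1, !h.2.1, h.2.2) else (h.1, !h.2.1, !h.2.2)

/-- The other end of the edge of the diagram that contains the half-edge. -/
def opp (D : LinkDiagram.{u}) (h : D.HalfEdge) : D.HalfEdge :=
  if h.2.2 = true then ((D.next (h.1, h.2.1)).1, (D.next (h.1, h.2.1)).2, false)
  else ((D.next.symm (h.1, h.2.1)).1, (D.next.symm (h.1, h.2.1)).2, true)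

/-- The diagram lies on the sphere: with `V` crossings, `2 V` edges, `F` faces (the orbits of
`rot ∘ opp`) and `C` connected components of the underlying 4-valent graph, every component has
Euler characteristic two, that is `V - 2 V + F = 2 C`. -/
def IsClassical (D : LinkDiagram.{u}) : Prop :=
  Nat.card (Quot fun h h' : D.HalfEdge => h' = D.rot (D.opp h)) =
    Fintype.card D.Crossing +
      2 * Nat.card (Quot fun c c' : D.Crossing => ∃ o o', D.next (c, o) = (c', o'))

/-- In a state `s` every crossing is replaced by an uncrossing: the one with coefficient `t` if
`s c` is true and the one with coefficient `t⁻¹` otherwise. The uncrossing with coefficient `t`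
merges the two regions swept by the over-strand rotated counterclockwise up to the under-strand;
so it connects every over half-edge to the half-edge that precedes it in the counterclockwise order,
while the other uncrossing connects it to the half-edge that follows it. -/
def Joined (D : LinkDiagram.{u}) (s : D.Crossing → Bool) (h h' : D.HalfEdge) : Prop :=
  h.2.1 = true ∧ if s h.1 = true then D.rot h' = h else h' = D.rot h

/-- The number of circles of the diagram without crossings obtained from the state `s`. -/
noncomputable def loops (D : LinkDiagram.{u}) (s : D.Crossing → Bool) : ℕ :=
  D.circles + Nat.card (Quot fun h h' : D.HalfEdge => h' = D.opp h ∨ D.Joined s h h')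

/-- The exponent of `t` in the coefficient of the state `s`. -/
def weight (D : LinkDiagram.{u}) (s : D.Crossing → Bool) : ℤ :=
  ∑ c, if s c = true then 1 else -1

/-- The Kauffman bracket, as a Laurent polynomial in `t = T 1`. A diagram without crossings that
consists of `d ≥ 1` circles contributes `(-(t² + t⁻²)) ^ (d - 1)`. (By convention the empty diagram
has bracket `1`.) -/
noncomputable def bracket (D : LinkDiagram.{u}) : ℤ[T;T⁻¹] :=
  ∑ s : D.Crossing → Bool, LaurentPolynomial.T (D.weight s) *
    (-(LaurentPolynomial.T 2 + LaurentPolynomial.T (-2))) ^ (D.loops s - 1)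

/-- The writhe of the diagram. -/
def writhe (D : LinkDiagram.{u}) : ℤ := ∑ c, (D.sign c : ℤ)

/-- The Jones polynomial of the link presented by a diagram on the sphere, as a Laurent polynomial
in `s = q^{1/2} = T 1`. This is the usual `(-t)^{-3 w(D)} ⟨D⟩` with `q = t⁻⁴`, written out state by
state in terms of `s = t⁻²`: a state contributes
`(-t)^{-3 w} t^σ (-(t² + t⁻²))^{d-1} = (-1)^w s^{(3 w - σ)/2} (-(s + s⁻¹))^{d-1}`,
where `3 w - σ` is always even. -/
noncomputable def jones (D : LinkDiagram.{u}) : ℤ[T;T⁻¹] :=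
  ∑ s : D.Crossing → Bool, LaurentPolynomial.C (D.writhe.negOnePow : ℤ) *
    LaurentPolynomial.T ((3 * D.writhe - D.weight s) / 2) *
    (-(LaurentPolynomial.T 1 + LaurentPolynomial.T (-1))) ^ (D.loops s - 1)

end LinkDiagram

/-! ### Nanophrases over the four-letter alphabet and their diagrams -/

/-- The set `α_* = {a₊, a₋, b₊, b₋}`. -/
inductive AlphaStar : Type
  | aPlus
  | aMinus
  | bPlus
  | bMinus

namespace AlphaStar

/-- The projection `α_* → α₁ = {1, -1}`, which is also the sign of a crossing. -/
def sign : AlphaStar → ℤˣ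
  | aPlus => 1
  | aMinus => -1
  | bPlus => 1
  | bMinus => -1

/-- Whether the first of the two passages through the crossing is the over-passage. The letter is
`a` iff the tangent vectors of the first and the second passage form a positive basis; at a positive
(negative) crossing the tangent vectors of the over- and the under-strand form a positive (negative)
basis. -/
def firstOver : AlphaStar → Bool
  | aPlus => true
  | aMinus => false
  | bPlus => false
  | bMinus => true

end AlphaStar

namespace Nanophrase

/-- Turn the occurrences of letters in a word into passages through crossings; `seen` is the list
of letters that have occurred before, and `fst A` tells whether the first passage through `A` is
the over-passage. -/
def passagesWord {L : Type u} [DecidableEq L] (fst : L → Bool) :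
    List L → List L → List (L × Bool)
  | _, [] => []
  | seen, A :: w => (A, if A ∈ seen then !fst A else fst A) :: passagesWord fst (A :: seen) w

/-- The same for a sequence of words. -/
def passages {L : Type u} [DecidableEq L] (fst : L → Bool) :
    List L → List (List L) → List (List (L × Bool))
  | _, [] => []
  | seen, w :: ws => passagesWord fst seen w :: passages fst (w ++ seen) ws

/-- The link diagram determined by a nanophrase over `α_*`: its components are the words, each
being traversed cyclically (`List.formPerm` sends every element of a list without repetitions to
the next one, cyclically). -/
def diagram (P : Nanophrase.{u} AlphaStar) : LinkDiagram.{u} where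
  Crossing := P.Letter
  sign := fun A => (P.proj A).sign
  next := ((passages (fun A => (P.proj A).firstOver) [] P.words).map List.formPerm).prod
  circles := P.words.countP List.isEmpty

/-- The bracket polynomial of a nanophrase over `α_*` is the bracket of its diagram. -/
noncomputable def bracket (P : Nanophrase.{u} AlphaStar) : ℤ[T;T⁻¹] := P.diagram.bracket

/-- The underlying nanophrase over `α₁ = {1, -1}`. -/
def toSigns (P : Nanophrase.{u} AlphaStar) : Nanophrase.{u} ℤˣ := P.map AlphaStar.sign

/-- The set `S₁`; the involution `τ` of `α₁` is the negation and the shift involution is the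
identity. -/
def S₁ : Set (ℤˣ × ℤˣ × ℤˣ) :=
  {(1, 1, 1), (1, 1, -1), (-1, 1, 1), (-1, -1, -1), (-1, -1, 1), (1, -1, -1)}

/-- `S₁`-homotopy of nanophrases over `α₁`. -/
def Homotopic₁ (p q : Nanophrase.{u} ℤˣ) : Prop := Homotopic (fun a => -a) S₁ p q

/-- The sum of `|A|` over all letters. -/
def writhe (p : Nanophrase.{u} ℤˣ) : ℤ := ∑ A, (p.proj A : ℤ)

/-- The sum of `|A|` over all letters `A` that occur exactly once in `w`. -/
def writheOnce (p : Nanophrase.{u} ℤˣ) (w : List p.Letter) : ℤ :=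
  ∑ A, if w.count A = 1 then (p.proj A : ℤ) else 0

theorem exists_toSigns_eq (p : Nanophrase.{u} ℤˣ) :
    ∃ P : Nanophrase.{u} AlphaStar, P.toSigns = p := by
  refine ⟨p.map fun e => if e = 1 then AlphaStar.aPlus else AlphaStar.aMinus, ?_⟩
  have h : (fun A => AlphaStar.sign (if p.proj A = 1 then AlphaStar.aPlus else AlphaStar.aMinus))
      = p.proj := by
    funext A
    rcases Int.units_eq_one_or (p.proj A) with h | h <;> rw [h] <;> rfl
  cases p
  simp only [toSigns, map] at h ⊢
  congr

end Nanophrase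

/-! ### Pseudo-links -/

/-- The relation that generates the equivalence of nanophrases over `α₁` defining pseudo-links:
isomorphisms, cyclic shifts and permutations of words. -/
def PseudoLinkRel (p q : Nanophrase.{u} ℤˣ) : Prop :=
  Nanophrase.IsIsomorphic p q ∨ Nanophrase.IsShift id p q ∨ Nanophrase.IsPermutation id p q

/-- Pseudo-links: nanophrases over `α₁ = {1, -1}` considered up to isomorphism and up to
permutations and cyclic shifts of words. -/
def PseudoLink : Type (u + 1) := Quot PseudoLinkRel.{u}

theorem Nanophrase.writhe_eq_of_rel (p q : Nanophrase.{u} ℤˣ) (h : PseudoLinkRel p q) :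
    p.writhe = q.writhe := by
  have key : ∀ f : q.Letter ≃ p.Letter, (∀ B, q.proj B = p.proj (f B)) → p.writhe = q.writhe := by
    intro f hf
    simp only [writhe, hf]
    exact (Equiv.sum_comp f fun A => (p.proj A : ℤ)).symm
  rcases h with ⟨f, _, h⟩ | ⟨f, _, _, _, _, _, _, h⟩ | ⟨f, _, _, _, _, _, _, h⟩
  · exact key f h
  · exact key f fun B => by simpa using h B
  · exact key f fun B => by simpa using h B

/-- The pseudo-link represented by a nanophrase over `α₁`. -/
def Nanophrase.toPseudoLink (p : Nanophrase.{u} ℤˣ) : PseudoLink.{u} := Quot.mk _ p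

namespace PseudoLink

theorem exists_lift (p : PseudoLink.{u}) :
    ∃ P : Nanophrase.{u} AlphaStar, P.toSigns.toPseudoLink = p := by
  obtain ⟨q, rfl⟩ := Quot.exists_rep p
  obtain ⟨P, rfl⟩ := q.exists_toSigns_eq
  exact ⟨P, rfl⟩

/-- The bracket of a pseudo-link: the bracket of any nanophrase over `α_*` that projects to it.
(That the choice does not matter is something to be proved.) -/
noncomputable def bracket (p : PseudoLink.{u}) : ℤ[T;T⁻¹] := p.exists_lift.choose.bracket

/-- The writhe of a pseudo-link. -/
def writhe (p : PseudoLink.{u}) : ℤ := Quot.lift Nanophrase.writhe Nanophrase.writhe_eq_of_rel p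

/-- The Jones polynomial `J(p) = (-t)^{-3|p|} ⟨p⟩` of a pseudo-link. -/
noncomputable def jones (p : PseudoLink.{u}) : ℤ[T;T⁻¹] :=
  LaurentPolynomial.C ((-3 * p.writhe).negOnePow : ℤ) * LaurentPolynomial.T (-3 * p.writhe) *
    p.bracket

end PseudoLink

/-- The unit `t⁻²` of `ℤ[t, t⁻¹]`. -/
noncomputable def tInvSq : ℤ[T;T⁻¹]ˣ := (LaurentPolynomial.isUnit_T (-2)).unit

/-- The substitution `s = t⁻²`. -/
noncomputable def substInvSq : ℤ[T;T⁻¹] →+* ℤ[T;T⁻¹] :=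
  LaurentPolynomial.eval₂ LaurentPolynomial.C tInvSq

/-! ### Rank of a finite list of identifications -/

/-! Everything rests on one reading of the state sum. A state is a finite graph on the half-edges,
and its number of circles is the number of vertices minus the rank of its edge list
(`card_quot_add_rank`, `loops_add_rank`). With `d = -(t² + t⁻²)`, the bracket is therefore `d⁻¹
d^(4n + circles)` times a sum of `t^weight d^(-rank)` over the states. Negative powers of `d` occur,
so the computation is done in the field of fractions, where the image of `ℤ[t, t⁻¹]` is faithful.
The rank depends only on which predicates the edges respect (`rank_congr`), so lists of edges may be
rewritten up to propositional equivalence, and a vertex attached by a single edge costs exactly one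
factor `d⁻¹` (`nb_pendant`, `nb_reduce`).

At a crossing of given sign the two uncrossings are symmetric in the two passages: exchanging over
and under while keeping the sign changes nothing (`cross_equiv`, `phraseSum_flipPassage`). Hence the
bracket is a function `signSum` of the nanophrase over `{1, -1}`, which is invariant under
isomorphisms, shifts and permutations. This makes the bracket of a pseudo-link well defined.

The homotopy moves are local identities among at most three crossings (`nb_first_move`,
`nb_second_move`, `nb_third_move`). The letters that disappear are first kept as plain edges through
their half-edges, then sewn up by `nb_sew`. The third move needs `|A| = |B|` or `|B| = |C|`, a
condition met by all the triples of `S₁`. Reversing a word exchanges incoming and outgoing ends; a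
letter met once has its two uncrossings exchanged, which its change of sign compensates
(`cross_reversePassages`). The two expansions are the uncrossings of one letter, the non-oriented
one joining `z` to the reverse of `w`.

The Jones polynomial follows from the behaviour of the writhe. For a diagram, the cycles of `next`
are cut open into words to give a nanophrase, and the state sums of `J` and `V` agree term by term
after substitution. -/

namespace StateSum

variable {V W : Type*}

/-- The predicate `S` does not separate the ends of any pair in `E`. -/
def Resp (S : V → Prop) (E : List (V × V)) : Prop := ∀ p ∈ E, (S p.1 ↔ S p.2)

@[simp] theorem resp_nil (S : V → Prop) : Resp S [] := by simp [Resp]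

@[simp] theorem resp_cons (S : V → Prop) (p : V × V) (E : List (V × V)) :
    Resp S (p :: E) ↔ (S p.1 ↔ S p.2) ∧ Resp S E := by simp [Resp]

@[simp] theorem resp_append (S : V → Prop) (E F : List (V × V)) :
    Resp S (E ++ F) ↔ Resp S E ∧ Resp S F := by simp [Resp, or_imp, forall_and]

/-- Two vertices are identified by the pairs in `E`. -/
def Conn (E : List (V × V)) (a b : V) : Prop := ∀ S : V → Prop, Resp S E → (S a ↔ S b)

theorem Conn.refl (E : List (V × V)) (a : V) : Conn E a a := fun _ _ => Iff.rfl

theorem Conn.symm {E : List (V × V)} {a b : V} (h : Conn E a b) : Conn E b a :=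
  fun S hS => (h S hS).symm

theorem Conn.trans {E : List (V × V)} {a b c : V} (h : Conn E a b) (h' : Conn E b c) :
    Conn E a c := fun S hS => (h S hS).trans (h' S hS)

theorem Conn.of_mem {E : List (V × V)} {p : V × V} (h : p ∈ E) : Conn E p.1 p.2 :=
  fun _ hS => hS p h

/-- Connectivity is quantified over predicates; this supplies the predicate "connected to `x`" as a
test predicate. -/
theorem resp_conn (E : List (V × V)) (x : V) : Resp (Conn E x) E := fun _ hp =>
  ⟨fun h => h.trans (.of_mem hp), fun h => h.trans (Conn.of_mem hp).symm⟩

theorem Conn.mono {E F : List (V × V)} (h : ∀ p ∈ E, Conn F p.1 p.2) {a b : V}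
    (hab : Conn E a b) : Conn F a b :=
  fun S hS => hab S fun p hp => h p hp S hS

theorem conn_cons {E : List (V × V)} {p : V × V} {x y : V} :
    Conn (p :: E) x y ↔
      Conn E x y ∨ (Conn E x p.1 ∧ Conn E p.2 y) ∨ (Conn E x p.2 ∧ Conn E p.1 y) := by
  have hmono : ∀ {a b}, Conn E a b → Conn (p :: E) a b := fun h =>
    Conn.mono (fun q hq => Conn.of_mem (List.mem_cons_of_mem _ hq)) h
  have hp : Conn (p :: E) p.1 p.2 := Conn.of_mem List.mem_cons_self
  constructor
  · intro h
    -- The test predicate is the right-hand side itself, as a function of the end point. It respects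
    -- `p :: E` and holds at `x`.
    refine (h (fun y => Conn E x y ∨ (Conn E x p.1 ∧ Conn E p.2 y) ∨
      (Conn E x p.2 ∧ Conn E p.1 y)) ?_).1 (Or.inl (Conn.refl _ _))
    rw [resp_cons]
    refine ⟨?_, fun q hq => ?_⟩
    · have h1 := Conn.refl E p.1
      have h2 := Conn.refl E p.2
      constructor
      · rintro (h | ⟨h, -⟩ | ⟨h, -⟩)
        · exact Or.inr (Or.inl ⟨h, h2⟩)
        · exact Or.inr (Or.inl ⟨h, h2⟩)
        · exact Or.inl h
      · rintro (h | ⟨h, -⟩ | ⟨h, -⟩)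
        · exact Or.inr (Or.inr ⟨h, h1⟩)
        · exact Or.inl h
        · exact Or.inr (Or.inr ⟨h, h1⟩)
    · have key : ∀ z, Conn E z q.1 ↔ Conn E z q.2 := fun z => resp_conn E z q hq
      simp only [key]
  · rintro (h | ⟨h, h'⟩ | ⟨h, h'⟩)
    · exact hmono h
    · exact (hmono h).trans (hp.trans (hmono h'))
    · exact (hmono h).trans (hp.symm.trans (hmono h'))

theorem conn_cons_of_conn {E : List (V × V)} {p : V × V} (h : Conn E p.1 p.2) {x y : V} :
    Conn (p :: E) x y ↔ Conn E x y := by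
  rw [conn_cons]
  refine ⟨?_, Or.inl⟩
  rintro (h' | ⟨h1, h2⟩ | ⟨h1, h2⟩)
  · exact h'
  · exact h1.trans (h.trans h2)
  · exact h1.trans (h.symm.trans h2)

open Classical in
/-- The number of pairs in `E` that identify new vertices: the rank of the graph with edges `E`. -/
noncomputable def rank : List (V × V) → ℕ
  | [] => 0
  | p :: E => rank E + if Conn E p.1 p.2 then 0 else 1

theorem rank_cons_of_conn {E : List (V × V)} {p : V × V} (h : Conn E p.1 p.2) :
    rank (p :: E) = rank E := by simp [rank, h]

theorem rank_cons_of_not_conn {E : List (V × V)} {p : V × V} (h : ¬ Conn E p.1 p.2) :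
    rank (p :: E) = rank E + 1 := by simp [rank, h]

/-- The greedy count does not depend on the order. The only delicate case is when `E` connects the
ends of neither pair: then `p` becomes redundant after `q` exactly when `q` becomes redundant after
`p`, the exchange property of graphs. -/
theorem rank_swap (p q : V × V) (E : List (V × V)) : rank (p :: q :: E) = rank (q :: p :: E) := by
  by_cases hp : Conn E p.1 p.2
  · rw [rank_cons_of_conn ((conn_cons).2 (Or.inl hp))]
    by_cases hq : Conn E q.1 q.2
    · rw [rank_cons_of_conn hq, rank_cons_of_conn ((conn_cons).2 (Or.inl hq)),
        rank_cons_of_conn hp]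
    · rw [rank_cons_of_not_conn hq, rank_cons_of_not_conn
        (fun h => hq ((conn_cons_of_conn hp).1 h)), rank_cons_of_conn hp]
  · by_cases hq : Conn E q.1 q.2
    · rw [rank_cons_of_conn (p := q) ((conn_cons).2 (Or.inl hq)), rank_cons_of_not_conn hp,
        rank_cons_of_not_conn (fun h => hp ((conn_cons_of_conn hq).1 h)), rank_cons_of_conn hq]
    · have key : Conn (q :: E) p.1 p.2 ↔ Conn (p :: E) q.1 q.2 := by
        simp only [conn_cons, hp, hq, false_or]
        constructor
        · rintro (⟨h, h'⟩ | ⟨h, h'⟩)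
          · exact Or.inl ⟨h.symm, h'.symm⟩
          · exact Or.inr ⟨h', h⟩
        · rintro (⟨h, h'⟩ | ⟨h, h'⟩)
          · exact Or.inl ⟨h.symm, h'.symm⟩
          · exact Or.inr ⟨h', h⟩
      by_cases h : Conn (q :: E) p.1 p.2
      · rw [rank_cons_of_conn h, rank_cons_of_conn (key.1 h), rank_cons_of_not_conn hp,
          rank_cons_of_not_conn hq]
      · rw [rank_cons_of_not_conn h, rank_cons_of_not_conn (fun h' => h (key.2 h')),
          rank_cons_of_not_conn hp, rank_cons_of_not_conn hq]

theorem conn_perm {E F : List (V × V)} (h : E.Perm F) (a b : V) : Conn E a b ↔ Conn F a b :=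
  ⟨Conn.mono fun _ hp => .of_mem (h.mem_iff.1 hp), Conn.mono fun _ hp => .of_mem (h.mem_iff.2 hp)⟩

theorem rank_perm {E F : List (V × V)} (h : E.Perm F) : rank E = rank F := by
  induction h with
  | nil => rfl
  | @cons p E F h ih =>
    have hc := conn_perm h p.1 p.2
    by_cases hp : Conn E p.1 p.2
    · rw [rank_cons_of_conn hp, rank_cons_of_conn (hc.1 hp), ih]
    · rw [rank_cons_of_not_conn hp, rank_cons_of_not_conn (fun h => hp (hc.2 h)), ih]
  | swap p q E => exact rank_swap _ _ _
  | trans _ _ h1 h2 => exact h1.trans h2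

theorem rank_append_of_conn (F : List (V × V)) {E : List (V × V)}
    (h : ∀ p ∈ F, Conn E p.1 p.2) : rank (F ++ E) = rank E := by
  induction F with
  | nil => rfl
  | cons p F ih =>
    rw [List.cons_append, rank_cons_of_conn, ih fun q hq => h q (List.mem_cons_of_mem _ hq)]
    exact Conn.mono (fun q hq => .of_mem (List.mem_append_right _ hq)) (h p List.mem_cons_self)

/-- Each list makes the other redundant, so both ranks equal that of the concatenation. Consequently
an equality of ranks reduces to a propositional equivalence. -/
theorem rank_congr {E F : List (V × V)} (h : ∀ S : V → Prop, Resp S E ↔ Resp S F) :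
    rank E = rank F := by
  rw [← rank_append_of_conn F fun p hp S hS => (h S).1 hS p hp, rank_perm List.perm_append_comm,
    rank_append_of_conn E fun p hp S hS => (h S).2 hS p hp]

theorem conn_map {f : V → W} (hf : Function.Injective f) (E : List (V × V)) (a b : V) :
    Conn (E.map (Prod.map f f)) (f a) (f b) ↔ Conn E a b := by
  constructor
  · intro h S hS
    have := h (fun w => ∃ v, f v = w ∧ S v) ?_
    · simpa [hf.eq_iff] using this
    · intro p hp
      obtain ⟨q, hq, rfl⟩ := List.mem_map.1 hp
      simpa [hf.eq_iff] using hS q hq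
  · intro h S hS
    refine h (fun v => S (f v)) fun p hp => ?_
    exact hS _ (List.mem_map_of_mem hp)

theorem rank_map {f : V → W} (hf : Function.Injective f) (E : List (V × V)) :
    rank (E.map (Prod.map f f)) = rank E := by
  induction E with
  | nil => rfl
  | cons p E ih =>
    have hc : Conn _ (Prod.map f f p).1 (Prod.map f f p).2 ↔ _ := conn_map hf E p.1 p.2
    rw [List.map_cons]
    by_cases hp : Conn E p.1 p.2
    · rw [rank_cons_of_conn hp, rank_cons_of_conn (hc.2 hp), ih]
    · rw [rank_cons_of_not_conn hp, rank_cons_of_not_conn (fun h => hp (hc.1 h)), ih]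

/-- The vertex `m` does not occur in `E`. -/
def Fresh (m : V) (E : List (V × V)) : Prop := ∀ p ∈ E, p.1 ≠ m ∧ p.2 ≠ m

@[simp] theorem fresh_nil (m : V) : Fresh m [] := by simp [Fresh]

@[simp] theorem fresh_cons (m : V) (p : V × V) (E : List (V × V)) :
    Fresh m (p :: E) ↔ (p.1 ≠ m ∧ p.2 ≠ m) ∧ Fresh m E := by simp [Fresh]

@[simp] theorem fresh_append (m : V) (E F : List (V × V)) :
    Fresh m (E ++ F) ↔ Fresh m E ∧ Fresh m F := by
  simp only [Fresh, List.mem_append, or_imp, forall_and (p := fun p : V × V => p ∈ E → _)]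

theorem rank_pendant {m x : V} {E : List (V × V)} (hm : Fresh m E) (hx : x ≠ m) :
    rank ((x, m) :: E) = rank E + 1 := by
  refine rank_cons_of_not_conn fun h => hx ?_
  -- The predicate "equal to `m`" respects `E` because no edge touches `m`.
  exact (h (fun v => v = m) fun p hp => by simp [hm p hp]).2 rfl

/-- Induction on edges: a redundant edge leaves the classes alone, and any other edge merges exactly
two of them. -/
theorem card_quot_conn [Finite V] (E : List (V × V)) :
    Nat.card (Quot (Conn E)) + rank E = Nat.card V := by
  induction E with
  | nil =>
    refine Nat.card_congr (Equiv.ofBijective (Quot.lift id ?_) ⟨?_, ?_⟩)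
    · intro a b h
      exact ((h (fun v => v = b) (by simp)).2 rfl : a = b)
    · rintro ⟨a⟩ ⟨b⟩ (h : a = b)
      rw [h]
    · exact fun a => ⟨Quot.mk _ a, rfl⟩
  | cons p E ih =>
    by_cases h : Conn E p.1 p.2
    · rw [rank_cons_of_conn h, ← ih]
      congr 3
      funext a b
      exact propext (conn_cons_of_conn h)
    · rw [rank_cons_of_not_conn h, ← ih]
      have hE : Equivalence (Conn E) := ⟨Conn.refl E, Conn.symm, Conn.trans⟩
      have hpE : Equivalence (Conn (p :: E)) := ⟨Conn.refl _, Conn.symm, Conn.trans⟩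
      have hle : ∀ a b, Conn E a b → Conn (p :: E) a b := fun a b h => conn_cons.2 (Or.inl h)
      -- The class of `p.2` is absorbed by that of `p.1`, so the old classes other than that of
      -- `p.2` represent the new ones exactly once.
      have hbij : Function.Bijective
          (fun x : {x : Quot (Conn E) // x ≠ Quot.mk _ p.2} => Quot.map id hle x.1) := by
        constructor
        · rintro ⟨⟨a⟩, ha⟩ ⟨⟨b⟩, hb⟩ hab
          have hab := (hpE.quot_mk_eq_iff a b).1 hab
          have ha : ¬ Conn E a p.2 := fun h => ha ((hE.quot_mk_eq_iff _ _).2 h)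
          have hb : ¬ Conn E b p.2 := fun h => hb ((hE.quot_mk_eq_iff _ _).2 h)
          refine Subtype.ext ((hE.quot_mk_eq_iff _ _).2 ?_)
          rcases conn_cons.1 hab with h | ⟨-, h⟩ | ⟨h, -⟩
          · exact h
          · exact absurd h.symm hb
          · exact absurd h ha
        · rintro ⟨a⟩
          by_cases ha : Conn E a p.2
          · refine ⟨⟨Quot.mk _ p.1, fun h' => h ((hE.quot_mk_eq_iff _ _).1 h')⟩, ?_⟩
            exact (hpE.quot_mk_eq_iff _ _).2
              ((Conn.of_mem List.mem_cons_self).trans (hle _ _ ha).symm)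
          · exact ⟨⟨Quot.mk _ a, fun h' => ha ((hE.quot_mk_eq_iff _ _).1 h')⟩, rfl⟩
      rw [← Nat.card_congr (Equiv.ofBijective _ hbij)]
      have := Fintype.ofFinite (Quot (Conn E))
      classical
      rw [Nat.card_eq_fintype_card, Nat.card_eq_fintype_card, Fintype.card_subtype_compl,
        Fintype.card_subtype_eq]
      have : 0 < Fintype.card (Quot (Conn E)) := Fintype.card_pos_iff.2 ⟨Quot.mk _ p.1⟩
      omega

/-- A quotient is determined by the predicates that descend to it, so the count applies to any
relation that respects the same predicates as `E`, in particular to the one that defines the loops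
of a state. -/
theorem card_quot_add_rank [Finite V] {r : V → V → Prop} {E : List (V × V)}
    (h : ∀ S : V → Prop, (∀ a b, r a b → (S a ↔ S b)) ↔ Resp S E) :
    Nat.card (Quot r) + rank E = Nat.card V := by
  rw [← card_quot_conn E]
  have h1 : ∀ a b, r a b → Conn E a b := fun a b hab S hS => (h S).2 hS a b hab
  have h2 : ∀ a b, Conn E a b → (Quot.mk r a = Quot.mk r b) := fun a b hab =>
    ((hab (fun v => Quot.mk r a = Quot.mk r v)
      ((h _).1 fun c d hcd => by rw [Quot.sound hcd])).1 rfl)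
  congr 1
  refine Nat.card_congr ⟨Quot.map id h1, Quot.lift (Quot.mk r) h2, ?_, ?_⟩
  · rintro ⟨a⟩; rfl
  · rintro ⟨a⟩; rfl

end StateSum

/-! ### State sums of lists of crossings -/

namespace StateSum

variable {V W : Type*}

/-- The field of fractions of `ℤ[t, t⁻¹]`. -/
abbrev FracField : Type := FractionRing ℤ[T;T⁻¹]

/-- The indeterminate `t`. -/
noncomputable def tt : FracField := algebraMap ℤ[T;T⁻¹] _ (LaurentPolynomial.T 1)

/-- The value of a circle. -/
noncomputable def dd : FracField := -(tt ^ (2 : ℤ) + tt ^ (-2 : ℤ))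

theorem algebraMap_injective : Function.Injective (algebraMap ℤ[T;T⁻¹] FracField) :=
  IsFractionRing.injective _ _

theorem tt_ne_zero : tt ≠ 0 := by
  refine (map_ne_zero_iff _ algebraMap_injective).2 ?_
  exact (LaurentPolynomial.isUnit_T 1).ne_zero

theorem algebraMap_T (n : ℤ) :
    algebraMap ℤ[T;T⁻¹] FracField (LaurentPolynomial.T n) = tt ^ n := by
  have key : ∀ m : ℕ, algebraMap ℤ[T;T⁻¹] FracField (LaurentPolynomial.T m) = tt ^ m := fun m => by
    rw [tt, ← map_pow, LaurentPolynomial.T_pow, mul_one]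
  obtain ⟨m, rfl | rfl⟩ := n.eq_nat_or_neg
  · rw [key, zpow_natCast]
  · rw [zpow_neg, zpow_natCast, ← key]
    refine eq_inv_of_mul_eq_one_left ?_
    rw [← map_mul, ← LaurentPolynomial.T_add, neg_add_cancel, LaurentPolynomial.T_zero, map_one]

theorem algebraMap_circle : algebraMap ℤ[T;T⁻¹] FracField
    (-(LaurentPolynomial.T 2 + LaurentPolynomial.T (-2))) = dd := by
  rw [map_neg, map_add, algebraMap_T, algebraMap_T, dd]

theorem dd_ne_zero : dd ≠ 0 := by
  rw [← algebraMap_circle]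
  refine (map_ne_zero_iff _ algebraMap_injective).2 fun h => ?_
  -- At `t = 1` the value of a circle is `-2`.
  have := congrArg (LaurentPolynomial.eval₂ (RingHom.id ℤ) 1) h
  simp at this

/-- A crossing of sign `sign` with two passages, from `i` to `o` and from `i'` to `o'`. -/
structure Cross (V : Type*) where
  sign : ℤˣ
  i : V
  o : V
  i' : V
  o' : V

namespace Cross

/-- The identifications in the uncrossing that respects the orientation. -/
def par (c : Cross V) : List (V × V) := [(c.i, c.o'), (c.i', c.o)]

/-- The identifications in the uncrossing that does not respect the orientation. -/
def alt (c : Cross V) : List (V × V) := [(c.i, c.i'), (c.o, c.o')]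

/-- The image of a crossing under a map of vertices. -/
def map (f : V → W) (c : Cross V) : Cross W := ⟨c.sign, f c.i, f c.o, f c.i', f c.o'⟩

/-- The crossings `c` and `c'` have the same uncrossings with the same coefficients. -/
def Equiv (c c' : Cross V) : Prop :=
  (c.sign = c'.sign ∧ (∀ S, Resp S c.par ↔ Resp S c'.par) ∧ ∀ S, Resp S c.alt ↔ Resp S c'.alt) ∨
  (c.sign = -c'.sign ∧ (∀ S, Resp S c.par ↔ Resp S c'.alt) ∧ ∀ S, Resp S c.alt ↔ Resp S c'.par)

/-- The vertex `m` does not occur in the crossing `c`. -/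
def Avoids (m : V) (c : Cross V) : Prop := c.i ≠ m ∧ c.o ≠ m ∧ c.i' ≠ m ∧ c.o' ≠ m

end Cross

/-- The state sum of a list of crossings in a graph with edges `E`, normalized so that it is the
sum of `d ^ (-rank)` over all states. -/
noncomputable def nb : List (V × V) → List (Cross V) → FracField
  | E, [] => dd⁻¹ ^ rank E
  | E, c :: cs => tt ^ (c.sign : ℤ) * nb (c.par ++ E) cs + tt ^ (-(c.sign : ℤ)) * nb (c.alt ++ E) cs

theorem nb_congr {E F : List (V × V)} (h : ∀ S : V → Prop, Resp S E ↔ Resp S F)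
    (cs : List (Cross V)) : nb E cs = nb F cs := by
  induction cs generalizing E F with
  | nil => rw [nb, nb, rank_congr h]
  | cons c cs ih =>
    rw [nb, nb, ih (E := c.par ++ E) (F := c.par ++ F) fun S => by simp [h],
      ih (E := c.alt ++ E) (F := c.alt ++ F) fun S => by simp [h]]

theorem resp_perm {E F : List (V × V)} (h : E.Perm F) (S : V → Prop) : Resp S E ↔ Resp S F := by
  simp [Resp, h.mem_iff]

theorem nb_perm {E F : List (V × V)} (h : E.Perm F) (cs : List (Cross V)) : nb E cs = nb F cs :=
  nb_congr (resp_perm h) cs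

theorem nb_cross_perm (E : List (V × V)) {cs cs' : List (Cross V)} (h : cs.Perm cs') :
    nb E cs = nb E cs' := by
  induction h generalizing E with
  | nil => rfl
  | cons c _ ih => rw [nb, nb, ih, ih]
  | swap c c' cs =>
    have key : ∀ F G : List (V × V), nb (F ++ (G ++ E)) cs = nb (G ++ (F ++ E)) cs := fun F G =>
      nb_congr (fun S => by simp only [resp_append]; tauto) cs
    simp only [nb]
    rw [key c.par c'.par, key c.par c'.alt, key c.alt c'.par, key c.alt c'.alt]
    ring
  | trans _ _ h1 h2 => exact (h1 E).trans (h2 E)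

theorem nb_cross_congr {ι : Type*} {f g : ι → Cross V} (E : List (V × V)) {l : List ι}
    (h : ∀ a ∈ l, (f a).Equiv (g a)) : nb E (l.map f) = nb E (l.map g) := by
  induction l generalizing E with
  | nil => rfl
  | cons a l ih =>
    have ih := fun E => ih E fun b hb => h b (List.mem_cons_of_mem _ hb)
    have hc : ∀ {F G : List (V × V)}, (∀ S, Resp S F ↔ Resp S G) →
        nb (F ++ E) (l.map g) = nb (G ++ E) (l.map g) := fun h =>
      nb_congr (fun S => by simp [h]) _
    simp only [List.map_cons, nb, ih]
    rcases h a List.mem_cons_self with ⟨h1, h2, h3⟩ | ⟨h1, h2, h3⟩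
    · rw [h1, hc h2, hc h3]
    · rw [h1, hc h2, hc h3, Units.val_neg, neg_neg, add_comm]

theorem nb_map {f : V → W} (hf : Function.Injective f) (E : List (V × V)) (cs : List (Cross V)) :
    nb (E.map (Prod.map f f)) (cs.map (Cross.map f)) = nb E cs := by
  induction cs generalizing E with
  | nil => rw [List.map_nil, nb, nb, rank_map hf]
  | cons c cs ih =>
    rw [List.map_cons, nb, nb, ← ih, ← ih, List.map_append, List.map_append]
    rfl

/-- No crossing touches `m`, so `m` stays pendant in every state and raises each rank by one. -/
theorem nb_pendant {m x : V} (hx : x ≠ m) {E : List (V × V)} {cs : List (Cross V)}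
    (hE : Fresh m E) (hcs : ∀ c ∈ cs, c.Avoids m) : nb ((x, m) :: E) cs = dd⁻¹ * nb E cs := by
  induction cs generalizing E with
  | nil => rw [nb, nb, rank_pendant hE hx, pow_succ']
  | cons c cs ih =>
    have ih := fun E hE => ih (E := E) hE fun c hc => hcs c (List.mem_cons_of_mem _ hc)
    have hc := hcs c List.mem_cons_self
    have key : ∀ F, nb (F ++ (x, m) :: E) cs = nb ((x, m) :: (F ++ E)) cs := fun F =>
      nb_perm List.perm_middle _
    have h1 : Fresh m (c.par ++ E) := by simp [Cross.par, hE, hc.1, hc.2.1, hc.2.2.1, hc.2.2.2]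
    have h2 : Fresh m (c.alt ++ E) := by simp [Cross.alt, hE, hc.1, hc.2.1, hc.2.2.1, hc.2.2.2]
    rw [nb, nb, key, key, ih _ h1, ih _ h2]
    ring

/-- Replacing identifications `L` by equivalent ones, of which `A` attach new vertices. -/
theorem nb_reduce (L A F : List (V × V)) {E : List (V × V)} {cs : List (Cross V)}
    (h : ∀ S : V → Prop, Resp S L ↔ Resp S A ∧ Resp S F) (hA : (A.map Prod.snd).Nodup)
    (hA' : ∀ m ∈ A.map Prod.snd, m ∉ A.map Prod.fst ∧ Fresh m F ∧ Fresh m E ∧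
      ∀ c ∈ cs, c.Avoids m) :
    nb (L ++ E) cs = dd⁻¹ ^ A.length * nb (F ++ E) cs := by
  have h' : nb (L ++ E) cs = nb (A ++ (F ++ E)) cs :=
    nb_congr (fun S => by simp [h, and_assoc]) _
  rw [h']
  clear h h'
  induction A with
  | nil => simp
  | cons p A ih =>
    obtain ⟨h1, h2, h3, h4⟩ := hA' p.2 (by simp)
    rw [List.map_cons, List.nodup_cons] at hA
    have ih := ih hA.2 fun m hm => by
      obtain ⟨h1, h2⟩ := hA' m (by simp only [List.map_cons, List.mem_cons]; exact Or.inr hm)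
      exact ⟨fun h => h1 (by simp only [List.map_cons, List.mem_cons]; exact Or.inr h), h2⟩
    have hfr : Fresh p.2 (A ++ (F ++ E)) := by
      rw [fresh_append, fresh_append]
      refine ⟨fun q hq => ⟨fun h => h1 ?_, fun h => hA.1 ?_⟩, h2, h3⟩
      · rw [← h]; exact List.mem_map_of_mem (List.mem_cons_of_mem _ hq)
      · rw [← h]; exact List.mem_map_of_mem hq
    have hne : p.1 ≠ p.2 := fun h => h1 (by simp [h])
    rw [List.cons_append, nb_pendant (x := p.1) hne hfr h4, ih, List.length_cons, pow_succ',
      mul_assoc]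

end StateSum

/-! ### The three homotopy moves as local identities of state sums -/

namespace StateSum

variable {V W : Type*}

/-- The right side keeps the two passages of the removed crossing as plain edges, so that both sides
have the same vertices. The oriented uncrossing splits off a circle through `b` and `c` and saves
one `dd⁻¹`; the other one yields an arc from `a` to `e`. What remains is `t^s d + t^(-s) = -t^(3s)`.
-/
theorem nb_first_move (s : ℤˣ) {a b c e : V} (hn : [a, b, c, e].Nodup) {E : List (V × V)}
    {cs : List (Cross V)} (hE : ∀ m ∈ [b, c], Fresh m E)
    (hcs : ∀ m ∈ [b, c], ∀ k ∈ cs, k.Avoids m) :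
    nb ((b, c) :: E) (⟨s, a, b, c, e⟩ :: cs) =
      -tt ^ (3 * (s : ℤ)) * nb ((a, b) :: (c, e) :: (b, c) :: E) cs := by
  simp only [List.nodup_cons, List.mem_cons, List.not_mem_nil, or_false, not_or] at hn
  simp only [List.forall_mem_cons, List.not_mem_nil, IsEmpty.forall_iff, implies_true,
    and_true] at hE hcs
  change nb ([(b, c)] ++ E) _ = _ * nb ([(a, b), (c, e), (b, c)] ++ E) cs
  simp only [nb, Cross.par, Cross.alt, ← List.append_assoc]
  rw [nb_reduce (_ ++ _) [(b, c)] [(a, e)] (by simp only [resp_append, resp_cons, resp_nil]; grind) (by simp)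
      (by simp; grind),
    nb_reduce (_ ++ _) [(a, b), (a, c)] [(a, e)] (by simp only [resp_append, resp_cons, resp_nil]; grind)
      (by simp; grind) (by simp; grind),
    nb_reduce [(a, b), _, _] [(a, b), (a, c)] [(a, e)]
      (by simp only [resp_cons, resp_nil]; grind) (by simp; grind) (by simp; grind)]
  have h : tt * tt⁻¹ = 1 := mul_inv_cancel₀ tt_ne_zero
  have h' : dd * dd⁻¹ = 1 := mul_inv_cancel₀ dd_ne_zero
  generalize nb _ cs = X
  suffices tt ^ (s : ℤ) * dd + tt ^ (-(s : ℤ)) = -tt ^ (3 * (s : ℤ)) by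
    simp only [List.length_cons, List.length_nil]
    linear_combination dd⁻¹ ^ 2 * X * this - tt ^ (s : ℤ) * dd⁻¹ * X * h'
  have h0 := tt_ne_zero
  rw [dd]
  rcases Int.units_eq_one_or s with rfl | rfl <;>
    simp only [Units.val_one, Units.val_neg, mul_one, mul_neg, neg_neg] <;> field_simp <;> ring

/-- Of the four states, only the one with both crossings uncrossed by `alt` connects the ends as on
the right. The other three have a common connection pattern and cancel, since `t^(2s) + t^(-2s) =
-d` and the doubly oriented state contains an extra circle. -/
theorem nb_second_move (s : ℤˣ) {p q r s' w x y z : V} (hn : [p, q, r, s', w, x, y, z].Nodup)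
    {E : List (V × V)} {cs : List (Cross V)} (hE : ∀ m ∈ [q, w, z, r], Fresh m E)
    (hcs : ∀ m ∈ [q, w, z, r], ∀ k ∈ cs, k.Avoids m) :
    nb ((q, w) :: (z, r) :: E) (⟨s, p, q, r, s'⟩ :: ⟨-s, w, x, y, z⟩ :: cs) =
      nb ((p, q) :: (r, s') :: (w, x) :: (y, z) :: (q, w) :: (z, r) :: E) cs := by
  simp only [List.nodup_cons, List.mem_cons, List.not_mem_nil, or_false, not_or] at hn
  simp only [List.forall_mem_cons, List.not_mem_nil, IsEmpty.forall_iff, implies_true,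
    and_true] at hE hcs
  change nb ([(q, w), (z, r)] ++ E) _ =
    nb ([(p, q), (r, s'), (w, x), (y, z), (q, w), (z, r)] ++ E) cs
  simp only [nb, Cross.par, Cross.alt, ← List.append_assoc]
  rw [nb_reduce (_ ++ _ ++ _) [(q, w), (q, z), (q, r)] [(p, s'), (x, y)]
      (by simp only [resp_append, resp_cons, resp_nil]; grind) (by simp; grind) (by simp; grind),
    nb_reduce (_ ++ _ ++ _) [(x, q), (x, w), (x, z), (x, r)] [(p, s'), (x, y)]
      (by simp only [resp_append, resp_cons, resp_nil]; grind) (by simp; grind) (by simp; grind),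
    nb_reduce (_ ++ _ ++ _) [(p, q), (p, w), (p, z), (p, r)] [(p, s'), (x, y)]
      (by simp only [resp_append, resp_cons, resp_nil]; grind) (by simp; grind) (by simp; grind),
    nb_reduce (_ ++ _ ++ _) [(p, z), (p, r), (y, q), (y, w)] [(p, x), (y, s')]
      (by simp only [resp_append, resp_cons, resp_nil]; grind) (by simp; grind) (by simp; grind),
    nb_reduce [(p, q), _, _, _, _, _] [(p, q), (p, w), (y, z), (y, r)] [(p, x), (y, s')]
      (by simp only [resp_cons, resp_nil]; grind) (by simp; grind) (by simp; grind)]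
  have h : tt ^ (s : ℤ) * tt ^ (-(s : ℤ)) = 1 := by
    rw [← zpow_add₀ tt_ne_zero, add_neg_cancel, zpow_zero]
  have h' : dd * dd⁻¹ = 1 := mul_inv_cancel₀ dd_ne_zero
  have h2 : tt ^ (s : ℤ) * tt ^ (s : ℤ) + tt ^ (-(s : ℤ)) * tt ^ (-(s : ℤ)) = -dd := by
    rw [← zpow_add₀ tt_ne_zero, ← zpow_add₀ tt_ne_zero, dd]
    rcases Int.units_eq_one_or s with rfl | rfl <;> norm_num [add_comm]
  simp only [List.length_cons, List.length_nil, Units.val_neg, neg_neg]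
  generalize nb _ cs = X
  generalize nb _ cs = Y
  linear_combination (dd⁻¹ ^ 3 * X + dd⁻¹ ^ 4 * Y) * h + dd⁻¹ ^ 4 * X * h2 - dd⁻¹ ^ 3 * X * h'

/-- Both sides use the same three strands and only reattach the crossings to other passages. Each
side has eight states. Those with no `alt`, with `alt` at `B` and `C` only, or at `A` and `B` only
have the same connections on both sides. The other five connect the outer ends by one of two
patterns `M`, `N`, exchanged between the sides. If `sA = sB`, the states with `alt` only at `A` and
only at `B` balance each other, and three states with `alt` at `C` are left, with coefficients
proportional to `t^(2 sB)`, `d` (from an extra circle) and `t^(-2 sB)`, whose sum vanishes. If `sB =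
sC`, the roles of `A` and `C` are interchanged. -/
theorem nb_third_move (sA sB sC : ℤˣ) (hs : sA = sB ∨ sB = sC)
    {i₁ o₁ i₂ o₂ j₁ p₁ j₂ p₂ k₁ q₁ k₂ q₂ : V}
    (hn : [i₁, o₁, i₂, o₂, j₁, p₁, j₂, p₂, k₁, q₁, k₂, q₂].Nodup)
    {E : List (V × V)} {cs : List (Cross V)} (hE : ∀ m ∈ [o₁, j₁, o₂, k₁, p₂, k₂], Fresh m E)
    (hcs : ∀ m ∈ [o₁, j₁, o₂, k₁, p₂, k₂], ∀ c ∈ cs, c.Avoids m) :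
    nb ((o₁, j₁) :: (o₂, k₁) :: (p₂, k₂) :: E)
        (⟨sA, i₁, o₁, i₂, o₂⟩ :: ⟨sB, j₁, p₁, j₂, p₂⟩ :: ⟨sC, k₁, q₁, k₂, q₂⟩ :: cs) =
      nb ((o₁, j₁) :: (o₂, k₁) :: (p₂, k₂) :: E)
        (⟨sA, j₁, p₁, k₁, q₁⟩ :: ⟨sB, i₁, o₁, k₂, q₂⟩ :: ⟨sC, i₂, o₂, j₂, p₂⟩ :: cs) := by
  simp only [List.nodup_cons, List.mem_cons, List.not_mem_nil, or_false, not_or] at hn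
  simp only [List.forall_mem_cons, List.not_mem_nil, IsEmpty.forall_iff, implies_true,
    and_true] at hE hcs
  have h0 : ∀ E' : List (V × V), (o₁, j₁) :: (o₂, k₁) :: (p₂, k₂) :: E' =
    [(o₁, j₁), (o₂, k₁), (p₂, k₂)] ++ E' := fun _ => rfl
  rw [h0]
  clear h0
  simp only [nb, Cross.par, Cross.alt, ← List.append_assoc]
  rw [nb_reduce (_ ++ _ ++ _ ++ _) [(i₁, o₂), (i₁, k₁), (i₂, o₁), (i₂, j₁), (i₂, p₂), (i₂, k₂)]
    [(i₁, q₂), (p₁, j₂), (i₂, q₁)] (by simp only [resp_append, resp_cons, resp_nil]; grind) (by simp; grind) (by simp; grind)]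
  rw [nb_reduce (_ ++ _ ++ _ ++ _) [(i₁, o₁), (i₁, j₁), (i₁, o₂), (i₁, k₁), (i₁, p₂), (i₁, k₂)]
    [(i₁, i₂), (p₁, j₂), (q₁, q₂)] (by simp only [resp_append, resp_cons, resp_nil]; grind) (by simp; grind) (by simp; grind)]
  rw [nb_reduce (_ ++ _ ++ _ ++ _) [(i₁, o₂), (i₁, k₁), (p₁, p₂), (p₁, k₂), (i₂, o₁), (i₂, j₁)]
    [(i₁, q₂), (p₁, q₁), (i₂, j₂)] (by simp only [resp_append, resp_cons, resp_nil]; grind) (by simp; grind) (by simp; grind)]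
  rw [nb_reduce (_ ++ _ ++ _ ++ _) [(i₁, o₂), (i₁, k₁), (i₁, p₂), (i₁, k₂), (i₂, o₁), (i₂, j₁)]
    [(i₁, p₁), (i₂, j₂), (q₁, q₂)] (by simp only [resp_append, resp_cons, resp_nil]; grind) (by simp; grind) (by simp; grind)]
  rw [nb_reduce (_ ++ _ ++ _ ++ _) [(q₁, o₁), (q₁, j₁), (q₁, o₂), (q₁, k₁), (q₁, p₂), (q₁, k₂)]
    [(i₁, i₂), (p₁, j₂), (q₁, q₂)] (by simp only [resp_append, resp_cons, resp_nil]; grind) (by simp; grind) (by simp; grind)]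
  rw [nb_reduce (_ ++ _ ++ _ ++ _) [(o₁, j₁), (o₁, o₂), (o₁, k₁), (o₁, p₂), (o₁, k₂)]
    [(i₁, i₂), (p₁, j₂), (q₁, q₂)] (by simp only [resp_append, resp_cons, resp_nil]; grind) (by simp; grind) (by simp; grind)]
  rw [nb_reduce (_ ++ _ ++ _ ++ _) [(p₁, p₂), (p₁, k₂), (j₂, o₁), (j₂, j₁), (j₂, o₂), (j₂, k₁)]
    [(i₁, i₂), (p₁, q₁), (j₂, q₂)] (by simp only [resp_append, resp_cons, resp_nil]; grind) (by simp; grind) (by simp; grind)]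
  rw [nb_reduce (_ ++ _ ++ _ ++ _) [(p₁, o₁), (p₁, j₁), (p₁, o₂), (p₁, k₁), (p₁, p₂), (p₁, k₂)]
    [(i₁, i₂), (p₁, j₂), (q₁, q₂)] (by simp only [resp_append, resp_cons, resp_nil]; grind) (by simp; grind) (by simp; grind)]
  rw [nb_reduce (_ ++ _ ++ _ ++ _) [(p₁, o₂), (p₁, k₁), (i₂, o₁), (i₂, j₁), (i₂, p₂), (i₂, k₂)]
    [(i₁, q₂), (p₁, j₂), (i₂, q₁)] (by simp only [resp_append, resp_cons, resp_nil]; grind) (by simp; grind) (by simp; grind)]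
  rw [nb_reduce (_ ++ _ ++ _ ++ _) [(p₁, o₁), (p₁, j₁), (p₁, o₂), (p₁, k₁), (p₁, p₂), (p₁, k₂)]
    [(i₁, q₂), (p₁, q₁), (i₂, j₂)] (by simp only [resp_append, resp_cons, resp_nil]; grind) (by simp; grind) (by simp; grind)]
  rw [nb_reduce (_ ++ _ ++ _ ++ _) [(i₁, p₂), (i₁, k₂), (p₁, o₂), (p₁, k₁), (q₁, o₁), (q₁, j₁)]
    [(i₁, i₂), (p₁, j₂), (q₁, q₂)] (by simp only [resp_append, resp_cons, resp_nil]; grind) (by simp; grind) (by simp; grind)]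
  rw [nb_reduce (_ ++ _ ++ _ ++ _) [(i₁, o₂), (i₁, k₁), (i₁, p₂), (i₁, k₂), (q₁, o₁), (q₁, j₁)]
    [(i₁, p₁), (i₂, j₂), (q₁, q₂)] (by simp only [resp_append, resp_cons, resp_nil]; grind) (by simp; grind) (by simp; grind)]
  rw [nb_reduce (_ ++ _ ++ _ ++ _) [(i₂, o₁), (i₂, j₁), (i₂, o₂), (i₂, k₁), (i₂, p₂), (i₂, k₂)]
    [(i₁, q₂), (p₁, q₁), (i₂, j₂)] (by simp only [resp_append, resp_cons, resp_nil]; grind) (by simp; grind) (by simp; grind)]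
  rw [nb_reduce (_ ++ _ ++ _ ++ _) [(o₁, j₁), (o₁, o₂), (o₁, k₁), (o₁, p₂), (o₁, k₂)]
    [(i₁, q₂), (p₁, q₁), (i₂, j₂)] (by simp only [resp_append, resp_cons, resp_nil]; grind) (by simp; grind) (by simp; grind)]
  rw [nb_reduce (_ ++ _ ++ _ ++ _) [(i₁, p₂), (i₁, k₂), (j₂, o₁), (j₂, j₁), (j₂, o₂), (j₂, k₁)]
    [(i₁, i₂), (p₁, q₁), (j₂, q₂)] (by simp only [resp_append, resp_cons, resp_nil]; grind) (by simp; grind) (by simp; grind)]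
  rw [nb_reduce (_ ++ _ ++ _ ++ _) [(i₁, o₁), (i₁, j₁), (i₁, o₂), (i₁, k₁), (i₁, p₂), (i₁, k₂)]
    [(i₁, q₂), (p₁, q₁), (i₂, j₂)] (by simp only [resp_append, resp_cons, resp_nil]; grind) (by simp; grind) (by simp; grind)]
  simp only [List.length_cons, List.length_nil]
  have h : tt ^ (sB : ℤ) * tt ^ (-(sB : ℤ)) = 1 := by
    rw [← zpow_add₀ tt_ne_zero, add_neg_cancel, zpow_zero]
  have h' : dd * dd⁻¹ = 1 := mul_inv_cancel₀ dd_ne_zero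
  have h2 : tt ^ (sB : ℤ) * tt ^ (sB : ℤ) + tt ^ (-(sB : ℤ)) * tt ^ (-(sB : ℤ)) = -dd := by
    rw [← zpow_add₀ tt_ne_zero, ← zpow_add₀ tt_ne_zero, dd]
    rcases Int.units_eq_one_or sB with rfl | rfl <;> norm_num [add_comm]
  -- `M` and `N` are the only connection patterns on which the two sides differ.
  generalize nb ([(i₁, i₂), (p₁, j₂), (q₁, q₂)] ++ E) cs = M
  generalize nb ([(i₁, q₂), (p₁, q₁), (i₂, j₂)] ++ E) cs = N
  rcases hs with rfl | rfl
  · linear_combination tt ^ (-(sC : ℤ)) * (M - N) *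
      (dd⁻¹ ^ 6 * h2 + dd⁻¹ ^ 5 * h - dd⁻¹ ^ 5 * h')
  · linear_combination tt ^ (-(sA : ℤ)) * (M - N) *
      (dd⁻¹ ^ 6 * h2 + dd⁻¹ ^ 5 * h - dd⁻¹ ^ 5 * h')

end StateSum

/-! ### Paths through crossings -/

namespace StateSum

variable {V X : Type*}

section Path

variable (i o : X → V)

/-- The edges of a path from `u` to `v` through the passages `w`; the passage `x` is entered at
`i x` and left at `o x`. -/
def path : V → List X → V → List (V × V)
  | u, [], v => [(u, v)]
  | u, x :: w, v => (u, i x) :: path (o x) w v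

/-- The edges of the closed path through the passages `w`. -/
def cyc : List X → List (V × V)
  | [] => []
  | x :: w => path i o (o x) w (i x)

variable {i o}

theorem path_append_cons (u v : V) (w : List X) (x : X) (z : List X) :
    path i o u (w ++ x :: z) v = path i o u w (i x) ++ path i o (o x) z v := by
  induction w generalizing u with
  | nil => rfl
  | cons y w ih => simp [path, ih]

/-- Splits off the last edge uniformly in the end point, so that the end point can be varied or
dropped; `path_head` does the same for the first edge. -/
theorem path_last (u : V) (w : List X) :
    ∃ F p, ∀ m, path i o u w m = F ++ [(p, m)] := by
  induction w generalizing u with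
  | nil => exact ⟨[], u, fun _ => rfl⟩
  | cons x w ih =>
    obtain ⟨F, p, h⟩ := ih (o x)
    exact ⟨(u, i x) :: F, p, fun m => by simp [path, h]⟩

theorem path_head (w : List X) (v : V) :
    ∃ q G, ∀ m, path i o m w v = (m, q) :: G := by
  cases w with
  | nil => exact ⟨v, [], fun _ => rfl⟩
  | cons x w => exact ⟨i x, path i o (o x) w v, fun _ => rfl⟩

theorem path_append {F : List (V × V)} {p q u v : V} {G : List (V × V)} {w z : List X}
    (hF : ∀ m, path i o u w m = F ++ [(p, m)]) (hG : ∀ m, path i o m z v = (m, q) :: G) :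
    path i o u (w ++ z) v = F ++ (p, q) :: G := by
  cases z with
  | nil =>
    have := hG u
    simp only [path, List.cons.injEq, Prod.mk.injEq, true_and] at this
    obtain ⟨rfl, rfl⟩ := this
    rw [List.append_nil, hF]
  | cons x z =>
    have := hG u
    simp only [path, List.cons.injEq, Prod.mk.injEq, true_and] at this
    obtain ⟨rfl, rfl⟩ := this
    rw [path_append_cons, hF]
    simp

theorem fresh_path {m u v : V} {w : List X} (hu : u ≠ m) (hv : v ≠ m)
    (hw : ∀ x ∈ w, i x ≠ m ∧ o x ≠ m) : Fresh m (path i o u w v) := by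
  induction w generalizing u with
  | nil => simp [path, hu, hv]
  | cons x w ih =>
    rw [path, fresh_cons]
    exact ⟨⟨hu, (hw x (by simp)).1⟩, ih (hw x (by simp)).2 fun y hy => hw y (by simp [hy])⟩

theorem fresh_cyc {m : V} {w : List X} (hw : ∀ x ∈ w, i x ≠ m ∧ o x ≠ m) :
    Fresh m (cyc i o w) := by
  cases w with
  | nil => simp [cyc]
  | cons x w =>
    exact fresh_path (hw x (by simp)).2 (hw x (by simp)).1 fun y hy => hw y (by simp [hy])

/-- Identifications have no direction, so a path may be read backwards provided that entrances and
exits exchange roles. -/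
theorem resp_path_reverse (S : V → Prop) (u v : V) (w : List X) :
    Resp S (path i o u w v) ↔ Resp S (path o i v w.reverse u) := by
  induction w generalizing u with
  | nil => simp [path, iff_comm]
  | cons x w ih =>
    rw [List.reverse_cons, path_append_cons, resp_append, ← ih]
    simp only [path, resp_cons, resp_nil, and_true]
    rw [and_comm, iff_comm (a := S u)]

theorem path_map {W Y : Type*} {i' o' : Y → W} {f : V → W} {g : X → Y}
    {w : List X} (hi : ∀ x ∈ w, f (i x) = i' (g x)) (ho : ∀ x ∈ w, f (o x) = o' (g x)) (u v : V) :
    (path i o u w v).map (Prod.map f f) = path i' o' (f u) (w.map g) (f v) := by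
  induction w generalizing u with
  | nil => rfl
  | cons x w ih =>
    simp only [path, List.map_cons, Prod.map, hi x (by simp)]
    rw [← ho x (by simp), ← ih (fun y hy => hi y (by simp [hy])) (fun y hy => ho y (by simp [hy]))]

theorem cyc_map {W Y : Type*} {i' o' : Y → W} {f : V → W} {g : X → Y}
    {w : List X} (hi : ∀ x ∈ w, f (i x) = i' (g x)) (ho : ∀ x ∈ w, f (o x) = o' (g x)) :
    (cyc i o w).map (Prod.map f f) = cyc i' o' (w.map g) := by
  cases w with
  | nil => rfl
  | cons x w =>
    rw [List.map_cons, cyc, cyc, ← hi x (by simp), ← ho x (by simp)]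
    exact path_map (fun y hy => hi y (by simp [hy])) (fun y hy => ho y (by simp [hy])) _ _

/-- Removing an intermediate vertex of a path. -/
theorem nb_path_append {u v m : V} {w z : List X} {E : List (V × V)} {cs : List (Cross V)}
    (hu : u ≠ m) (hv : v ≠ m) (hw : ∀ x ∈ w, i x ≠ m ∧ o x ≠ m)
    (hz : ∀ x ∈ z, i x ≠ m ∧ o x ≠ m) (hE : Fresh m E) (hcs : ∀ c ∈ cs, c.Avoids m) :
    nb (path i o u w m ++ path i o m z v ++ E) cs =
      dd⁻¹ * nb (path i o u (w ++ z) v ++ E) cs := by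
  obtain ⟨F, p, hF⟩ := path_last (i := i) (o := o) u w
  obtain ⟨q, G, hG⟩ := path_head (i := i) (o := o) z v
  have h1 := fresh_path hu hu hw
  have h2 := fresh_path hv hv hz
  rw [hF, fresh_append] at h1
  rw [hG, fresh_cons] at h2
  rw [path_append hF hG, hF, hG, nb_reduce (F ++ [(p, m)] ++ (m, q) :: G) [(p, m)]
    (F ++ (p, q) :: G) (fun S => ?_) (by simp) ?_]
  · simp
  · simp only [fresh_cons] at h1
    simp only [List.map_cons, List.map_nil, List.mem_singleton, forall_eq, fresh_append, fresh_cons]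
    exact ⟨h1.2.1.1.symm, ⟨h1.1, ⟨h1.2.1.1, h2.1.2⟩, h2.2⟩, hE, hcs⟩
  · simp only [resp_append, resp_cons, resp_nil]
    grind

/-- Removing the base point of a closed path. -/
theorem nb_cyc {b : V} {w : List X} {E : List (V × V)} {cs : List (Cross V)}
    (hw : ∀ x ∈ w, i x ≠ b ∧ o x ≠ b) (hE : Fresh b E) (hcs : ∀ c ∈ cs, c.Avoids b) :
    nb (path i o b w b ++ E) cs =
      (if w = [] then 1 else dd⁻¹) * nb (cyc i o w ++ E) cs := by
  cases w with
  | nil =>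
    -- For the empty word the path is the loop `(b, b)`, of rank zero; this is why the factor
    -- depends on emptiness.
    rw [if_pos rfl, one_mul]
    exact nb_congr (fun S => by simp [path, cyc]) cs
  | cons x w =>
    have hx := hw x (by simp)
    rw [if_neg (by simp)]
    -- The closed path is cut at `x` instead of at `b`, so that `b` becomes an intermediate vertex.
    have key := nb_path_append (i := i) (o := o) (u := o x) (v := i x) (m := b) (w := w) (z := [])
      hx.2 hx.1 (fun y hy => hw y (by simp [hy])) (by simp) hE hcs
    rw [List.append_nil] at key
    rw [cyc, ← key]
    exact nb_congr (fun S => by simp only [path, resp_append, resp_cons, resp_nil]; tauto) cs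

end Path

/-! ### The state sum of a phrase of passages -/

variable {L : Type*}

/-- Half-edges at the crossings labelled by `L`, and base points. -/
abbrev Vtx (L : Type*) := (L × Bool × Bool) ⊕ ℕ

/-- The incoming half-edge of a passage. -/
def vin (x : L × Bool) : Vtx L := Sum.inl (x.1, x.2, false)

/-- The outgoing half-edge of a passage. -/
def vout (x : L × Bool) : Vtx L := Sum.inl (x.1, x.2, true)

/-- The base points. -/
def base (n : ℕ) : Vtx L := Sum.inr n

@[simp] theorem vin_inj {x y : L × Bool} : vin x = vin y ↔ x = y := by
  simp [vin, Prod.ext_iff]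

@[simp] theorem vout_inj {x y : L × Bool} : vout x = vout y ↔ x = y := by
  simp [vout, Prod.ext_iff]

@[simp] theorem base_inj {m n : ℕ} : (base m : Vtx L) = base n ↔ m = n := by simp [base]

@[simp] theorem vin_ne_vout (x y : L × Bool) : vin x ≠ vout y := by simp [vin, vout]

@[simp] theorem vout_ne_vin (x y : L × Bool) : vout x ≠ vin y := by simp [vin, vout]

@[simp] theorem vin_ne_base (x : L × Bool) (n : ℕ) : vin x ≠ base n := by simp [vin, base]

@[simp] theorem base_ne_vin (x : L × Bool) (n : ℕ) : base n ≠ vin x := by simp [vin, base]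

@[simp] theorem vout_ne_base (x : L × Bool) (n : ℕ) : vout x ≠ base n := by simp [vout, base]

@[simp] theorem base_ne_vout (x : L × Bool) (n : ℕ) : base n ≠ vout x := by simp [vout, base]

/-- The crossing labelled by `A`. -/
def cross (s : L → ℤˣ) (A : L) : Cross (Vtx L) :=
  ⟨s A, vin (A, true), vout (A, true), vin (A, false), vout (A, false)⟩

theorem cross_equiv (s : L → ℤˣ) (A : L) (b : Bool) :
    (cross s A).Equiv ⟨s A, vin (A, b), vout (A, b), vin (A, !b), vout (A, !b)⟩ := by
  refine Or.inl ⟨rfl, fun S => ?_, fun S => ?_⟩ <;> cases b <;>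
    simp only [cross, Cross.par, Cross.alt, resp_cons, resp_nil, Bool.not_true, Bool.not_false] <;>
    tauto

theorem cross_avoids_base (s : L → ℤˣ) (A : L) (n : ℕ) : (cross s A).Avoids (base n) := by
  simp [Cross.Avoids, cross]

theorem cross_avoids {s : L → ℤˣ} {A : L} {x : L × Bool} (h : A ≠ x.1) :
    (cross s A).Avoids (vin x) ∧ (cross s A).Avoids (vout x) := by
  simp only [Cross.Avoids, cross, ne_eq, vin_inj, vout_inj, vin_ne_vout, vout_ne_vin]
  refine ⟨⟨?_, ?_, ?_, ?_⟩, ?_, ?_, ?_, ?_⟩ <;> first | exact not_false | exact fun h' => h (h' ▸ rfl)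

/-- The state sum of a phrase of passages. -/
noncomputable def phraseSum (s : L → ℤˣ) (l : List L) (ws : List (List (L × Bool))) : FracField :=
  dd ^ (ws.countP List.isEmpty) * nb (ws.flatMap (cyc vin vout)) (l.map (cross s))

/-- The edges of a phrase of passages with base points, given by its code. -/
def codeEdges : ℕ → Vtx L → List (Option (L × Bool)) → List (Vtx L × Vtx L)
  | _, _, [] => []
  | n, c, some x :: l => (c, vin x) :: codeEdges n (vout x) l
  | n, c, none :: l => (c, base n) :: codeEdges (n + 1) (base (n + 1)) l

theorem codeEdges_word (n : ℕ) (c : Vtx L) (w : List (L × Bool)) (l : List (Option (L × Bool))) :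
    codeEdges n c (w.map some ++ none :: l) =
      path vin vout c w (base n) ++ codeEdges (n + 1) (base (n + 1)) l := by
  induction w generalizing c with
  | nil => rfl
  | cons x w ih => simp [codeEdges, path, ih]

/-- Erasing the base point of a nonempty word costs one `dd⁻¹`, that of an empty word nothing. The
extra list `E` collects the words already passed in the induction. -/
theorem nb_codeEdges (s : L → ℤˣ) (l : List L) (ws : List (List (L × Bool))) (n : ℕ)
    {E : List (Vtx L × Vtx L)} (hE : ∀ k, n ≤ k → Fresh (base k) E) :
    nb (codeEdges n (base n) (Nanophrase.code ws) ++ E) (l.map (cross s)) =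
      dd⁻¹ ^ (ws.length - ws.countP List.isEmpty) *
        nb (ws.flatMap (cyc vin vout) ++ E) (l.map (cross s)) := by
  induction ws generalizing n E with
  | nil => simp [Nanophrase.code, codeEdges]
  | cons w ws ih =>
    have h1 : Nanophrase.code (w :: ws) = w.map some ++ none :: Nanophrase.code ws := by
      simp [Nanophrase.code]
    have hcyc : Fresh (base n : Vtx L) (ws.flatMap (cyc vin vout)) := by
      intro p hp
      obtain ⟨w', -, hp⟩ := List.mem_flatMap.1 hp
      exact fresh_cyc (by simp) p hp
    have h2 : nb (codeEdges n (base n) (Nanophrase.code (w :: ws)) ++ E) (l.map (cross s)) =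
        nb (codeEdges (n + 1) (base (n + 1)) (Nanophrase.code ws) ++
          (path vin vout (base n) w (base n) ++ E)) (l.map (cross s)) := by
      rw [h1, codeEdges_word]
      exact nb_congr (fun S => by simp only [resp_append]; tauto) _
    have h3 : nb (ws.flatMap (cyc vin vout) ++ (path vin vout (base n) w (base n) ++ E))
        (l.map (cross s)) = nb (path vin vout (base n) w (base n) ++
          (ws.flatMap (cyc vin vout) ++ E)) (l.map (cross s)) :=
      nb_congr (fun S => by simp only [resp_append]; tauto) _
    rw [h2, ih, h3, nb_cyc (by simp) (by rw [fresh_append]; exact ⟨hcyc, hE n le_rfl⟩)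
      (by simp [cross_avoids_base]), List.flatMap_cons, List.append_assoc]
    · have hle := List.countP_le_length (p := List.isEmpty) (l := ws)
      cases w with
      | nil => simp
      | cons x w =>
        simp only [List.length_cons, List.countP_cons, List.isEmpty_cons, Bool.false_eq_true,
          if_false, add_zero, Nat.succ_sub hle, pow_succ, reduceCtorEq]
        ring
    · intro k hk
      rw [fresh_append]
      refine ⟨fresh_path ?_ ?_ (by simp), hE k (by omega)⟩ <;> simp <;> omega

/-- With base points, empty and nonempty words carry the same factor `dd`. A homotopy move, which
may empty a word but preserves the number of words, then needs no case distinction. -/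
theorem phraseSum_eq_codeEdges (s : L → ℤˣ) (l : List L) (ws : List (List (L × Bool))) :
    phraseSum s l ws =
      dd ^ ws.length * nb (codeEdges 0 (base 0) (Nanophrase.code ws)) (l.map (cross s)) := by
  have h := nb_codeEdges s l ws 0 (E := []) (by simp)
  rw [List.append_nil, List.append_nil] at h
  have hle := List.countP_le_length (p := List.isEmpty) (l := ws)
  rw [h, phraseSum, ← mul_assoc, inv_pow]
  congr 1
  obtain ⟨k, hk⟩ := Nat.exists_eq_add_of_le hle
  have := dd_ne_zero
  rw [hk, Nat.add_sub_cancel_left, pow_add]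
  field_simp

end StateSum

namespace StateSum

variable {L M : Type*}

/-! ### Relabelling -/

/-- The map of vertices induced by a map of passages. -/
def vmap (f : L × Bool → M × Bool) : Vtx L → Vtx M :=
  Sum.map (fun h => ((f (h.1, h.2.1)).1, (f (h.1, h.2.1)).2, h.2.2)) id

@[simp] theorem vmap_vin (f : L × Bool → M × Bool) (x : L × Bool) : vmap f (vin x) = vin (f x) :=
  rfl

@[simp] theorem vmap_vout (f : L × Bool → M × Bool) (x : L × Bool) :
    vmap f (vout x) = vout (f x) := rfl

@[simp] theorem vmap_base (f : L × Bool → M × Bool) (n : ℕ) : vmap f (base n) = base n := rfl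

theorem vmap_injective {f : L × Bool → M × Bool} (hf : Function.Injective f) :
    Function.Injective (vmap f) := by
  refine Sum.map_injective.2 ⟨?_, Function.injective_id⟩
  rintro ⟨a, b, c⟩ ⟨a', b', c'⟩ h
  simp only [Prod.mk.injEq] at h
  have := hf (Prod.ext h.1 h.2.1)
  simp only [Prod.mk.injEq] at this ⊢
  exact ⟨this.1, this.2, h.2.2⟩

theorem flatMap_cyc_map (f : L × Bool → M × Bool) (ws : List (List (L × Bool))) :
    (ws.map (List.map f)).flatMap (cyc vin vout) =
      (ws.flatMap (cyc vin vout)).map (Prod.map (vmap f) (vmap f)) := by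
  induction ws with
  | nil => rfl
  | cons w ws ih =>
    rw [List.map_cons, List.flatMap_cons, List.flatMap_cons, List.map_append, ih,
      cyc_map (fun x _ => vmap_vin f x) (fun x _ => vmap_vout f x)]

theorem codeEdges_map (f : L × Bool → M × Bool) (n : ℕ) (c : Vtx L)
    (l : List (Option (L × Bool))) :
    codeEdges n (vmap f c) (l.map (Option.map f)) =
      (codeEdges n c l).map (Prod.map (vmap f) (vmap f)) := by
  induction l generalizing n c with
  | nil => rfl
  | cons a l ih =>
    cases a with
    | none => simp [codeEdges, ← ih]
    | some x => simp [codeEdges, ← ih]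

theorem countP_isEmpty_map {α β : Type*} (f : α → β) (ws : List (List α)) :
    (ws.map (List.map f)).countP List.isEmpty = ws.countP List.isEmpty := by
  rw [List.countP_map]
  congr 1
  funext w
  simp

/-- Renaming the letters does not change the state sum. -/
theorem phraseSum_map {f : L → M} (hf : Function.Injective f) (s : M → ℤˣ) (l : List L)
    (ws : List (List (L × Bool))) :
    phraseSum s (l.map f) (ws.map (List.map (Prod.map f id))) =
      phraseSum (fun A => s (f A)) l ws := by
  rw [phraseSum, phraseSum, countP_isEmpty_map, flatMap_cyc_map,
    ← nb_map (vmap_injective (hf.prodMap Function.injective_id)), List.map_map, List.map_map]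
  rfl

/-- Exchanging the two passages through the crossings `A` with `φ A = true`. -/
def flipPassage (φ : L → Bool) (x : L × Bool) : L × Bool := (x.1, xor x.2 (φ x.1))

theorem flipPassage_injective (φ : L → Bool) : Function.Injective (flipPassage φ) := by
  rintro ⟨A, b⟩ ⟨A', b'⟩ h
  simp only [flipPassage, Prod.mk.injEq] at h
  obtain ⟨rfl, h⟩ := h
  simpa using h

/-- With the sign fixed, both uncrossings are symmetric in the two passages. This is why the bracket
does not see the difference between the types `a` and `b`. -/
theorem phraseSum_flipPassage (φ : L → Bool) (s : L → ℤˣ) (l : List L)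
    (ws : List (List (L × Bool))) :
    phraseSum s l (ws.map (List.map (flipPassage φ))) = phraseSum s l ws := by
  rw [phraseSum, phraseSum, countP_isEmpty_map, flatMap_cyc_map,
    ← nb_map (vmap_injective (flipPassage_injective φ)) (ws.flatMap _), List.map_map]
  congr 1
  refine nb_cross_congr _ fun A _ => ?_
  have := cross_equiv s A (!φ A)
  simpa [cross, Cross.map, flipPassage] using this

theorem exists_flipPassage {l l' : List (L × Bool)} (h : l.map Prod.fst = l'.map Prod.fst)
    (hl : l.Nodup) (hl' : l'.Nodup) : ∃ φ : L → Bool, l' = l.map (flipPassage φ) := by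
  classical
  induction l generalizing l' with
  | nil => exact ⟨fun _ => false, by simpa using h.symm⟩
  | cons x l ih =>
    cases l' with
    | nil => simp at h
    | cons x' l' =>
      obtain ⟨A, b⟩ := x
      obtain ⟨A', b'⟩ := x'
      simp only [List.map_cons, List.cons.injEq] at h
      obtain ⟨rfl, h⟩ := h
      rw [List.nodup_cons] at hl hl'
      obtain ⟨φ, rfl⟩ := ih h hl.2 hl'.2
      -- If the other passage of `A` comes later, `φ A` is already fixed and the absence of
      -- repetitions forces agreement here; otherwise `φ A` is free.
      by_cases hA : (A, !b) ∈ l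
      · refine ⟨φ, ?_⟩
        have h1 : flipPassage φ (A, !b) ∈ l.map (flipPassage φ) := List.mem_map_of_mem hA
        have h2 : flipPassage φ (A, !b) ≠ (A, b') := fun h => hl'.1 (h ▸ h1)
        rw [List.map_cons]
        congr 1
        simp only [flipPassage, ne_eq, Prod.mk.injEq, true_and] at h2 ⊢
        revert h2
        cases b <;> cases b' <;> cases φ A <;> decide
      · refine ⟨Function.update φ A (xor b b'), ?_⟩
        rw [List.map_cons]
        congr 1
        · simp [flipPassage]
        · refine List.map_congr_left fun x hx => ?_
          have : x.1 ≠ A := by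
            rintro rfl
            rcases Bool.eq_or_eq_not x.2 b with h' | h'
            · exact hl.1 (h' ▸ hx)
            · exact hA (h' ▸ hx)
          simp [flipPassage, this]

/-- The state sum depends only on the underlying phrase of letters. -/
theorem phraseSum_eq_of_map_fst {ws ws' : List (List (L × Bool))}
    (h : ws.map (List.map Prod.fst) = ws'.map (List.map Prod.fst))
    (hws : ws.flatten.Nodup) (hws' : ws'.flatten.Nodup) (s : L → ℤˣ) (l : List L) :
    phraseSum s l ws = phraseSum s l ws' := by
  have h1 : ws.flatten.map Prod.fst = ws'.flatten.map Prod.fst := by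
    rw [List.map_flatten, List.map_flatten, h]
  obtain ⟨φ, hφ⟩ := exists_flipPassage h1 hws hws'
  have h2 : ws' = ws.map (List.map (flipPassage φ)) := by
    rw [List.eq_iff_flatten_eq, hφ, List.map_flatten, List.map_map]
    refine ⟨rfl, ?_⟩
    have := congrArg (List.map List.length) h
    simpa [Function.comp_def] using this.symm
  rw [h2, phraseSum_flipPassage]

theorem phraseSum_perm (s : L → ℤˣ) {l l' : List L} (hl : l.Perm l')
    (ws : List (List (L × Bool))) : phraseSum s l ws = phraseSum s l' ws := by
  rw [phraseSum, phraseSum, nb_cross_perm _ (hl.map _)]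

/-! ### Removing and exchanging passages in a code -/

theorem mem_codeEdges {n : ℕ} {c : Vtx L} {l : List (Option (L × Bool))} {p : Vtx L × Vtx L}
    (hp : p ∈ codeEdges n c l) :
    (p.1 = c ∨ (∃ x, some x ∈ l ∧ p.1 = vout x) ∨ ∃ k, n < k ∧ p.1 = base k) ∧
      ((∃ x, some x ∈ l ∧ p.2 = vin x) ∨ ∃ k, n ≤ k ∧ p.2 = base k) := by
  induction l generalizing n c with
  | nil => simp [codeEdges] at hp
  | cons a l ih =>
    cases a with
    | none =>
      rw [codeEdges, List.mem_cons] at hp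
      rcases hp with rfl | hp
      · exact ⟨Or.inl rfl, Or.inr ⟨n, le_rfl, rfl⟩⟩
      · obtain ⟨h1, h2⟩ := ih hp
        constructor
        · rcases h1 with h | ⟨x, hx, h⟩ | ⟨k, hk, h⟩
          · exact Or.inr (Or.inr ⟨n + 1, by omega, h⟩)
          · exact Or.inr (Or.inl ⟨x, by simp [hx], h⟩)
          · exact Or.inr (Or.inr ⟨k, by omega, h⟩)
        · rcases h2 with ⟨x, hx, h⟩ | ⟨k, hk, h⟩
          · exact Or.inl ⟨x, by simp [hx], h⟩
          · exact Or.inr ⟨k, by omega, h⟩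
    | some y =>
      rw [codeEdges, List.mem_cons] at hp
      rcases hp with rfl | hp
      · exact ⟨Or.inl rfl, Or.inl ⟨y, by simp, rfl⟩⟩
      · obtain ⟨h1, h2⟩ := ih hp
        constructor
        · rcases h1 with h | ⟨x, hx, h⟩ | h
          · exact Or.inr (Or.inl ⟨y, by simp, h⟩)
          · exact Or.inr (Or.inl ⟨x, by simp [hx], h⟩)
          · exact Or.inr (Or.inr h)
        · rcases h2 with ⟨x, hx, h⟩ | h
          · exact Or.inl ⟨x, by simp [hx], h⟩
          · exact Or.inr h

theorem fresh_codeEdges {n : ℕ} {c : Vtx L} {l : List (Option (L × Bool))} {a : L × Bool}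
    (ha : some a ∉ l) (hc : c ≠ vin a) (hc' : c ≠ vout a) :
    Fresh (vin a) (codeEdges n c l) ∧ Fresh (vout a) (codeEdges n c l) := by
  refine ⟨fun p hp => ?_, fun p hp => ?_⟩ <;> obtain ⟨h1, h2⟩ := mem_codeEdges hp
  · refine ⟨?_, ?_⟩
    · rcases h1 with h | ⟨x, hx, h⟩ | ⟨k, hk, h⟩ <;> simp [h, hc]
    · rcases h2 with ⟨x, hx, h⟩ | ⟨k, hk, h⟩
      · rw [h, ne_eq, vin_inj]
        exact fun h' => ha (h' ▸ hx)
      · simp [h]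
  · refine ⟨?_, ?_⟩
    · rcases h1 with h | ⟨x, hx, h⟩ | ⟨k, hk, h⟩
      · rwa [h]
      · rw [h, ne_eq, vout_inj]
        exact fun h' => ha (h' ▸ hx)
      · simp [h]
    · rcases h2 with ⟨x, hx, h⟩ | ⟨k, hk, h⟩ <;> simp [h]

/-- Every vertex is the source of at most one edge and the target of at most one, the incoming
half-edges are not sources and the outgoing ones are not targets. -/
def IsDirected (E : List (Vtx L × Vtx L)) : Prop :=
  E.Pairwise (fun p q => p.1 ≠ q.1 ∧ p.2 ≠ q.2) ∧
    ∀ p ∈ E, ∀ x, p.1 ≠ vin x ∧ p.2 ≠ vout x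

/-- The ends of the edge joining two consecutive passages occur in no other edge: this supplies the
freshness required by the local identities. -/
theorem IsDirected.exists_perm {E : List (Vtx L × Vtx L)} (hE : IsDirected E) {a b : L × Bool}
    (h : (vout a, vin b) ∈ E) :
    ∃ R, E.Perm ((vout a, vin b) :: R) ∧ IsDirected R ∧ Fresh (vout a) R ∧ Fresh (vin b) R := by
  obtain ⟨s, t, rfl⟩ := List.append_of_mem h
  obtain ⟨h1, h2⟩ := hE
  have hperm : (s ++ (vout a, vin b) :: t).Perm ((vout a, vin b) :: (s ++ t)) := List.perm_middle
  rw [hperm.pairwise_iff fun h => ⟨h.1.symm, h.2.symm⟩, List.pairwise_cons] at h1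
  have h3 : ∀ p ∈ s ++ t, ∀ x, p.1 ≠ vin x ∧ p.2 ≠ vout x :=
    fun p hp => h2 p (hperm.mem_iff.2 (List.mem_cons_of_mem _ hp))
  refine ⟨_, hperm, ⟨h1.2, h3⟩, fun p hp => ?_, fun p hp => ?_⟩
  · exact ⟨(h1.1 p hp).1.symm, (h3 p hp a).2⟩
  · exact ⟨(h3 p hp b).1, (h1.1 p hp).2.symm⟩

theorem isDirected_codeEdges {n : ℕ} {c : Vtx L} {l : List (Option (L × Bool))}
    (hl : l.reduceOption.Nodup) (hc : ∀ x, c ≠ vin x) (hc' : ∀ x, some x ∈ l → c ≠ vout x)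
    (hn : ∀ k, n < k → c ≠ base k) : IsDirected (codeEdges n c l) := by
  constructor
  · induction l generalizing n c with
    | nil => exact List.Pairwise.nil
    | cons a l ih =>
      cases a with
      | none =>
        rw [List.reduceOption_cons_of_none] at hl
        rw [codeEdges, List.pairwise_cons]
        refine ⟨fun p hp => ?_, ih hl (by simp) (by simp) (by simp; omega)⟩
        obtain ⟨h1, h2⟩ := mem_codeEdges hp
        constructor
        · rcases h1 with h | ⟨x, hx, h⟩ | ⟨k, hk, h⟩
          · rw [h]; exact hn _ (by omega)
          · rw [h]; exact hc' x (by simp [hx])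
          · rw [h]; exact hn k (by omega)
        · rcases h2 with ⟨x, hx, h⟩ | ⟨k, hk, h⟩
          · simp [h]
          · simp only [h, ne_eq, base_inj]; omega
      | some y =>
        rw [List.reduceOption_cons_of_some, List.nodup_cons, List.reduceOption_mem_iff] at hl
        rw [codeEdges, List.pairwise_cons]
        refine ⟨fun p hp => ?_, ih hl.2 (by simp) (fun x hx h => ?_) (by simp)⟩
        · obtain ⟨h1, h2⟩ := mem_codeEdges hp
          constructor
          · rcases h1 with h | ⟨x, hx, h⟩ | ⟨k, hk, h⟩
            · rw [h]; exact hc' y (by simp)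
            · rw [h]; exact hc' x (by simp [hx])
            · rw [h]; exact hn k hk
          · rcases h2 with ⟨x, hx, h⟩ | ⟨k, hk, h⟩
            · rw [h, ne_eq, vin_inj]
              rintro rfl
              exact hl.1 hx
            · simp [h]
        · rw [vout_inj] at h
          exact hl.1 (h ▸ hx)
  · intro p hp x
    obtain ⟨h1, h2⟩ := mem_codeEdges hp
    constructor
    · rcases h1 with h | ⟨x, hx, h⟩ | ⟨k, hk, h⟩ <;> simp [h, hc]
    · rcases h2 with ⟨x, hx, h⟩ | ⟨k, hk, h⟩ <;> simp [h]

theorem mem_codeEdges_of_consecutive {n : ℕ} {c : Vtx L} (x y : List (Option (L × Bool)))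
    (a b : L × Bool) : (vout a, vin b) ∈ codeEdges n c (x ++ some a :: some b :: y) := by
  induction x generalizing n c with
  | nil => simp [codeEdges]
  | cons z x ih => cases z <;> simp [codeEdges, ih]

/-- Removing a passage. -/
theorem nb_sew {n : ℕ} {c : Vtx L} {x y : List (Option (L × Bool))} {a : L × Bool}
    {E : List (Vtx L × Vtx L)} {cs : List (Cross (Vtx L))} (hx : some a ∉ x) (hy : some a ∉ y)
    (hy0 : y ≠ []) (hc : c ≠ vin a) (hc' : c ≠ vout a) (hE : Fresh (vin a) E)
    (hE' : Fresh (vout a) E) (hcs : ∀ k ∈ cs, k.Avoids (vin a) ∧ k.Avoids (vout a)) :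
    nb ((vin a, vout a) :: (codeEdges n c (x ++ some a :: y) ++ E)) cs =
      dd⁻¹ ^ 2 * nb (codeEdges n c (x ++ y) ++ E) cs := by
  induction x generalizing n c E with
  | nil =>
    -- Here `v` is the vertex that follows `a`; it exists because `y` is not empty. Both half-edges
    -- of `a` lie on the chain from `c` to `v` and are dropped as two pendant vertices.
    have key : ∀ (v : Vtx L) (R : List (Vtx L × Vtx L)), v ≠ vin a → v ≠ vout a →
        Fresh (vin a) R → Fresh (vout a) R →
        nb ((vin a, vout a) :: (c, vin a) :: (vout a, v) :: (R ++ E)) cs =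
          dd⁻¹ ^ 2 * nb ((c, v) :: (R ++ E)) cs := by
      intro v R hv hv' hR hR'
      refine nb_reduce [(vin a, vout a), (c, vin a), (vout a, v)] [(c, vin a), (c, vout a)]
        [(c, v)] (E := R ++ E) (fun S => ?_) (by simp) ?_
      · simp only [resp_cons, resp_nil]
        grind
      · simp only [List.map_cons, List.map_nil, List.mem_cons, List.not_mem_nil, or_false,
          forall_eq_or_imp, forall_eq, fresh_append, fresh_cons, fresh_nil, and_true]
        refine ⟨⟨?_, ⟨hc, hv⟩, ⟨hR, hE⟩, fun k hk => (hcs k hk).1⟩, ?_, ⟨hc', hv'⟩, ⟨hR', hE'⟩,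
          fun k hk => (hcs k hk).2⟩
        · simp [hc.symm]
        · simp [hc'.symm]
    cases y with
    | nil => exact absurd rfl hy0
    | cons z y =>
      have hay : some a ∉ y := fun h => hy (by simp [h])
      cases z with
      | none =>
        obtain ⟨h1, h2⟩ := fresh_codeEdges (n := n + 1) (c := base (n + 1)) hay (by simp) (by simp)
        exact key _ _ (by simp) (by simp) h1 h2
      | some b =>
        have hb : b ≠ a := fun h => hy (by simp [h])
        obtain ⟨h1, h2⟩ := fresh_codeEdges (n := n) (c := vout b) hay (by simp) (by simpa using hb)
        exact key _ _ (by simpa using hb) (by simp) h1 h2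
  | cons z x ih =>
    have hax : some a ∉ x := fun h => hx (by simp [h])
    -- Edges before the passage are moved into `E`, which is therefore general in the induction.
    have key : ∀ (p : Vtx L × Vtx L) (J J' : List (Vtx L × Vtx L)),
        nb ((vin a, vout a) :: (J ++ (p :: E))) cs = dd⁻¹ ^ 2 * nb (J' ++ (p :: E)) cs →
        nb ((vin a, vout a) :: (p :: J ++ E)) cs = dd⁻¹ ^ 2 * nb (p :: J' ++ E) cs := by
      intro p J J' h
      rw [nb_perm (E := p :: J' ++ E) (F := J' ++ p :: E) List.perm_middle.symm, ← h]
      exact nb_perm (List.perm_middle.symm.cons _) cs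
    cases z with
    | none =>
      refine key _ _ _ (ih hax (by simp) (by simp) ?_ ?_) <;> rw [fresh_cons]
      · exact ⟨⟨hc, by simp⟩, hE⟩
      · exact ⟨⟨hc', by simp⟩, hE'⟩
    | some b =>
      have hb : b ≠ a := fun h => hx (by simp [h])
      refine key _ _ _ (ih hax (by simp) (by simpa using hb) ?_ ?_) <;> rw [fresh_cons]
      · exact ⟨⟨hc, by simpa using hb⟩, hE⟩
      · exact ⟨⟨hc', by simp⟩, hE'⟩

end StateSum

namespace StateSum

open Nanophrase (code)

variable {L : Type*}

/-! ### Codes -/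

theorem code_cons (w : List L) (ws : List (List L)) :
    code (w :: ws) = w.map some ++ none :: code ws := by simp [code]

theorem reduceOption_code (ws : List (List L)) : (code ws).reduceOption = ws.flatten := by
  induction ws with
  | nil => rfl
  | cons w ws ih =>
    rw [code_cons, List.reduceOption_append, List.reduceOption_cons_of_none, ih, List.flatten_cons]
    congr 1
    simp [List.reduceOption, List.filterMap_map]

theorem countP_isNone_code (ws : List (List L)) : (code ws).countP Option.isNone = ws.length := by
  induction ws with
  | nil => rfl
  | cons w ws ih =>
    rw [code_cons, List.countP_append, List.countP_cons, ih, List.countP_map]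
    have : w.countP (Option.isNone ∘ some) = 0 := List.countP_eq_zero.2 (by simp)
    simp [this]

/-- A nonempty code ends with a separator, so something always follows a passage, as `nb_sew`
requires. -/
theorem code_ne_concat_some (ws : List (List L)) (l : List (Option L)) (a : L) :
    code ws ≠ l ++ [some a] := by
  rcases List.eq_nil_or_concat ws with rfl | ⟨ws, w, rfl⟩
  · simp [code]
  · intro h
    rw [code, List.concat_eq_append, List.flatMap_append, List.flatMap_singleton,
      ← List.append_assoc] at h
    have := (List.append_inj' h rfl).2
    simp at this

/-- A code of passages obtained by editing is again the code of a phrase as soon as its underlying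
list of letters is. -/
theorem exists_code_eq_of_map {K : Type*} {g : K → L} {c : List (Option K)} {ws : List (List L)}
    (h : c.map (Option.map g) = code ws) :
    ∃ vs : List (List K), c = code vs ∧ vs.map (List.map g) = ws := by
  induction ws generalizing c with
  | nil =>
    have : c = [] := by simpa [code] using h
    exact ⟨[], by simp [this, code], rfl⟩
  | cons w ws ih =>
    rw [code_cons] at h
    obtain ⟨c₁, c₂, rfl, h1, h2⟩ := List.map_eq_append_iff.1 h
    obtain ⟨o, c₃, rfl, ho, h3⟩ := List.map_eq_cons_iff.1 h2
    obtain ⟨vs, rfl, rfl⟩ := ih h3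
    have ho : o = none := by simpa using ho
    have : ∃ v : List K, c₁ = v.map some ∧ v.map g = w := by
      clear h h2 h3
      induction w generalizing c₁ with
      | nil => exact ⟨[], by simpa using h1, rfl⟩
      | cons a w ih =>
        rw [List.map_cons] at h1
        obtain ⟨o', c₄, rfl, ho', h4⟩ := List.map_eq_cons_iff.1 h1
        obtain ⟨v, rfl, rfl⟩ := ih _ h4
        obtain ⟨b, rfl, rfl⟩ := Option.map_eq_some_iff.1 ho'
        exact ⟨b :: v, rfl, rfl⟩
    obtain ⟨v, rfl, rfl⟩ := this
    exact ⟨v :: vs, by rw [code_cons, ho], rfl⟩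

/-! ### The homotopy moves -/

variable {s : L → ℤˣ} {l : List L} {ws ws' : List (List (L × Bool))}
  {x y z t : List (Option (L × Bool))} {A B C : L} {b b' b'' : Bool}

theorem avoids_of_not_mem (s : L → ℤˣ) (hA : A ∉ l) (b : Bool) : ∀ k ∈ l.map (cross s),
    k.Avoids (vin (A, b)) ∧ k.Avoids (vout (A, b)) := by
  intro k hk
  obtain ⟨B, hB, rfl⟩ := List.mem_map.1 hk
  exact cross_avoids fun h : B = A => hA (h ▸ hB)

theorem isDirected_code (hws : ws.flatten.Nodup) : IsDirected (codeEdges 0 (base 0) (code ws)) :=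
  isDirected_codeEdges (by rwa [reduceOption_code]) (by simp) (by simp) (by simp; omega)

theorem nb_cross_cons_congr {V : Type*} (E : List (V × V)) {c c' : Cross V} (h : c.Equiv c')
    (cs : List (Cross V)) : nb E (c :: cs) = nb E (c' :: cs) := by
  have key : ∀ {F G : List (V × V)}, (∀ S, Resp S F ↔ Resp S G) →
      nb (F ++ E) cs = nb (G ++ E) cs := fun h => nb_congr (fun S => by simp [h]) _
  rw [nb, nb]
  rcases h with ⟨h1, h2, h3⟩ | ⟨h1, h2, h3⟩
  · rw [h1, key h2, key h3]
  · rw [h1, key h2, key h3, Units.val_neg, neg_neg, add_comm]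

theorem nodup_reduceOption_remove {K : Type*} {x y : List (Option K)} {a : Option K}
    (h : (x ++ a :: y).reduceOption.Nodup) : (x ++ y).reduceOption.Nodup :=
  h.sublist (List.Sublist.filterMap _ ((List.Sublist.refl x).append (List.sublist_cons_self a y)))

theorem nb_sew_code {a : L × Bool} {E : List (Vtx L × Vtx L)} {cs : List (Cross (Vtx L))}
    (hnd : (x ++ some a :: y).reduceOption.Nodup) (hy0 : y ≠ [])
    (hE : Fresh (vin a) E) (hE' : Fresh (vout a) E)
    (hcs : ∀ k ∈ cs, k.Avoids (vin a) ∧ k.Avoids (vout a)) :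
    nb (codeEdges 0 (base 0) (x ++ some a :: y) ++ (vin a, vout a) :: E) cs =
      dd⁻¹ ^ 2 * nb (codeEdges 0 (base 0) (x ++ y) ++ E) cs := by
  rw [List.reduceOption_append, List.reduceOption_cons_of_some, List.nodup_append] at hnd
  simp only [List.nodup_cons, List.mem_cons, List.reduceOption_mem_iff] at hnd
  obtain ⟨-, ⟨hy, -⟩, hx⟩ := hnd
  rw [← nb_sew (fun h => hx _ h _ (Or.inl rfl) rfl) hy hy0 (by simp) (by simp) hE hE' hcs]
  exact nb_perm List.perm_middle _

/-- The edge between the two passages is isolated, the local identity removes the crossing, and the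
passages left as plain edges are sewn up. Four half-edges disappear, whence `dd⁻¹ ^ 4`. -/
theorem phraseSum_first_move (hA : A ∉ l) (hws : ws.flatten.Nodup)
    (h : code ws = x ++ some (A, b) :: some (A, !b) :: y) (h' : code ws' = x ++ y) :
    phraseSum s (A :: l) ws = -tt ^ (3 * (s A : ℤ)) * dd⁻¹ ^ 4 * phraseSum s l ws' := by
  have hdir := isDirected_code hws
  have hlen : ws.length = ws'.length := by
    rw [← countP_isNone_code, ← countP_isNone_code, h, h']
    simp
  have hnd := hws
  rw [← reduceOption_code, h] at hnd
  have hy0 : y ≠ [] := by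
    rintro rfl
    exact code_ne_concat_some ws (x ++ [some (A, b)]) (A, !b) (by simp [h])
  rw [h] at hdir
  obtain ⟨R, hR, -, hR1, hR2⟩ := hdir.exists_perm
    (mem_codeEdges_of_consecutive (n := 0) (c := base 0) x y (A, b) (A, !b))
  have hav := avoids_of_not_mem s hA
  have h1 := nb_first_move (s A) (a := vin (A, b)) (b := vout (A, b)) (c := vin (A, !b))
    (e := vout (A, !b)) (by simp) (E := R) (cs := l.map (cross s))
    (by simp [hR1, hR2]) (by
      simp only [List.mem_cons, List.not_mem_nil, or_false, forall_eq_or_imp, forall_eq]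
      exact ⟨fun k hk => (hav b k hk).2, fun k hk => (hav (!b) k hk).1⟩)
  have h2 : nb ((vin (A, b), vout (A, b)) :: (vin (A, !b), vout (A, !b)) ::
      (vout (A, b), vin (A, !b)) :: R) (l.map (cross s)) =
      nb (codeEdges 0 (base 0) (x ++ some (A, b) :: some (A, !b) :: y) ++
        [(vin (A, b), vout (A, b)), (vin (A, !b), vout (A, !b))]) (l.map (cross s)) :=
    (nb_perm ((hR.append_right _).trans (List.perm_append_comm (l₂ := [_, _]))) _).symm
  rw [phraseSum_eq_codeEdges, phraseSum_eq_codeEdges, h, h', hlen, List.map_cons,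
    nb_cross_cons_congr _ (cross_equiv s A b), nb_perm hR, h1, h2,
    nb_sew_code hnd (by simp) (by simp) (by simp) (hav b),
    nb_sew_code (nodup_reduceOption_remove hnd) hy0 (by simp) (by simp)
      (hav (!b)), List.append_nil]
  ring

/-- The scheme of the first move with two edges isolated; two letters have eight half-edges. -/
theorem phraseSum_second_move (hA : A ∉ l) (hB : B ∉ l) (hAB : A ≠ B) (hs : s B = -s A)
    (hws : ws.flatten.Nodup)
    (h : code ws = x ++ some (A, b) :: some (B, b') :: (y ++ some (B, !b') :: some (A, !b) :: z))
    (h' : code ws' = x ++ y ++ z) :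
    phraseSum s (A :: B :: l) ws = dd⁻¹ ^ 8 * phraseSum s l ws' := by
  have hdir := isDirected_code hws
  have hlen : ws.length = ws'.length := by
    rw [← countP_isNone_code, ← countP_isNone_code, h, h']
    simp
  have hnd := hws
  rw [← reduceOption_code, h] at hnd
  have hz0 : z ≠ [] := by
    rintro rfl
    exact code_ne_concat_some ws
      (x ++ some (A, b) :: some (B, b') :: (y ++ [some (B, !b')])) (A, !b) (by simp [h])
  rw [h] at hdir
  have hm1 := mem_codeEdges_of_consecutive (n := 0) (c := base 0) x
    (y ++ some (B, !b') :: some (A, !b) :: z) (A, b) (B, b')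
  have hm2 := mem_codeEdges_of_consecutive (n := 0) (c := base 0)
    (x ++ some (A, b) :: some (B, b') :: y) z (B, !b') (A, !b)
  simp only [List.append_assoc, List.cons_append] at hm2
  obtain ⟨R₁, hR₁, hdir₁, hR1, hR2⟩ := hdir.exists_perm hm1
  obtain ⟨R, hR, -, hR3, hR4⟩ := hdir₁.exists_perm (a := (B, !b')) (b := (A, !b)) (by
    simpa [hAB, hAB.symm] using hR₁.mem_iff.1 hm2)
  have hR₂ := hR₁.trans (hR.cons _)
  have hRf : ∀ m, Fresh m R₁ → Fresh m R := fun m hm p hp =>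
    hm p (hR.mem_iff.2 (List.mem_cons_of_mem _ hp))
  have hav := avoids_of_not_mem s hA
  have hbv := avoids_of_not_mem s hB
  have h1 := nb_second_move (s A) (p := vin (A, b)) (q := vout (A, b)) (r := vin (A, !b))
    (s' := vout (A, !b)) (w := vin (B, b')) (x := vout (B, b')) (y := vin (B, !b'))
    (z := vout (B, !b')) (by simp [hAB]) (E := R) (cs := l.map (cross s))
    (by simp [hR3, hR4, hRf _ hR1, hRf _ hR2]) (by
      simp only [List.mem_cons, List.not_mem_nil, or_false, forall_eq_or_imp, forall_eq]
      exact ⟨fun k hk => (hav b k hk).2, fun k hk => (hbv b' k hk).1,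
        fun k hk => (hbv (!b') k hk).2, fun k hk => (hav (!b) k hk).1⟩)
  have h2 : nb ((vin (A, b), vout (A, b)) :: (vin (A, !b), vout (A, !b)) ::
      (vin (B, b'), vout (B, b')) :: (vin (B, !b'), vout (B, !b')) ::
      (vout (A, b), vin (B, b')) :: (vout (B, !b'), vin (A, !b)) :: R) (l.map (cross s)) =
      nb (codeEdges 0 (base 0)
        (x ++ some (A, b) :: some (B, b') :: (y ++ some (B, !b') :: some (A, !b) :: z)) ++
        [(vin (A, b), vout (A, b)), (vin (B, b'), vout (B, b')), (vin (B, !b'), vout (B, !b')),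
          (vin (A, !b), vout (A, !b))]) (l.map (cross s)) :=
    nb_congr (fun S => by
      rw [resp_append, resp_perm hR₂]
      simp only [resp_cons, resp_nil]
      grind) _
  have h3 : ∀ E cs, nb (codeEdges 0 (base 0) (x ++ (y ++ some (B, !b') :: some (A, !b) :: z)) ++ E)
      cs = nb (codeEdges 0 (base 0) (x ++ y ++ some (B, !b') :: some (A, !b) :: z) ++ E) cs :=
    fun E cs => by rw [List.append_assoc]
  have hnd1 := nodup_reduceOption_remove hnd
  have hnd2 := nodup_reduceOption_remove hnd1
  rw [← List.append_assoc] at hnd2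
  have h4 : nb (codeEdges 0 (base 0)
        (x ++ some (A, b) :: some (B, b') :: (y ++ some (B, !b') :: some (A, !b) :: z)) ++
        [(vin (A, b), vout (A, b)), (vin (B, b'), vout (B, b')), (vin (B, !b'), vout (B, !b')),
          (vin (A, !b), vout (A, !b))]) (l.map (cross s)) =
      dd⁻¹ ^ 2 * (dd⁻¹ ^ 2 * (dd⁻¹ ^ 2 * (dd⁻¹ ^ 2 *
        nb (codeEdges 0 (base 0) (x ++ y ++ z)) (l.map (cross s))))) := by
    rw [nb_sew_code hnd (by simp) (by simp [hAB.symm]) (by simp [hAB.symm]) (hav b),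
      nb_sew_code hnd1 (by simp) (by simp [hAB]) (by simp [hAB]) (hbv b'), h3,
      nb_sew_code hnd2 (by simp) (by simp [hAB]) (by simp [hAB]) (hbv (!b')),
      nb_sew_code (nodup_reduceOption_remove hnd2) hz0 (by simp) (by simp) (hav (!b)),
      List.append_nil]
  have h5 : nb ((vout (A, b), vin (B, b')) :: (vout (B, !b'), vin (A, !b)) :: R)
      (cross s A :: cross s B :: l.map (cross s)) =
      nb ((vout (A, b), vin (B, b')) :: (vout (B, !b'), vin (A, !b)) :: R)
      (⟨s A, vin (A, b), vout (A, b), vin (A, !b), vout (A, !b)⟩ ::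
        ⟨-s A, vin (B, b'), vout (B, b'), vin (B, !b'), vout (B, !b')⟩ :: l.map (cross s)) := by
    -- Each crossing is brought to the head in turn, so that its passages can be listed in order of
    -- occurrence.
    rw [nb_cross_cons_congr _ (cross_equiv s A b), nb_cross_perm _ (List.Perm.swap _ _ _),
      nb_cross_cons_congr _ (cross_equiv s B b'), nb_cross_perm _ (List.Perm.swap _ _ _), hs]
  rw [phraseSum_eq_codeEdges, phraseSum_eq_codeEdges, h, h', hlen, List.map_cons, List.map_cons,
    nb_perm hR₂, h5, h1, h2, h4]
  ring

end StateSum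

/-! ### The third homotopy move -/

namespace StateSum

open Nanophrase (code)

variable {L : Type*}

theorem Cross.Equiv.refl {V : Type*} (c : Cross V) : c.Equiv c :=
  Or.inl ⟨rfl, fun _ => Iff.rfl, fun _ => Iff.rfl⟩

theorem nb_cross_forall₂ {V : Type*} (E : List (V × V)) {cs cs' : List (Cross V)}
    (h : List.Forall₂ Cross.Equiv cs cs') : nb E cs = nb E cs' := by
  induction h generalizing E with
  | nil => rfl
  | cons h1 _ ih => rw [nb_cross_cons_congr _ h1, nb, nb, ih, ih]

/-- A product of three disjoint transpositions. As a relabelling of passages it performs the three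
exchanges of neighbours in the third move. -/
theorem exists_triple_swap {X : Type*} [DecidableEq X] {a b c d e f : X}
    (h : [a, b, c, d, e, f].Nodup) : ∃ g : X → X, Function.Injective g ∧ g a = b ∧ g b = a ∧
      g c = d ∧ g d = c ∧ g e = f ∧ g f = e ∧ ∀ x, x ∉ [a, b, c, d, e, f] → g x = x := by
  refine ⟨Equiv.swap a b * Equiv.swap c d * Equiv.swap e f, Equiv.injective _, ?_⟩
  simp only [List.nodup_cons, List.mem_cons, List.not_mem_nil, or_false, not_or] at h
  simp only [Equiv.Perm.coe_mul, Function.comp_apply, List.mem_cons, List.not_mem_nil, or_false,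
    not_or]
  refine ⟨?_, ?_, ?_, ?_, ?_, ?_, fun x hx => ?_⟩ <;> simp only [Equiv.swap_apply_def] <;> grind

section ThirdMove

variable {s : L → ℤˣ} {l : List L} {ws ws' : List (List (L × Bool))}
  {x y z t : List (Option (L × Bool))} {A B C : L} {b b' b'' : Bool}

/-- The local identity fixes the edges and redistributes the crossings over the six passages.
Relabelling by the triple transposition puts the crossings back in place and turns the edges into
those of the moved phrase. -/
theorem phraseSum_third_move (hA : A ∉ l) (hB : B ∉ l) (hC : C ∉ l) (hAB : A ≠ B) (hAC : A ≠ C)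
    (hBC : B ≠ C) (hs : s A = s B ∨ s B = s C) (hws : ws.flatten.Nodup)
    (h : code ws = x ++ some (A, b) :: some (B, b') :: (y ++ some (A, !b) :: some (C, b'') ::
      (z ++ some (B, !b') :: some (C, !b'') :: t)))
    (h' : code ws' = x ++ some (B, b') :: some (A, b) :: (y ++ some (C, b'') :: some (A, !b) ::
      (z ++ some (C, !b'') :: some (B, !b') :: t))) :
    phraseSum s (A :: B :: C :: l) ws = phraseSum s (A :: B :: C :: l) ws' := by
  classical
  have hlen : ws.length = ws'.length := by
    rw [← countP_isNone_code, ← countP_isNone_code, h, h']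
    simp
  obtain ⟨g, hg, hga, hgb, hga', hgc, hgb', hgc', hgx⟩ := exists_triple_swap
    (a := (A, b)) (b := (B, b')) (c := (A, !b)) (d := (C, b'')) (e := (B, !b')) (f := (C, !b''))
    (by simp [hAB, hAC, hBC, hAB.symm, hBC.symm])
  have hnd := hws
  rw [← reduceOption_code, h] at hnd
  have hdir := isDirected_code hws
  rw [h] at hdir
  have hm1 := mem_codeEdges_of_consecutive (n := 0) (c := base 0) x
    (y ++ some (A, !b) :: some (C, b'') :: (z ++ some (B, !b') :: some (C, !b'') :: t))
    (A, b) (B, b')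
  have hm2 := mem_codeEdges_of_consecutive (n := 0) (c := base 0)
    (x ++ some (A, b) :: some (B, b') :: y)
    (z ++ some (B, !b') :: some (C, !b'') :: t) (A, !b) (C, b'')
  have hm3 := mem_codeEdges_of_consecutive (n := 0) (c := base 0)
    (x ++ some (A, b) :: some (B, b') :: (y ++ some (A, !b) :: some (C, b'') :: z))
    t (B, !b') (C, !b'')
  simp only [List.append_assoc, List.cons_append] at hm2 hm3
  have hmap : code ws' = (code ws).map (Option.map g) := by
    have hid : ∀ u : List (Option (L × Bool)),
        (∀ d ∈ [(A, b), (B, b'), (A, !b), (C, b''), (B, !b'), (C, !b'')], some d ∉ u) →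
        u.map (Option.map g) = u := by
      intro u hu
      refine (List.map_congr_left fun o ho => ?_).trans (List.map_id u)
      cases o with
      | none => rfl
      | some d => exact congrArg some (hgx d fun hd => hu d hd ho)
    simp only [List.reduceOption_append, List.reduceOption_cons_of_some] at hnd
    have key : ∀ d ∈ [(A, b), (B, b'), (A, !b), (C, b''), (B, !b'), (C, !b'')],
        some d ∉ x ∧ some d ∉ y ∧ some d ∉ z ∧ some d ∉ t := by
      simp only [← List.reduceOption_mem_iff]
      intro d hd
      -- Each of the six passages is already used once, so it occurs in none of `x`, `y`, `z`, `t`,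
      -- and `g` fixes these lists.
      have hc := List.nodup_iff_count_le_one.1 hnd d
      simp only [List.count_append, List.count_cons, beq_iff_eq] at hc
      have h1 : 1 ≤ (if (A, b) = d then 1 else 0) + (if (B, b') = d then 1 else 0) +
          (if (A, !b) = d then 1 else 0) + (if (C, b'') = d then 1 else 0) +
          (if (B, !b') = d then 1 else 0) + (if (C, !b'') = d then 1 else 0) := by
        simp only [List.mem_cons, List.not_mem_nil, or_false] at hd
        rcases hd with rfl | rfl | rfl | rfl | rfl | rfl <;> simp only [if_true] <;> omega
      simp only [← List.count_pos_iff]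
      omega
    rw [h, h']
    simp only [List.map_append, List.map_cons, Option.map_some, hga, hgb, hga', hgc, hgb', hgc']
    rw [hid x fun d hd => (key d hd).1, hid y fun d hd => (key d hd).2.1,
      hid z fun d hd => (key d hd).2.2.1, hid t fun d hd => (key d hd).2.2.2]
  obtain ⟨R₁, hR₁, hdir₁, hR1, hR2⟩ := hdir.exists_perm hm1
  obtain ⟨R₂, hR₂, hdir₂, hR3, hR4⟩ := hdir₁.exists_perm (a := (A, !b)) (b := (C, b'')) (by
    simpa [hBC, hBC.symm] using hR₁.mem_iff.1 hm2)
  have hm3' : (vout (B, !b'), vin (C, !b'')) ∈ R₁ := by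
    simpa [hBC, hBC.symm] using hR₁.mem_iff.1 hm3
  obtain ⟨R, hR, -, hR5, hR6⟩ := hdir₂.exists_perm (a := (B, !b')) (b := (C, !b'')) (by
    simpa [hAB, hAB.symm] using hR₂.mem_iff.1 hm3')
  have hR' := hR₁.trans ((hR₂.trans (hR.cons _)).cons _)
  have hRf : ∀ m, Fresh m R₂ → Fresh m R := fun m hm p hp =>
    hm p (hR.mem_iff.2 (List.mem_cons_of_mem _ hp))
  have hRf' : ∀ m, Fresh m R₁ → Fresh m R := fun m hm => hRf m fun p hp =>
    hm p (hR₂.mem_iff.2 (List.mem_cons_of_mem _ hp))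
  have hav := avoids_of_not_mem s hA
  have hbv := avoids_of_not_mem s hB
  have hcv := avoids_of_not_mem s hC
  have h1 := nb_third_move (s A) (s B) (s C) hs (i₁ := vin (A, b)) (o₁ := vout (A, b))
    (i₂ := vin (A, !b)) (o₂ := vout (A, !b)) (j₁ := vin (B, b')) (p₁ := vout (B, b'))
    (j₂ := vin (B, !b')) (p₂ := vout (B, !b')) (k₁ := vin (C, b'')) (q₁ := vout (C, b''))
    (k₂ := vin (C, !b'')) (q₂ := vout (C, !b''))
    (by simp [hAB, hAC, hBC]) (E := R) (cs := l.map (cross s))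
    (by simp [hR5, hR6, hRf _ hR3, hRf _ hR4, hRf' _ hR1, hRf' _ hR2]) (by
      simp only [List.mem_cons, List.not_mem_nil, or_false, forall_eq_or_imp, forall_eq]
      exact ⟨fun k hk => (hav b k hk).2, fun k hk => (hbv b' k hk).1,
        fun k hk => (hav (!b) k hk).2, fun k hk => (hcv b'' k hk).1,
        fun k hk => (hbv (!b') k hk).2, fun k hk => (hcv (!b'') k hk).1⟩)
  have h2 : ∀ E, nb E ((A :: B :: C :: l).map (cross s)) =
      nb E (⟨s A, vin (A, b), vout (A, b), vin (A, !b), vout (A, !b)⟩ ::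
        ⟨s B, vin (B, b'), vout (B, b'), vin (B, !b'), vout (B, !b')⟩ ::
        ⟨s C, vin (C, b''), vout (C, b''), vin (C, !b''), vout (C, !b'')⟩ :: l.map (cross s)) :=
    fun E => nb_cross_forall₂ E (.cons (cross_equiv s A b) (.cons (cross_equiv s B b')
      (.cons (cross_equiv s C b'') (List.forall₂_same.2 fun c _ => .refl c))))
  have h3 : l.map (cross s) = (l.map (cross s)).map (Cross.map (vmap g)) := by
    rw [List.map_map]
    refine List.map_congr_left fun D hD => ?_
    have hg1 : ∀ o, g (D, o) = (D, o) := fun o => hgx _ (by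
      have h1 : D ≠ A := fun h => hA (h ▸ hD)
      have h2 : D ≠ B := fun h => hB (h ▸ hD)
      have h3 : D ≠ C := fun h => hC (h ▸ hD)
      simp [h1, h2, h3])
    simp [cross, Cross.map, hg1]
  have h4 : nb (codeEdges 0 (base 0) (code ws))
      (⟨s A, vin (B, b'), vout (B, b'), vin (C, b''), vout (C, b'')⟩ ::
        ⟨s B, vin (A, b), vout (A, b), vin (C, !b''), vout (C, !b'')⟩ ::
        ⟨s C, vin (A, !b), vout (A, !b), vin (B, !b'), vout (B, !b')⟩ :: l.map (cross s)) =
      nb (codeEdges 0 (base 0) (code ws'))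
      (⟨s A, vin (A, b), vout (A, b), vin (A, !b), vout (A, !b)⟩ ::
        ⟨s B, vin (B, b'), vout (B, b'), vin (B, !b'), vout (B, !b')⟩ ::
        ⟨s C, vin (C, b''), vout (C, b''), vin (C, !b''), vout (C, !b'')⟩ :: l.map (cross s)) := by
    rw [← nb_map (vmap_injective hg), hmap, ← codeEdges_map, vmap_base]
    simp only [List.map_cons, Cross.map, vmap_vin, vmap_vout, hga, hgb, hga', hgc, hgb', hgc', ← h3]
  rw [phraseSum_eq_codeEdges, phraseSum_eq_codeEdges, hlen, h2, h2, ← h4, h, nb_perm hR', h1,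
    nb_perm hR']

end ThirdMove

/-! ### Inversions and expansions -/

section Expansion

variable {s : L → ℤˣ} {l : List L} {U V : List (List (L × Bool))}
  {w z : List (L × Bool)} {A : L} {b : Bool}

/-- The signs after inversion of the word `w`. -/
def flipSign [DecidableEq L] (w : List (L × Bool)) (s : L → ℤˣ) (A : L) : ℤˣ :=
  if ((A, true) ∈ w ↔ (A, false) ∈ w) then s A else -s A

/-- Reversing the passages in `w`. -/
def reversePassages [DecidableEq L] (w : List (L × Bool)) : Vtx L → Vtx L
  | Sum.inl h => Sum.inl (h.1, h.2.1, xor h.2.2 (decide ((h.1, h.2.1) ∈ w)))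
  | Sum.inr n => Sum.inr n

theorem reversePassages_involutive [DecidableEq L] (w : List (L × Bool)) :
    Function.Involutive (reversePassages w) := by
  rintro (⟨A, o, d⟩ | n) <;> simp [reversePassages]

theorem reversePassages_vin [DecidableEq L] {x : L × Bool} (hx : x ∈ w) :
    reversePassages w (vin x) = vout x := by simp [reversePassages, vin, vout, hx]

theorem reversePassages_vout [DecidableEq L] {x : L × Bool} (hx : x ∈ w) :
    reversePassages w (vout x) = vin x := by simp [reversePassages, vin, vout, hx]

theorem reversePassages_of_ne [DecidableEq L] {v : Vtx L} (h : ∀ x ∈ w, v ≠ vin x ∧ v ≠ vout x) :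
    reversePassages w v = v := by
  rcases v with ⟨A, o, d⟩ | n
  · have : (A, o) ∉ w := fun hw => by
      have := h _ hw
      cases d <;> simp [vin, vout] at this
    simp [reversePassages, this]
  · rfl

/-- Reversing one strand of a crossing exchanges `par` and `alt`, and the change of sign exchanges
their coefficients. Reversing both strands preserves both uncrossings. -/
theorem cross_reversePassages [DecidableEq L] (w : List (L × Bool)) (s : L → ℤˣ) (A : L) :
    ((cross s A).map (reversePassages w)).Equiv (cross (flipSign w s) A) := by
  by_cases h1 : (A, true) ∈ w <;> by_cases h2 : (A, false) ∈ w
  · refine Or.inl ⟨by simp [Cross.map, cross, flipSign, h1, h2], fun S => ?_, fun S => ?_⟩ <;>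
      simp [Cross.map, cross, Cross.par, Cross.alt, reversePassages, vin, vout, h1, h2] <;> tauto
  · refine Or.inr ⟨by simp [Cross.map, cross, flipSign, h1, h2], fun S => ?_, fun S => ?_⟩ <;>
      simp [Cross.map, cross, Cross.par, Cross.alt, reversePassages, vin, vout, h1, h2] <;> tauto
  · refine Or.inr ⟨by simp [Cross.map, cross, flipSign, h1, h2], fun S => ?_, fun S => ?_⟩ <;>
      simp [Cross.map, cross, Cross.par, Cross.alt, reversePassages, vin, vout, h1, h2] <;> tauto
  · refine Or.inl ⟨by simp [Cross.map, cross, flipSign, h1, h2], fun S => ?_, fun S => ?_⟩ <;>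
      simp [Cross.map, cross, Cross.par, Cross.alt, reversePassages, vin, vout, h1, h2]

/-- The path is read backwards, then entrances and exits of the passages in `w` are interchanged by
a relabelling that fixes all other edges and affects only the crossings. -/
theorem nb_path_reverse [DecidableEq L] {u v : Vtx L} {E : List (Vtx L × Vtx L)}
    (hu : ∀ x ∈ w, u ≠ vin x ∧ u ≠ vout x) (hv : ∀ x ∈ w, v ≠ vin x ∧ v ≠ vout x)
    (hE : ∀ x ∈ w, Fresh (vin x) E ∧ Fresh (vout x) E) :
    nb (path vin vout u w v ++ E) (l.map (cross s)) =
      nb (path vin vout v w.reverse u ++ E) (l.map (cross (flipSign w s))) := by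
  have h1 : nb (path vin vout u w v ++ E) (l.map (cross s)) =
      nb (path vout vin v w.reverse u ++ E) (l.map (cross s)) :=
    nb_congr (fun S => by simp only [resp_append, resp_path_reverse S u]) _
  have h2 : E.map (Prod.map (reversePassages w) (reversePassages w)) = E := by
    refine (List.map_congr_left fun p hp => ?_).trans (List.map_id E)
    refine Prod.ext (reversePassages_of_ne fun x hx => ?_) (reversePassages_of_ne fun x hx => ?_)
    · exact ⟨((hE x hx).1 p hp).1, ((hE x hx).2 p hp).1⟩
    · exact ⟨((hE x hx).1 p hp).2, ((hE x hx).2 p hp).2⟩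
  have h3 : (path vout vin v w.reverse u).map
      (Prod.map (reversePassages w) (reversePassages w)) = path vin vout v w.reverse u := by
    rw [path_map (i := vout) (o := vin) (i' := vin) (o' := vout) (g := fun x => x)
      (fun x hx => reversePassages_vout (List.mem_reverse.1 hx))
      (fun x hx => reversePassages_vin (List.mem_reverse.1 hx)),
      List.map_id', reversePassages_of_ne hu, reversePassages_of_ne hv]
  rw [h1, ← nb_map (reversePassages_involutive w).injective, List.map_append, h2, h3, List.map_map]
  exact nb_cross_congr _ fun A _ => cross_reversePassages w s A

/-- Singles out one word, based at any vertex not otherwise used. Such a vertex may also be a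
half-edge of a crossing that has been removed, which is how the self-expansion uses the version for
two words. The extra `dd` is the cost of the base point, or the factor of the word if it is empty.
-/
theorem phraseSum_word {b : Vtx L} (hw : ∀ x ∈ w, vin x ≠ b ∧ vout x ≠ b)
    (hE : Fresh b ((U ++ V).flatMap (cyc vin vout))) (hcs : ∀ c ∈ l.map (cross s), c.Avoids b) :
    phraseSum s l (U ++ w :: V) = dd ^ ((U ++ V).countP List.isEmpty + 1) *
      nb (path vin vout b w b ++ (U ++ V).flatMap (cyc vin vout)) (l.map (cross s)) := by
  rw [nb_cyc hw hE hcs, phraseSum, nb_congr (F := cyc vin vout w ++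
    (U ++ V).flatMap (cyc vin vout)) (fun S => by simp; tauto)]
  have := dd_ne_zero
  cases w with
  | nil => simp [List.countP_append, ← add_assoc]
  | cons x w =>
    simp [List.countP_append, pow_succ]
    field_simp

theorem fresh_flatMap_cyc {v : Vtx L} {ws : List (List (L × Bool))}
    (h : ∀ x ∈ ws.flatten, vin x ≠ v ∧ vout x ≠ v) : Fresh v (ws.flatMap (cyc vin vout)) := by
  intro p hp
  obtain ⟨w, hw, hp⟩ := List.mem_flatMap.1 hp
  exact fresh_cyc (fun x hx => h x (List.mem_flatten_of_mem hw hx)) p hp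

theorem phraseSum_two_words {b b' : Vtx L} (hw : ∀ x ∈ w, vin x ≠ b ∧ vout x ≠ b)
    (hz : ∀ x ∈ z, vin x ≠ b' ∧ vout x ≠ b') (hb : b ≠ b')
    (hwb : ∀ x ∈ w, vin x ≠ b' ∧ vout x ≠ b') (hzb : ∀ x ∈ z, vin x ≠ b ∧ vout x ≠ b)
    (hE : Fresh b ((U ++ V).flatMap (cyc vin vout)))
    (hE' : Fresh b' ((U ++ V).flatMap (cyc vin vout)))
    (hcs : ∀ c ∈ l.map (cross s), c.Avoids b) (hcs' : ∀ c ∈ l.map (cross s), c.Avoids b') :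
    phraseSum s l (U ++ w :: z :: V) = dd ^ ((U ++ V).countP List.isEmpty + 2) *
      nb (path vin vout b w b ++ path vin vout b' z b' ++ (U ++ V).flatMap (cyc vin vout))
        (l.map (cross s)) := by
  have h1 : nb ((U ++ z :: V).flatMap (cyc vin vout) ++ path vin vout b w b) (l.map (cross s)) =
      nb (cyc vin vout z ++ (path vin vout b w b ++ (U ++ V).flatMap (cyc vin vout)))
        (l.map (cross s)) :=
    nb_congr (fun S => by simp; tauto) _
  have h2 : Fresh b' (path vin vout b w b ++ (U ++ V).flatMap (cyc vin vout)) := by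
    rw [fresh_append]
    exact ⟨fresh_path hb hb hwb, hE'⟩
  rw [phraseSum_word hw _ hcs, nb_perm List.perm_append_comm, h1, List.append_assoc,
    nb_congr (E := path vin vout b w b ++ _) (F := path vin vout b' z b' ++
      (path vin vout b w b ++ (U ++ V).flatMap (cyc vin vout))) (fun S => by simp; tauto),
    nb_cyc hz h2 hcs']
  · have := dd_ne_zero
    cases z with
    | nil => simp [List.countP_append, ← add_assoc]
    | cons x z =>
      simp [List.countP_append, pow_succ]
      field_simp
  · simp only [List.flatMap_append, List.flatMap_cons, fresh_append] at hE ⊢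
    exact ⟨hE.1, fresh_cyc hzb, hE.2⟩

theorem nb_elim {u v m : Vtx L} (w z : List (L × Bool)) {E F : List (Vtx L × Vtx L)}
    {cs : List (Cross (Vtx L))}
    (h : ∀ S, Resp S F ↔ Resp S (path vin vout u w m) ∧ Resp S (path vin vout m z v) ∧ Resp S E)
    (hu : u ≠ m) (hv : v ≠ m) (hw : ∀ x ∈ w, vin x ≠ m ∧ vout x ≠ m)
    (hz : ∀ x ∈ z, vin x ≠ m ∧ vout x ≠ m) (hE : Fresh m E) (hcs : ∀ c ∈ cs, c.Avoids m) :
    nb F cs = dd⁻¹ * nb (path vin vout u (w ++ z) v ++ E) cs := by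
  rw [← nb_path_append hu hv hw hz hE hcs]
  exact nb_congr (fun S => by simp [h]) _

/-- The passages through `A` do not occur in `w`. -/
theorem ne_of_not_mem {x : L × Bool} (hx : x ∉ w) :
    (∀ y ∈ w, vin y ≠ vin x ∧ vout y ≠ vin x) ∧ ∀ y ∈ w, vin y ≠ vout x ∧ vout y ≠ vout x := by
  refine ⟨fun y hy => ⟨?_, by simp⟩, fun y hy => ⟨by simp, ?_⟩⟩ <;>
    simp only [ne_eq, vin_inj, vout_inj] <;> rintro rfl <;> exact hx hy

/-- Two paths leave the vertex `vout (A, b)`. Running the first one backwards produces a single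
closed path with `w` reversed, from which that vertex is dropped; the reversal changes the signs. -/
theorem nb_reverse_append [DecidableEq L] {n : ℕ} {E : List (Vtx L × Vtx L)} (hA : A ∉ l)
    (haw : (A, b) ∉ w) (haz : (A, b) ∉ z) (hwz : ∀ x ∈ w, x ∉ z) (haE : Fresh (vout (A, b)) E)
    (hE : ∀ x ∈ w, Fresh (vin x) E ∧ Fresh (vout x) E) :
    nb (path vin vout (vout (A, b)) w (base n) ++ (path vin vout (vout (A, b)) z (base n) ++ E))
        (l.map (cross s)) =
      dd⁻¹ * nb (path vin vout (base n) (w.reverse ++ z) (base n) ++ E)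
        (l.map (cross (flipSign w s))) := by
  have h1 := ne_of_not_mem haw
  have h2 := ne_of_not_mem haz
  rw [nb_path_reverse (fun x hx => ⟨by simp, (h1.2 x hx).2.symm⟩) (by simp) fun x hx => ?_,
    nb_elim (u := base n) (m := vout (A, b)) (v := base n) w.reverse z
      (fun S => by simp only [resp_append]) (by simp) (by simp)
      (fun x hx => h1.2 x (List.mem_reverse.1 hx)) h2.2 haE
      fun k hk => (avoids_of_not_mem _ hA b k hk).2]
  have h3 := ne_of_not_mem (hwz x hx)
  rw [fresh_append, fresh_append]
  exact ⟨⟨fresh_path (by simp) (by simp) h3.1, (hE x hx).1⟩,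
    fresh_path (h1.2 x hx).2.symm (by simp) h3.2, (hE x hx).2⟩

theorem phraseSum_self_expansion [DecidableEq L] (hA : A ∉ l)
    (hnd : (U ++ ((A, b) :: w ++ (A, !b) :: z) :: V).flatten.Nodup) :
    phraseSum s (A :: l) (U ++ ((A, b) :: w ++ (A, !b) :: z) :: V) =
      dd⁻¹ ^ 4 * (tt ^ (s A : ℤ) * phraseSum s l (U ++ w :: z :: V) +
        tt ^ (-(s A : ℤ)) * phraseSum (flipSign w s) l (U ++ (w.reverse ++ z) :: V)) := by
  have hperm : (U ++ ((A, b) :: w ++ (A, !b) :: z) :: V).flatten.Perm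
      ((A, b) :: (A, !b) :: (w ++ (z ++ (U ++ V).flatten))) := by
    classical
    rw [List.perm_iff_count]
    intro x
    simp [List.count_append, List.count_cons]
    omega
  rw [hperm.nodup_iff] at hnd
  simp only [List.nodup_cons, List.mem_cons, List.mem_append, not_or] at hnd
  obtain ⟨⟨-, haw, haz, haE⟩, ⟨haw', haz', haE'⟩, hnd⟩ := hnd
  obtain ⟨hw1, hw2⟩ := ne_of_not_mem haw
  obtain ⟨hw3, hw4⟩ := ne_of_not_mem haw'
  obtain ⟨hz1, hz2⟩ := ne_of_not_mem haz
  obtain ⟨hz3, hz4⟩ := ne_of_not_mem haz'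
  obtain ⟨hE1, hE2⟩ := ne_of_not_mem haE
  obtain ⟨hE3, hE4⟩ := ne_of_not_mem haE'
  replace hE1 := fresh_flatMap_cyc hE1
  replace hE2 := fresh_flatMap_cyc hE2
  replace hE3 := fresh_flatMap_cyc hE3
  replace hE4 := fresh_flatMap_cyc hE4
  have hav := avoids_of_not_mem s hA
  have hE0 : ∀ n, Fresh (base n) ((U ++ V).flatMap (cyc vin vout)) := fun n =>
    fresh_flatMap_cyc (by simp)
  rw [phraseSum_word (b := base 0) (by simp) (hE0 0) (by simp [cross_avoids_base]),
    phraseSum_word (b := base 0) (by simp) (hE0 0) (by simp [cross_avoids_base]),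
    phraseSum_two_words (b := vout (A, b)) (b' := base 0) hw2 (by simp) (by simp) (by simp) hz2 hE2
      (hE0 0) (fun c hc => (hav b c hc).2) (by simp [cross_avoids_base]),
    List.map_cons, nb_cross_cons_congr _ (cross_equiv s A b), nb]
  have hwz : ∀ x ∈ w, x ∉ z := fun x hx hz =>
    (List.nodup_append.1 hnd).2.2 x hx x (by simp [hz]) rfl
  have hEw : ∀ x ∈ w, Fresh (vin x) ((U ++ V).flatMap (cyc vin vout)) ∧
      Fresh (vout x) ((U ++ V).flatMap (cyc vin vout)) := fun x hx => by
    have h := ne_of_not_mem (x := x) (w := (U ++ V).flatten) fun h =>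
      (List.nodup_append.1 hnd).2.2 x hx x (List.mem_append_right _ h) rfl
    exact ⟨fresh_flatMap_cyc h.1, fresh_flatMap_cyc h.2⟩
  generalize (U ++ V).flatMap (cyc vin vout) = E at *
  have hcA : ∀ b, ∀ k ∈ l.map (cross s), k.Avoids (vin (A, b)) := fun b k hk => (hav b k hk).1
  have hcA' : ∀ b, ∀ k ∈ l.map (cross s), k.Avoids (vout (A, b)) := fun b k hk => (hav b k hk).2
  -- The oriented uncrossing closes `w` up at `vout (A, b)`, which is kept as its base point; the
  -- other three half-edges of `A` are dropped.
  have h1 : nb (Cross.par ⟨s A, vin (A, b), vout (A, b), vin (A, !b), vout (A, !b)⟩ ++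
      (path vin vout (base 0) ((A, b) :: w ++ (A, !b) :: z) (base 0) ++ E)) (l.map (cross s)) =
      dd⁻¹ ^ 3 * nb (path vin vout (vout (A, b)) w (vout (A, b)) ++
        path vin vout (base 0) z (base 0) ++ E) (l.map (cross s)) := by
    rw [nb_elim (u := base 0) (m := vin (A, b)) (v := vout (A, !b)) [] []
        (E := (vin (A, !b), vout (A, b)) :: (path vin vout (vout (A, b)) w (vin (A, !b)) ++
          (path vin vout (vout (A, !b)) z (base 0) ++ E))) (fun S => ?_) (by simp) (by simp)
        (by simp) (by simp) ?_ (hcA b),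
      nb_elim (u := base 0) (m := vout (A, !b)) (v := base 0) [] z
        (E := (vin (A, !b), vout (A, b)) :: (path vin vout (vout (A, b)) w (vin (A, !b)) ++ E))
        (fun S => ?_) (by simp) (by simp) (by simp) hz4 ?_ (hcA' _),
      nb_elim (u := vout (A, b)) (m := vin (A, !b)) (v := vout (A, b)) w []
        (E := path vin vout (base 0) z (base 0) ++ E)
        (fun S => ?_) (by simp) (by simp) hw3 (by simp) ?_ (hcA _)]
    · simp only [List.append_nil, List.append_assoc]
      ring
    all_goals simp only [Cross.par, path, path_append_cons, resp_append, resp_cons, resp_nil,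
      List.nil_append, List.cons_append, List.append_nil, fresh_cons, fresh_append]
    · exact ⟨fresh_path (by simp) (by simp) hz3, hE3⟩
    · grind
    · exact ⟨by simp, fresh_path (by simp) (by simp) hw4, hE4⟩
    · grind
    · exact ⟨by simp, fresh_path (by simp) (by simp) hw1, fresh_path (by simp) (by simp) hz1, hE1⟩
    · grind
  -- The other uncrossing joins the two exits of `A`. The vertex `vout (A, b)` is kept as the point
  -- from which `w` and `z` both start.
  have h2 : nb (Cross.alt ⟨s A, vin (A, b), vout (A, b), vin (A, !b), vout (A, !b)⟩ ++
      (path vin vout (base 0) ((A, b) :: w ++ (A, !b) :: z) (base 0) ++ E)) (l.map (cross s)) =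
      dd⁻¹ ^ 3 * nb (path vin vout (vout (A, b)) w (base 0) ++
        (path vin vout (vout (A, b)) z (base 0) ++ E)) (l.map (cross s)) := by
    rw [nb_elim (u := base 0) (m := vin (A, b)) (v := vin (A, !b)) [] []
        (E := (vout (A, b), vout (A, !b)) :: (path vin vout (vout (A, b)) w (vin (A, !b)) ++
          (path vin vout (vout (A, !b)) z (base 0) ++ E))) (fun S => ?_) (by simp) (by simp)
        (by simp) (by simp) ?_ (hcA b),
      nb_elim (u := vout (A, b)) (m := vin (A, !b)) (v := base 0) w []
        (E := (vout (A, b), vout (A, !b)) :: (path vin vout (vout (A, !b)) z (base 0) ++ E))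
        (fun S => ?_) (by simp) (by simp) hw3 (by simp) ?_ (hcA _),
      nb_elim (u := vout (A, b)) (m := vout (A, !b)) (v := base 0) [] z
        (E := path vin vout (vout (A, b)) w (base 0) ++ E)
        (fun S => ?_) (by simp) (by simp) (by simp) hz4 ?_ (hcA' _),
      nb_congr (E := path vin vout (vout (A, b)) ([] ++ z) _ ++ _)
        (F := path vin vout (vout (A, b)) w (base 0) ++
          (path vin vout (vout (A, b)) z (base 0) ++ E)) (fun S => ?_)]
    · ring
    all_goals simp only [Cross.alt, path, path_append_cons, resp_append, resp_cons, resp_nil,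
      List.nil_append, List.cons_append, List.append_nil, fresh_cons, fresh_append]
    · grind
    · exact ⟨fresh_path (by simp) (by simp) hw4, hE4⟩
    · grind
    · exact ⟨by simp, fresh_path (by simp) (by simp) hz3, hE3⟩
    · grind
    · exact ⟨by simp, fresh_path (by simp) (by simp) hw1, fresh_path (by simp) (by simp) hz1, hE1⟩
    · grind
  rw [h1, h2, nb_reverse_append hA haw haz hwz hE2 hEw]
  have := dd_ne_zero
  field_simp
  ring

set_option maxHeartbeats 1000000 in
theorem phraseSum_mixed_expansion [DecidableEq L] (hA : A ∉ l)
    (hnd : (U ++ ((A, b) :: w) :: ((A, !b) :: z) :: V).flatten.Nodup) :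
    phraseSum s (A :: l) (U ++ ((A, b) :: w) :: ((A, !b) :: z) :: V) =
      dd⁻¹ ^ 4 * (tt ^ (s A : ℤ) * phraseSum s l (U ++ (w ++ z) :: V) +
        tt ^ (-(s A : ℤ)) * phraseSum (flipSign w s) l (U ++ (w.reverse ++ z) :: V)) := by
  have hperm : (U ++ ((A, b) :: w) :: ((A, !b) :: z) :: V).flatten.Perm
      ((A, b) :: (A, !b) :: (w ++ (z ++ (U ++ V).flatten))) := by
    classical
    rw [List.perm_iff_count]
    intro x
    simp [List.count_append, List.count_cons]
    omega
  rw [hperm.nodup_iff] at hnd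
  simp only [List.nodup_cons, List.mem_cons, List.mem_append, not_or] at hnd
  obtain ⟨⟨-, haw, haz, haE⟩, ⟨haw', haz', haE'⟩, hnd⟩ := hnd
  obtain ⟨hw1, hw2⟩ := ne_of_not_mem haw
  obtain ⟨hw3, hw4⟩ := ne_of_not_mem haw'
  obtain ⟨hz1, hz2⟩ := ne_of_not_mem haz
  obtain ⟨hz3, hz4⟩ := ne_of_not_mem haz'
  obtain ⟨hE1, hE2⟩ := ne_of_not_mem haE
  obtain ⟨hE3, hE4⟩ := ne_of_not_mem haE'
  replace hE1 := fresh_flatMap_cyc hE1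
  replace hE2 := fresh_flatMap_cyc hE2
  replace hE3 := fresh_flatMap_cyc hE3
  replace hE4 := fresh_flatMap_cyc hE4
  have hav := avoids_of_not_mem s hA
  have hE0 : ∀ n, Fresh (base n) ((U ++ V).flatMap (cyc vin vout)) := fun n =>
    fresh_flatMap_cyc (by simp)
  rw [phraseSum_two_words (b := base 0) (b' := base 1) (by simp) (by simp) (by simp) (by simp)
      (by simp) (hE0 0) (hE0 1) (by simp [cross_avoids_base]) (by simp [cross_avoids_base]),
    phraseSum_word (b := base 1) (by simp) (hE0 1) (by simp [cross_avoids_base]),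
    phraseSum_word (b := base 1) (by simp) (hE0 1) (by simp [cross_avoids_base]),
    List.map_cons, nb_cross_cons_congr _ (cross_equiv s A b), nb]
  have hwz : ∀ x ∈ w, x ∉ z := fun x hx hz =>
    (List.nodup_append.1 hnd).2.2 x hx x (by simp [hz]) rfl
  have hEw : ∀ x ∈ w, Fresh (vin x) ((U ++ V).flatMap (cyc vin vout)) ∧
      Fresh (vout x) ((U ++ V).flatMap (cyc vin vout)) := fun x hx => by
    have h := ne_of_not_mem (x := x) (w := (U ++ V).flatten) fun h =>
      (List.nodup_append.1 hnd).2.2 x hx x (List.mem_append_right _ h) rfl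
    exact ⟨fresh_flatMap_cyc h.1, fresh_flatMap_cyc h.2⟩
  generalize (U ++ V).flatMap (cyc vin vout) = E at *
  have hcA : ∀ b, ∀ k ∈ l.map (cross s), k.Avoids (vin (A, b)) := fun b k hk => (hav b k hk).1
  have hcA' : ∀ b, ∀ k ∈ l.map (cross s), k.Avoids (vout (A, b)) := fun b k hk => (hav b k hk).2
  have hE0' := hE0 0
  have hcs : ∀ k ∈ l.map (cross s), k.Avoids (base 0) := by simp [cross_avoids_base]
  -- The two words merge into `w ++ z`: the four half-edges of `A` and the base point `base 0`
  -- disappear, five vertices in all.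
  have h1 : nb (Cross.par ⟨s A, vin (A, b), vout (A, b), vin (A, !b), vout (A, !b)⟩ ++
      (path vin vout (base 0) ((A, b) :: w) (base 0) ++
        path vin vout (base 1) ((A, !b) :: z) (base 1) ++ E)) (l.map (cross s)) =
      dd⁻¹ ^ 5 * nb (path vin vout (base 1) (w ++ z) (base 1) ++ E) (l.map (cross s)) := by
    rw [nb_elim (u := base 0) (m := vin (A, b)) (v := vout (A, !b)) [] []
        (E := (base 1, vin (A, !b)) :: (vin (A, !b), vout (A, b)) ::
          (path vin vout (vout (A, b)) w (base 0) ++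
          (path vin vout (vout (A, !b)) z (base 1) ++ E))) (fun S => ?_) (by simp) (by simp)
        (by simp) (by simp) ?_ (hcA b),
      nb_elim (u := base 1) (m := vin (A, !b)) (v := vout (A, b)) [] []
        (E := (base 0, vout (A, !b)) :: (path vin vout (vout (A, b)) w (base 0) ++
          (path vin vout (vout (A, !b)) z (base 1) ++ E))) (fun S => ?_) (by simp) (by simp)
        (by simp) (by simp) ?_ (hcA _),
      nb_elim (u := base 1) (m := vout (A, b)) (v := base 0) [] w
        (E := (base 0, vout (A, !b)) :: (path vin vout (vout (A, !b)) z (base 1) ++ E))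
        (fun S => ?_) (by simp) (by simp) (by simp) hw2 ?_ (hcA' _),
      nb_elim (u := base 0) (m := vout (A, !b)) (v := base 1) [] z
        (E := path vin vout (base 1) w (base 0) ++ E)
        (fun S => ?_) (by simp) (by simp) (by simp) hz4 ?_ (hcA' _),
      nb_elim (u := base 1) (m := base 0) (v := base 1) w z (E := E)
        (fun S => ?_) (by simp) (by simp) (by simp) (by simp) hE0' hcs]
    · ring
    all_goals simp only [Cross.par, path, resp_append, resp_cons, resp_nil,
      List.nil_append, List.cons_append, fresh_cons, fresh_append]
    · grind
    · exact ⟨fresh_path (by simp) (by simp) hw4, hE4⟩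
    · grind
    · exact ⟨by simp, fresh_path (by simp) (by simp) hz2, hE2⟩
    · grind
    · exact ⟨by simp, fresh_path (by simp) (by simp) hw3, fresh_path (by simp) (by simp) hz3, hE3⟩
    · grind
    · exact ⟨by simp, by simp, fresh_path (by simp) (by simp) hw1,
        fresh_path (by simp) (by simp) hz1, hE1⟩
    · grind
  -- Here only four vertices are dropped; the fifth, `vout (A, b)`, goes when `w` is reversed.
  have h2 : nb (Cross.alt ⟨s A, vin (A, b), vout (A, b), vin (A, !b), vout (A, !b)⟩ ++
      (path vin vout (base 0) ((A, b) :: w) (base 0) ++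
        path vin vout (base 1) ((A, !b) :: z) (base 1) ++ E)) (l.map (cross s)) =
      dd⁻¹ ^ 4 * nb (path vin vout (vout (A, b)) w (base 1) ++
        (path vin vout (vout (A, b)) z (base 1) ++ E)) (l.map (cross s)) := by
    rw [nb_elim (u := base 0) (m := vin (A, b)) (v := vin (A, !b)) [] []
        (E := (base 1, vin (A, !b)) :: (vout (A, b), vout (A, !b)) ::
          (path vin vout (vout (A, b)) w (base 0) ++
          (path vin vout (vout (A, !b)) z (base 1) ++ E))) (fun S => ?_) (by simp) (by simp)
        (by simp) (by simp) ?_ (hcA b),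
      nb_elim (u := base 0) (m := vin (A, !b)) (v := base 1) [] []
        (E := (vout (A, b), vout (A, !b)) :: (path vin vout (vout (A, b)) w (base 0) ++
          (path vin vout (vout (A, !b)) z (base 1) ++ E))) (fun S => ?_) (by simp) (by simp)
        (by simp) (by simp) ?_ (hcA _),
      nb_elim (u := vout (A, b)) (m := base 0) (v := base 1) w []
        (E := (vout (A, b), vout (A, !b)) :: (path vin vout (vout (A, !b)) z (base 1) ++ E))
        (fun S => ?_) (by simp) (by simp) (by simp) (by simp) ?_ hcs,
      nb_elim (u := vout (A, b)) (m := vout (A, !b)) (v := base 1) [] z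
        (E := path vin vout (vout (A, b)) w (base 1) ++ E)
        (fun S => ?_) (by simp) (by simp) (by simp) hz4 ?_ (hcA' _),
      nb_congr (E := path vin vout (vout (A, b)) ([] ++ z) _ ++ _)
        (F := path vin vout (vout (A, b)) w (base 1) ++
          (path vin vout (vout (A, b)) z (base 1) ++ E)) (fun S => ?_)]
    · ring
    all_goals simp only [Cross.alt, path, resp_append, resp_cons, resp_nil,
      List.nil_append, List.cons_append, List.append_nil, fresh_cons, fresh_append]
    · grind
    · exact ⟨fresh_path (by simp) (by simp) hw4, hE4⟩
    · grind
    · exact ⟨by simp, fresh_path (by simp) (by simp) (by simp), hE0'⟩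
    · grind
    · exact ⟨by simp, fresh_path (by simp) (by simp) hw3, fresh_path (by simp) (by simp) hz3, hE3⟩
    · grind
    · exact ⟨by simp, by simp, fresh_path (by simp) (by simp) hw1,
        fresh_path (by simp) (by simp) hz1, hE1⟩
    · grind
  rw [h1, h2, nb_reverse_append hA haw haz hwz hE2 hEw]
  have := dd_ne_zero
  field_simp
  ring

theorem phraseSum_inversion [DecidableEq L] (hnd : (U ++ w :: V).flatten.Nodup) :
    phraseSum s l (U ++ w :: V) = phraseSum (flipSign w s) l (U ++ w.reverse :: V) := by
  have hE0 : Fresh (base 0) ((U ++ V).flatMap (cyc vin vout)) := fresh_flatMap_cyc (by simp)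
  have hperm : (U ++ w :: V).flatten.Perm (w ++ (U ++ V).flatten) := by
    rw [List.perm_iff_count]
    intro x
    simp [List.count_append]
    omega
  rw [hperm.nodup_iff, List.nodup_append] at hnd
  rw [phraseSum_word (b := base 0) (by simp) hE0 (by simp [cross_avoids_base]),
    phraseSum_word (b := base 0) (by simp) hE0 (by simp [cross_avoids_base]),
    nb_path_reverse (by simp) (by simp) fun x hx => ?_]
  have h := ne_of_not_mem (x := x) (w := (U ++ V).flatten) fun h => hnd.2.2 x hx x h rfl
  exact ⟨fresh_flatMap_cyc h.1, fresh_flatMap_cyc h.2⟩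

end Expansion

end StateSum

namespace StateSum

/-! ### State sums as sums over states -/

theorem resp_flatMap {V ι : Type*} (S : V → Prop) (f : ι → List (V × V)) (l : List ι) :
    Resp S (l.flatMap f) ↔ ∀ c ∈ l, Resp S (f c) := by
  induction l with
  | nil => simp
  | cons c l ih => simp [ih]

theorem resp_map {V ι : Type*} (S : V → Prop) (f : ι → V × V) (l : List ι) :
    Resp S (l.map f) ↔ ∀ c ∈ l, (S (f c).1 ↔ S (f c).2) := by
  simp [Resp]

section States

variable {V : Type*}

/-- The uncrossing with coefficient `t` (if `b` is true) or `t⁻¹`. -/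
def Cross.smooth (c : Cross V) (b : Bool) : List (V × V) :=
  if (b = true ↔ c.sign = 1) then c.par else c.alt

theorem nb_cons_eq_smooth (E : List (V × V)) (c : Cross V) (cs : List (Cross V)) :
    nb E (c :: cs) = tt⁻¹ * nb (c.smooth false ++ E) cs + tt * nb (c.smooth true ++ E) cs := by
  rw [nb, Cross.smooth, Cross.smooth]
  rcases Int.units_eq_one_or c.sign with h | h
  · simp [h, add_comm]
  · have h' : ¬ ((-1 : ℤˣ) = 1) := by decide
    simp [h, h']

/-- Unfolds the recursion into a sum over states, a state being the set of crossings uncrossed with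
coefficient `t`. -/
theorem nb_eq_sum {ι : Type*} [DecidableEq ι] (f : ι → Cross V) (E : List (V × V)) {l : List ι}
    (hl : l.Nodup) : nb E (l.map f) = ∑ S ∈ l.toFinset.powerset,
      tt ^ (∑ c ∈ l.toFinset, if c ∈ S then (1 : ℤ) else -1) *
        dd⁻¹ ^ rank (l.flatMap (fun c => (f c).smooth (decide (c ∈ S))) ++ E) := by
  induction l generalizing E with
  | nil => simp [nb]
  | cons a l ih =>
    rw [List.nodup_cons] at hl
    have ha : a ∉ l.toFinset := by simpa using hl.1
    rw [List.toFinset_cons, Finset.sum_powerset_insert ha, List.map_cons, nb_cons_eq_smooth,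
      ih _ hl.2, ih _ hl.2, Finset.mul_sum, Finset.mul_sum]
    have hrank : ∀ F G H : List (V × V), rank (F ++ (G ++ H)) = rank (G ++ F ++ H) := fun F G H =>
      rank_perm (by
        rw [← List.append_assoc]
        exact List.perm_append_comm.append_right _)
    congr 1 <;> refine Finset.sum_congr rfl fun S hS => ?_
    · have haS : a ∉ S := fun h => ha (Finset.mem_powerset.1 hS h)
      rw [Finset.sum_insert ha, if_neg haS, zpow_add₀ tt_ne_zero, zpow_neg_one, hrank,
        List.flatMap_cons, decide_eq_false haS, mul_assoc]
    · rw [Finset.sum_insert ha, if_pos (Finset.mem_insert_self _ _), zpow_add₀ tt_ne_zero, zpow_one,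
        hrank, List.flatMap_cons, decide_eq_true (Finset.mem_insert_self _ _), mul_assoc]
      have h1 : ∀ c ∈ l, (c ∈ insert a S ↔ c ∈ S) := fun c hc => by
        rw [Finset.mem_insert, or_iff_right]
        rintro rfl
        exact hl.1 hc
      have h2 : (l.flatMap fun c => (f c).smooth (decide (c ∈ insert a S))) =
          l.flatMap fun c => (f c).smooth (decide (c ∈ S)) := by
        simp only [List.flatMap]
        congr 1
        exact List.map_congr_left fun c hc => by simp only [h1 c hc]
      rw [h2, Finset.sum_congr rfl fun c hc => if_congr (h1 c (List.mem_toFinset.1 hc)) rfl rfl]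

theorem nb_univ_eq_sum {ι : Type*} [Fintype ι] [DecidableEq ι] (f : ι → Cross V)
    (E : List (V × V)) : nb E ((Finset.univ : Finset ι).toList.map f) = ∑ s : ι → Bool,
      tt ^ (∑ c, if s c = true then (1 : ℤ) else -1) *
        dd⁻¹ ^ rank ((Finset.univ : Finset ι).toList.flatMap (fun c => (f c).smooth (s c)) ++ E) := by
  rw [nb_eq_sum f E (Finset.nodup_toList _), Finset.toList_toFinset, Finset.powerset_univ]
  refine Finset.sum_bij' (fun S _ c => decide (c ∈ S)) (fun s _ => Finset.univ.filter (s · = true))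
    (by simp) (by simp) (by simp) (by simp) fun S _ => ?_
  simp

end States

/-! ### The bracket of a link diagram -/

section Diagram

variable (D : LinkDiagram.{u})

/-- The edges of a link diagram. -/
noncomputable def diagramEdges : List (Vtx D.Crossing × Vtx D.Crossing) :=
  (Finset.univ : Finset (D.Crossing × Bool)).toList.map fun x => (vout x, vin (D.next x))

/-- Translates the counterclockwise description of the uncrossings: it joins ends of opposite
directions when the choice `s` matches the sign, and ends of equal directions otherwise. -/
theorem joined_iff (s : D.Crossing → Bool) (h h' : D.HalfEdge) :
    D.Joined s h h' ↔ h.2.1 = true ∧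
      h' = (h.1, false, if (s h.1 = true ↔ D.sign h.1 = 1) then !h.2.2 else h.2.2) := by
  obtain ⟨c, o, d⟩ := h
  obtain ⟨c', o', d'⟩ := h'
  have hne : ¬ ((-1 : ℤˣ) = 1) := by decide
  by_cases hcc : c' = c
  · subst hcc
    rcases Int.units_eq_one_or (D.sign c') with hs | hs <;> cases hsc : s c' <;> cases o <;>
      cases d <;> cases o' <;> cases d' <;> simp [LinkDiagram.Joined, LinkDiagram.rot, hs, hsc, hne]
  · have h1 : (D.rot (c, o, d)).1 = c := by unfold LinkDiagram.rot; split_ifs <;> rfl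
    have h2 : (D.rot (c', o', d')).1 = c' := by unfold LinkDiagram.rot; split_ifs <;> rfl
    simp only [LinkDiagram.Joined, Prod.mk.injEq, hcc, false_and, and_false, iff_false, not_and]
    rintro -
    split_ifs
    · exact fun h => hcc (by rw [← h2, h])
    · exact fun h => hcc (by rw [← h1, ← h])

theorem resp_loops_iff (s : D.Crossing → Bool) (S : D.HalfEdge → Prop) :
    (∀ a b, (b = D.opp a ∨ D.Joined s a b) → (S a ↔ S b)) ↔
      (∀ c, Resp S (Cross.smooth ⟨D.sign c, (c, true, false), (c, true, true), (c, false, false),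
        (c, false, true)⟩ (s c))) ∧
      ∀ x, S (x.1, x.2, true) ↔ S ((D.next x).1, (D.next x).2, false) := by
  have h1 : (∀ a, S a ↔ S (D.opp a)) ↔
      ∀ x, S (x.1, x.2, true) ↔ S ((D.next x).1, (D.next x).2, false) := by
    constructor
    · intro h x
      simpa [LinkDiagram.opp] using h (x.1, x.2, true)
    · rintro h ⟨c, o, d⟩
      cases d
      · have := h (D.next.symm (c, o))
        simp only [Equiv.apply_symm_apply] at this
        simp [LinkDiagram.opp, this]
      · simpa [LinkDiagram.opp] using h (c, o)
  have h2 : (∀ a b, D.Joined s a b → (S a ↔ S b)) ↔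
      ∀ c, Resp S (Cross.smooth ⟨D.sign c, (c, true, false), (c, true, true), (c, false, false),
        (c, false, true)⟩ (s c)) := by
    have key : (∀ a b, D.Joined s a b → (S a ↔ S b)) ↔ ∀ c d, (S (c, true, d) ↔
        S (c, false, if (s c = true ↔ D.sign c = 1) then !d else d)) := by
      simp only [joined_iff]
      constructor
      · exact fun h c d => h (c, true, d) _ ⟨rfl, rfl⟩
      · rintro h ⟨c, o, d⟩ b ⟨ho, rfl⟩
        simp only at ho
        subst ho
        exact h c d
    rw [key]
    refine forall_congr' fun c => ?_
    by_cases hc : (s c = true ↔ D.sign c = 1)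
    · simp only [Cross.smooth, hc, Cross.par, if_true, Bool.forall_bool, resp_cons, resp_nil,
        Bool.not_true, Bool.not_false]
      tauto
    · simp only [Cross.smooth, hc, Cross.alt, if_false, Bool.forall_bool, resp_cons, resp_nil,
        and_true]
  rw [← h1, ← h2]
  constructor
  · exact fun h => ⟨fun a b hab => h a b (Or.inr hab), fun a => h a _ (Or.inl rfl)⟩
  · rintro ⟨h, h'⟩ a b (rfl | hab)
    · exact h' a
    · exact h a b hab

theorem loops_add_rank (s : D.Crossing → Bool) :
    D.loops s + rank ((Finset.univ : Finset D.Crossing).toList.flatMap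
      (fun c => (cross D.sign c).smooth (s c)) ++ diagramEdges D) =
    D.circles + 4 * Fintype.card D.Crossing := by
  -- The count is made on half-edges only, four per crossing, because `Vtx` also contains infinitely
  -- many base points.
  let F : List (D.HalfEdge × D.HalfEdge) := (Finset.univ : Finset D.Crossing).toList.flatMap
      (fun c => Cross.smooth ⟨D.sign c, (c, true, false), (c, true, true), (c, false, false),
        (c, false, true)⟩ (s c)) ++ (Finset.univ : Finset (D.Crossing × Bool)).toList.map
      fun x => ((x.1, x.2, true), ((D.next x).1, (D.next x).2, false))
  have hF : (Finset.univ : Finset D.Crossing).toList.flatMap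
      (fun c => (cross D.sign c).smooth (s c)) ++ diagramEdges D =
        F.map (Prod.map Sum.inl Sum.inl) := by
    simp only [F, List.map_append, List.map_flatMap, List.map_map, diagramEdges]
    congr 2
    funext c
    by_cases hc : (s c = true ↔ D.sign c = 1)
    · simp only [Cross.smooth, cross, hc, if_true, Cross.par]
      rfl
    · simp only [Cross.smooth, cross, hc, if_false, Cross.alt]
      rfl
  rw [hF, rank_map Sum.inl_injective, LinkDiagram.loops, add_assoc, card_quot_add_rank,
    Nat.card_eq_fintype_card]
  · simp only [Fintype.card_prod, Fintype.card_bool]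
    ring
  · intro S
    rw [resp_loops_iff, resp_append]
    simp only [resp_flatMap, resp_map, Finset.mem_toList, Finset.mem_univ, forall_const]

/-- For a nonempty diagram every state has at least one loop, so the exponent `loops - 1` is not
truncated. The empty diagram has to be treated apart. -/
theorem algebraMap_bracket (h : D.circles ≠ 0 ∨ Nonempty D.Crossing) :
    dd * algebraMap _ FracField D.bracket = dd ^ (4 * Fintype.card D.Crossing) *
      (dd ^ D.circles * nb (diagramEdges D) (Finset.univ.toList.map (cross D.sign))) := by
  rw [LinkDiagram.bracket, map_sum, Finset.mul_sum, nb_univ_eq_sum, Finset.mul_sum, Finset.mul_sum]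
  refine Finset.sum_congr rfl fun s _ => ?_
  have h1 := loops_add_rank D s
  have h2 : 1 ≤ D.loops s := by
    rw [LinkDiagram.loops]
    rcases h with h | ⟨⟨c⟩⟩
    · omega
    · have : 0 < Nat.card (Quot fun h h' : D.HalfEdge => h' = D.opp h ∨ D.Joined s h h') := by
        have : Nonempty (Quot fun h h' : D.HalfEdge => h' = D.opp h ∨ D.Joined s h h') :=
          ⟨Quot.mk _ (c, true, true)⟩
        exact Nat.card_pos
      omega
  obtain ⟨k, hk⟩ := Nat.exists_eq_add_of_le' h2
  rw [map_mul, map_pow, algebraMap_T, algebraMap_circle, LinkDiagram.weight, hk, Nat.add_sub_cancel]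
  generalize rank _ = r at *
  have h3 : dd ^ (D.circles) * dd ^ (4 * Fintype.card D.Crossing) = dd ^ k * dd * dd ^ r := by
    rw [← pow_add, ← h1, hk, pow_add, pow_succ]
  have h4 : dd ^ r * dd⁻¹ ^ r = 1 := by
    rw [← mul_pow, mul_inv_cancel₀ dd_ne_zero, one_pow]
  linear_combination (-(tt ^ (∑ c, if s c = true then (1 : ℤ) else -1) * dd⁻¹ ^ r)) * h3 -
    (tt ^ (∑ c, if s c = true then (1 : ℤ) else -1) * dd ^ k * dd) * h4

end Diagram

end StateSum

namespace StateSum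

/-! ### The cycles of a product of cyclic permutations -/

section FormPerm

variable {L : Type*}

theorem mem_path {x : L × Bool} {l : List (L × Bool)} {v : Vtx L} {p : Vtx L × Vtx L}
    (hp : p ∈ path vin vout (vout x) l v) :
    (∃ l₁ y z l₂, x :: l = l₁ ++ y :: z :: l₂ ∧ p = (vout y, vin z)) ∨
      p = (vout ((x :: l).getLast (List.cons_ne_nil _ _)), v) := by
  induction l generalizing x with
  | nil => exact Or.inr (by simpa [path] using hp)
  | cons y l ih =>
    rw [path, List.mem_cons] at hp
    rcases hp with rfl | hp
    · exact Or.inl ⟨[], x, y, l, rfl, rfl⟩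
    · rcases ih hp with ⟨l₁, z, z', l₂, h, rfl⟩ | rfl
      · exact Or.inl ⟨x :: l₁, z, z', l₂, by rw [h, List.cons_append], rfl⟩
      · exact Or.inr (by rw [List.getLast_cons (List.cons_ne_nil _ _)])

theorem map_fst_path (u v : Vtx L) (w : List (L × Bool)) :
    (path vin vout u w v).map Prod.fst = u :: w.map vout := by
  induction w generalizing u with
  | nil => rfl
  | cons x w ih => simp [path, ih]

variable [DecidableEq L]

theorem mem_cyc_formPerm {w : List (L × Bool)} (hw : w.Nodup) {p : Vtx L × Vtx L}
    (hp : p ∈ cyc vin vout w) : ∃ x ∈ w, p = (vout x, vin (w.formPerm x)) := by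
  cases w with
  | nil => simp [cyc] at hp
  | cons x w =>
    rcases mem_path hp with ⟨l₁, y, z, l₂, h, rfl⟩ | rfl
    · have hlen : l₁.length + 1 < (l₁ ++ y :: z :: l₂).length := by simp
      rw [h] at hw ⊢
      have := List.formPerm_apply_lt_getElem _ hw l₁.length hlen
      simp only [List.getElem_append_right, le_refl, Nat.sub_self, List.getElem_cons_zero,
        Nat.le_add_right, Nat.add_sub_cancel_left, List.getElem_cons_succ] at this
      exact ⟨y, by simp, by rw [this]⟩
    · exact ⟨_, List.getLast_mem _, by rw [List.formPerm_apply_getLast]⟩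

theorem formPerm_mem_cyc {w : List (L × Bool)} (hw : w.Nodup) {x : L × Bool} (hx : x ∈ w) :
    (vout x, vin (w.formPerm x)) ∈ cyc vin vout w := by
  have h : vout x ∈ (cyc vin vout w).map Prod.fst := by
    cases w with
    | nil => simp at hx
    | cons y w =>
      rw [cyc, map_fst_path, ← List.map_cons]
      exact List.mem_map_of_mem hx
  obtain ⟨p, hp, hpx⟩ := List.mem_map.1 h
  obtain ⟨y, hy, rfl⟩ := mem_cyc_formPerm hw hp
  rw [vout_inj] at hpx
  subst hpx
  exact hp

/-- The words have disjoint supports, so only the factor of the word containing `x` moves it. -/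
theorem prod_formPerm_apply {X : Type*} [DecidableEq X] {ws : List (List X)}
    (h : ws.flatten.Nodup) {w : List X} (hw : w ∈ ws) {x : X} (hx : x ∈ w) :
    (ws.map List.formPerm).prod x = w.formPerm x := by
  have hfix : ∀ (vs : List (List X)) (y : X), y ∉ vs.flatten →
      (vs.map List.formPerm).prod y = y := by
    intro vs y hy
    induction vs with
    | nil => rfl
    | cons v vs ih =>
      rw [List.flatten_cons, List.mem_append, not_or] at hy
      rw [List.map_cons, List.prod_cons, Equiv.Perm.mul_apply, ih hy.2,
        List.formPerm_apply_of_notMem hy.1]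
  induction ws with
  | nil => simp at hw
  | cons v vs ih =>
    rw [List.flatten_cons, List.nodup_append] at h
    rw [List.map_cons, List.prod_cons, Equiv.Perm.mul_apply]
    rcases List.mem_cons.1 hw with rfl | hw
    · rw [hfix vs x fun hx' => h.2.2 x hx x hx' rfl]
    · rw [ih h.2.1 hw]
      refine List.formPerm_apply_of_notMem fun hv => ?_
      exact h.2.2 _ hv _ (List.mem_flatten_of_mem hw (List.formPerm_apply_mem_of_mem hx)) rfl

/-- The closed paths along the words have exactly the edges of the diagram, since the product of the
cyclic permutations is its `next`. -/
theorem resp_flatMap_cyc {ws : List (List (L × Bool))} (h : ws.flatten.Nodup)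
    (h' : ∀ x, x ∈ ws.flatten) (S : Vtx L → Prop) :
    Resp S (ws.flatMap (cyc vin vout)) ↔
      ∀ x, S (vout x) ↔ S (vin ((ws.map List.formPerm).prod x)) := by
  constructor
  · intro hS x
    obtain ⟨w, hw, hx⟩ := List.mem_flatten.1 (h' x)
    rw [prod_formPerm_apply h hw hx]
    exact hS _ (List.mem_flatMap.2 ⟨w, hw, formPerm_mem_cyc ((List.nodup_flatten.1 h).1 w hw) hx⟩)
  · intro hS p hp
    obtain ⟨w, hw, hp⟩ := List.mem_flatMap.1 hp
    obtain ⟨x, hx, rfl⟩ := mem_cyc_formPerm ((List.nodup_flatten.1 h).1 w hw) hp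
    rw [← prod_formPerm_apply h hw hx]
    exact hS x

end FormPerm

/-! ### Passages of a phrase -/

section Passages

variable {L : Type u} [DecidableEq L] (fst : L → Bool)

open Nanophrase (passagesWord passages)

theorem passagesWord_congr {seen seen' : List L} (h : ∀ A, A ∈ seen ↔ A ∈ seen') (w : List L) :
    passagesWord fst seen w = passagesWord fst seen' w := by
  induction w generalizing seen seen' with
  | nil => rfl
  | cons A w ih =>
    rw [passagesWord, passagesWord, ih (seen := A :: seen) (seen' := A :: seen') (by simp [h])]
    simp only [h]

theorem passagesWord_append (seen w w' : List L) :
    passagesWord fst seen (w ++ w') =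
      passagesWord fst seen w ++ passagesWord fst (w ++ seen) w' := by
  induction w generalizing seen with
  | nil => rfl
  | cons A w ih =>
    rw [List.cons_append, passagesWord, passagesWord, ih, List.cons_append,
      passagesWord_congr (seen := w ++ A :: seen) (seen' := A :: w ++ seen)]
    intro B
    simp
    tauto

theorem flatten_passages (seen : List L) (ws : List (List L)) :
    (passages fst seen ws).flatten = passagesWord fst seen ws.flatten := by
  induction ws generalizing seen with
  | nil => rfl
  | cons w ws ih => rw [passages, List.flatten_cons, ih, List.flatten_cons, passagesWord_append]

theorem map_fst_passagesWord (seen w : List L) : (passagesWord fst seen w).map Prod.fst = w := by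
  induction w generalizing seen with
  | nil => rfl
  | cons A w ih => rw [passagesWord, List.map_cons, ih]

theorem map_fst_passages (seen : List L) (ws : List (List L)) :
    (passages fst seen ws).map (List.map Prod.fst) = ws := by
  induction ws generalizing seen with
  | nil => rfl
  | cons w ws ih => rw [passages, List.map_cons, ih, map_fst_passagesWord]

theorem snd_of_mem_passagesWord {seen w : List L} {x : L × Bool}
    (hx : x ∈ passagesWord fst seen w) (hs : x.1 ∈ seen) : x.2 = !fst x.1 := by
  induction w generalizing seen with
  | nil => simp [passagesWord] at hx
  | cons A w ih =>
    rw [passagesWord, List.mem_cons] at hx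
    rcases hx with rfl | hx
    · exact if_pos hs
    · exact ih hx (List.mem_cons_of_mem _ hs)

theorem nodup_passagesWord {seen w : List L}
    (h : ∀ A, w.count A + (if A ∈ seen then 1 else 0) ≤ 2) : (passagesWord fst seen w).Nodup := by
  induction w generalizing seen with
  | nil => exact List.nodup_nil
  | cons A w ih =>
    rw [passagesWord, List.nodup_cons]
    refine ⟨fun hA => ?_, ih fun B => ?_⟩
    · by_cases hs : A ∈ seen
      · have h1 := h A
        rw [if_pos hs, List.count_cons_self] at h1
        have h2 : A ∈ w := by
          rw [← map_fst_passagesWord fst (A :: seen) w]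
          exact List.mem_map_of_mem hA
        have := List.count_pos_iff.2 h2
        omega
      · have := snd_of_mem_passagesWord fst hA (by simp)
        simp [hs] at this
    · have h1 := h B
      rw [List.count_cons] at h1
      by_cases hB : A = B
      · subst hB
        simp only [beq_self_eq_true, if_true, List.mem_cons, true_or] at h1 ⊢
        omega
      · have hB' : ¬ B = A := fun h => hB h.symm
        simpa [hB, hB'] using h1

theorem count_map_fst (l : List (L × Bool)) (A : L) :
    (l.map Prod.fst).count A = l.count (A, true) + l.count (A, false) := by
  induction l with
  | nil => rfl
  | cons x l ih =>
    obtain ⟨B, b⟩ := x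
    simp only [List.map_cons, List.count_cons, ih, beq_iff_eq, Prod.mk.injEq]
    by_cases h : B = A <;> cases b <;> simp [h] <;> omega

theorem mem_of_count_eq_two {l : List (L × Bool)} (hl : l.Nodup) {A : L}
    (h : (l.map Prod.fst).count A = 2) (b : Bool) : (A, b) ∈ l := by
  rw [count_map_fst] at h
  have h1 := List.nodup_iff_count_le_one.1 hl (A, true)
  have h2 := List.nodup_iff_count_le_one.1 hl (A, false)
  rw [← List.count_pos_iff]
  cases b <;> omega

end Passages

end StateSum

namespace StateSum

open Nanophrase (passagesWord passages code)

/-! ### The normalized state sum of a nanophrase over `{1, -1}` -/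

section NormSum

variable {L : Type u}

/-- The state sum of a phrase of passages with the normalization of the bracket. -/
noncomputable def normSum (s : L → ℤˣ) (l : List L) (ws : List (List (L × Bool))) : FracField :=
  dd⁻¹ * dd ^ (4 * l.length) * phraseSum s l ws

theorem normSum_perm (s : L → ℤˣ) {l l' : List L} (hl : l.Perm l')
    (ws : List (List (L × Bool))) : normSum s l ws = normSum s l' ws := by
  rw [normSum, normSum, phraseSum_perm s hl, hl.length_eq]

end NormSum

theorem bracket_of_isEmpty (D : LinkDiagram.{u}) [IsEmpty D.Crossing] (h : D.circles = 0) :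
    D.bracket = 1 := by
  have hl : ∀ s, D.loops s = 0 := by
    intro s
    rw [LinkDiagram.loops, h, zero_add]
    exact Nat.card_of_isEmpty
  rw [LinkDiagram.bracket, Fintype.sum_unique, hl]
  simp [LinkDiagram.weight]

theorem flatten_nodup_passages {α : Type} (p : Nanophrase.{u} α) (fst : p.Letter → Bool) :
    (passages fst [] p.words).flatten.Nodup := by
  rw [flatten_passages]
  exact nodup_passagesWord fst fun A => by simp [p.gauss A]

theorem mem_flatten_passages {α : Type} (p : Nanophrase.{u} α) (fst : p.Letter → Bool)
    (x : p.Letter × Bool) : x ∈ (passages fst [] p.words).flatten := by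
  refine mem_of_count_eq_two (flatten_nodup_passages p fst) ?_ x.2
  rw [flatten_passages, map_fst_passagesWord, p.gauss]

theorem isEmpty_letter {α : Type} {p : Nanophrase.{u} α} (h : p.words.flatten = []) :
    IsEmpty p.Letter :=
  ⟨fun A => by simpa [h] using p.gauss A⟩

theorem algebraMap_bracket_diagram (P : Nanophrase.{u} AlphaStar) (h : P.words ≠ []) :
    algebraMap _ FracField P.bracket = normSum (fun A => (P.proj A).sign) Finset.univ.toList
      (passages (fun A => (P.proj A).firstOver) [] P.words) := by
  have h0 : P.diagram.circles ≠ 0 ∨ Nonempty P.diagram.Crossing := by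
    obtain ⟨w, hw⟩ := List.exists_mem_of_ne_nil _ h
    cases w with
    | nil => exact Or.inl (List.countP_pos_iff.2 ⟨[], hw, rfl⟩).ne'
    | cons A w => exact Or.inr ⟨A⟩
  have key := algebraMap_bracket P.diagram h0
  have hE : nb (diagramEdges P.diagram) (Finset.univ.toList.map (cross P.diagram.sign)) =
      nb ((passages (fun A => (P.proj A).firstOver) [] P.words).flatMap (cyc vin vout))
        (Finset.univ.toList.map (cross fun A => (P.proj A).sign)) := by
    refine nb_congr (fun S => ?_) _
    refine Iff.trans ?_
      (resp_flatMap_cyc (flatten_nodup_passages P _) (mem_flatten_passages P _) S).symm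
    rw [diagramEdges, resp_map]
    simp only [Finset.mem_toList, Finset.mem_univ, forall_const]
    rfl
  have hc : P.diagram.circles =
      (passages (fun A => (P.proj A).firstOver) [] P.words).countP List.isEmpty := by
    rw [← countP_isEmpty_map Prod.fst, map_fst_passages]
    rfl
  rw [hE, hc] at key
  rw [normSum, phraseSum, Finset.length_toList, mul_assoc, eq_inv_mul_iff_mul_eq₀ dd_ne_zero]
  exact key

open Classical in
/-- The image of the bracket in the field of fractions, as a function of a nanophrase over
`{1, -1}`. -/
noncomputable def signSum (p : Nanophrase.{u} ℤˣ) : FracField :=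
  if p.words = [] then 1
  else normSum p.proj Finset.univ.toList (passages (fun _ => true) [] p.words)

/-- The choice of first passages is irrelevant, so it may be replaced by the constant one; the right
side then sees only the projection to `{1, -1}`. The empty phrase is separate, since its `normSum`
would be `dd⁻¹` and not `1`. -/
theorem algebraMap_bracket_eq_signSum (P : Nanophrase.{u} AlphaStar) :
    algebraMap _ FracField P.bracket = signSum P.toSigns := by
  by_cases h : P.words = []
  · have hs : signSum P.toSigns = 1 := if_pos h
    have : IsEmpty P.diagram.Crossing := isEmpty_letter (p := P) (by rw [h]; rfl)
    rw [hs, Nanophrase.bracket, bracket_of_isEmpty P.diagram (by simp [Nanophrase.diagram, h]),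
      map_one]
  · have hs : signSum P.toSigns = normSum (fun A => (P.proj A).sign) Finset.univ.toList
        (passages (fun _ => true) [] P.words) := if_neg h
    rw [hs, algebraMap_bracket_diagram P h, normSum, normSum]
    congr 1
    exact phraseSum_eq_of_map_fst (by rw [map_fst_passages, map_fst_passages])
      (flatten_nodup_passages P _) (flatten_nodup_passages P _) _ _

/-! ### The state sum under changes of the alphabet -/

section Transport

variable {p q : Nanophrase.{u} ℤˣ}

theorem exists_perm_univ {ι : Type*} [Fintype ι] [DecidableEq ι] {K : List ι} (hK : K.Nodup) :
    ∃ l : List ι, (K ++ l).Perm Finset.univ.toList := by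
  refine ⟨Finset.univ.toList.filter (· ∉ K), ?_⟩
  rw [List.perm_ext_iff_of_nodup _ (Finset.nodup_toList _)]
  · intro A
    simp [em]
  · refine List.nodup_append.2 ⟨hK, (Finset.nodup_toList _).filter _, ?_⟩
    rintro A hA B hB rfl
    simp [hA] at hB

/-- Allows the sum of `q` to be computed inside a larger alphabet and with any choice of passages,
so that two phrases related by an operation can be compared over one alphabet. -/
theorem signSum_eq {L : Type u} (f : q.Letter ↪ L) {s : L → ℤˣ} (hs : ∀ B, q.proj B = s (f B))
    {l : List L} (hl : l.Nodup) {vs : List (List (L × Bool))}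
    (hl' : ∀ A, A ∈ l ↔ A ∈ vs.flatten.map Prod.fst)
    (hv : vs.map (List.map Prod.fst) = q.words.map (List.map f)) (hnd : vs.flatten.Nodup)
    (h0 : vs ≠ []) : signSum q = normSum s l vs := by
  have hw : q.words ≠ [] := by
    rintro h
    rw [h] at hv
    exact h0 (by simpa using hv)
  have hlp : l.Perm ((Finset.univ : Finset q.Letter).toList.map f) := by
    rw [List.perm_ext_iff_of_nodup hl ((Finset.nodup_toList _).map f.injective)]
    intro A
    rw [hl', List.map_flatten, hv, ← List.map_flatten]
    simp only [List.mem_map, Finset.mem_toList, Finset.mem_univ, true_and]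
    refine ⟨fun ⟨B, _, h⟩ => ⟨B, h⟩, fun ⟨B, h⟩ => ⟨B, ?_, h⟩⟩
    rw [← List.count_pos_iff, q.gauss]
    exact Nat.two_pos
  have hs' : q.proj = fun B => s (f B) := funext hs
  rw [signSum, if_neg hw, normSum_perm s hlp, normSum, normSum, List.length_map, hs',
    ← phraseSum_map f.injective]
  congr 1
  refine phraseSum_eq_of_map_fst ?_ ?_ hnd _ _
  · rw [hv, List.map_map]
    conv_rhs => rw [← map_fst_passages (fun _ => true) [] q.words, List.map_map]
    refine List.map_congr_left fun w _ => ?_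
    simp
  · rw [← List.map_flatten]
    exact (flatten_nodup_passages q _).map (f.injective.prodMap Function.injective_id)

/-- The alphabet of `q` is that of `p` without the letters of `K`. -/
theorem signSum_eq_of_perm (f : q.Letter ↪ p.Letter) {s : p.Letter → ℤˣ}
    (hs : ∀ B, q.proj B = s (f B)) {K l : List p.Letter} (hl : (K ++ l).Perm Finset.univ.toList)
    {vs : List (List (p.Letter × Bool))}
    (hp : p.words.flatten.Perm (K ++ K ++ vs.flatten.map Prod.fst))
    (hv : vs.map (List.map Prod.fst) = q.words.map (List.map f)) (hnd : vs.flatten.Nodup)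
    (h0 : vs ≠ []) : signSum q = normSum s l vs := by
  have hnd' : (K ++ l).Nodup := hl.nodup_iff.2 (Finset.nodup_toList _)
  refine signSum_eq f hs (List.nodup_append.1 hnd').2.1 (fun A => ?_) hv hnd h0
  -- A letter is counted twice in `K ++ K` if it lies in `K`, and otherwise occurs in `vs`; since it
  -- occurs once in `K ++ l`, the letters of `vs` are those of `l`.
  have h1 := p.gauss A
  have h2 := List.count_eq_one_of_mem hnd' (hl.mem_iff.2 (Finset.mem_toList.2 (Finset.mem_univ A)))
  rw [hp.count_eq] at h1
  simp only [List.count_append] at h1 h2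
  rw [← List.count_pos_iff, ← List.count_pos_iff]
  omega

theorem signSum_eq_self {l : List p.Letter} (hl : l.Perm Finset.univ.toList)
    {vs : List (List (p.Letter × Bool))} (hv : vs.map (List.map Prod.fst) = p.words)
    (hnd : vs.flatten.Nodup) (h0 : vs ≠ []) : signSum p = normSum p.proj l vs :=
  signSum_eq_of_perm (p := p) (Function.Embedding.refl _) (K := []) (fun _ => rfl) hl
    (by rw [List.map_flatten, hv]; rfl) (hv.trans (by simp : p.words = p.words.map (List.map id))) hnd h0

theorem signSum_of_isIsomorphic (h : Nanophrase.IsIsomorphic p q) : signSum p = signSum q := by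
  obtain ⟨f, hw, hs⟩ := h
  by_cases h0 : p.words = []
  · have hq : q.words = [] := by simpa [h0] using hw
    rw [signSum, signSum, if_pos h0, if_pos hq]
  · have h1 : passages (fun _ => true) [] p.words ≠ [] := fun h => h0 (by
      rw [← map_fst_passages (fun _ => true) [] p.words, h]; rfl)
    rw [signSum_eq_self (List.Perm.refl _) (map_fst_passages _ _ _) (flatten_nodup_passages p _) h1]
    refine (signSum_eq_of_perm (p := p) f.toEmbedding (K := []) hs (List.Perm.refl _) ?_ ?_
      (flatten_nodup_passages p _) h1).symm
    · rw [List.map_flatten, map_fst_passages]; rfl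
    · rw [map_fst_passages]; exact hw.symm

end Transport

end StateSum

namespace StateSum

open Nanophrase (passagesWord passages code)

/-! ### Shifts and permutations of words -/

section Words

variable {L : Type u}

theorem phraseSum_eq_of_resp {ws ws' : List (List (L × Bool))}
    (hc : ws.countP List.isEmpty = ws'.countP List.isEmpty)
    (hE : ∀ S, Resp S (ws.flatMap (cyc vin vout)) ↔ Resp S (ws'.flatMap (cyc vin vout)))
    (s : L → ℤˣ) (l : List L) : phraseSum s l ws = phraseSum s l ws' := by
  rw [phraseSum, phraseSum, hc, nb_congr hE]

theorem resp_cyc_shift (S : Vtx L → Prop) (a : L × Bool) (w : List (L × Bool)) :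
    Resp S (cyc vin vout (a :: w)) ↔ Resp S (cyc vin vout (w ++ [a])) := by
  cases w with
  | nil => rfl
  | cons b w =>
    rw [cyc, List.cons_append, cyc, path_append_cons, path, path]
    simp only [resp_cons, resp_append, resp_nil]
    tauto

theorem phraseSum_shift (s : L → ℤˣ) (l : List L) (U V : List (List (L × Bool))) (a : L × Bool)
    (w : List (L × Bool)) :
    phraseSum s l (U ++ (a :: w) :: V) = phraseSum s l (U ++ (w ++ [a]) :: V) := by
  refine phraseSum_eq_of_resp ?_ (fun S => ?_) s l
  · simp
  · simp only [List.flatMap_append, List.flatMap_cons, resp_append, resp_cyc_shift S a w]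

theorem phraseSum_swap (s : L → ℤˣ) (l : List L) (U V : List (List (L × Bool)))
    (v w : List (L × Bool)) :
    phraseSum s l (U ++ v :: w :: V) = phraseSum s l (U ++ w :: v :: V) := by
  refine phraseSum_eq_of_resp ?_ (fun S => ?_) s l
  · exact ((List.Perm.swap w v V).append_left U).countP_eq _
  · simp only [List.flatMap_append, List.flatMap_cons, resp_append]
    tauto

theorem phraseSum_nil_word (s : L → ℤˣ) (l : List L) (U V : List (List (L × Bool))) :
    phraseSum s l (U ++ [] :: V) = dd * phraseSum s l (U ++ V) := by
  rw [phraseSum, phraseSum]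
  simp only [List.countP_append, List.countP_cons, List.flatMap_append, List.flatMap_cons, cyc,
    List.isEmpty_nil, if_true, List.nil_append]
  ring

end Words

/-! ### The operations on nanophrases over `{1, -1}` -/

section Operations

variable {p q r : Nanophrase.{u} ℤˣ}

theorem exists_passages (p : Nanophrase.{u} ℤˣ) :
    ∃ vs : List (List (p.Letter × Bool)), vs.map (List.map Prod.fst) = p.words ∧
      vs.flatten.Nodup :=
  ⟨_, map_fst_passages _ _ _, flatten_nodup_passages p fun _ => true⟩

theorem map_fst_eq_append_cons {L : Type u} {vs : List (List (L × Bool))} {U V : List (List L)}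
    {w : List L} (h : vs.map (List.map Prod.fst) = U ++ w :: V) :
    ∃ U' w' V', vs = U' ++ w' :: V' ∧ U'.map (List.map Prod.fst) = U ∧ w'.map Prod.fst = w ∧
      V'.map (List.map Prod.fst) = V := by
  obtain ⟨U', l, rfl, hU, hl⟩ := List.map_eq_append_iff.1 h
  obtain ⟨w', V', rfl, hw, hV⟩ := List.map_eq_cons_iff.1 hl
  exact ⟨U', w', V', rfl, hU, hw, hV⟩

/-- The scheme common to the operations: choose passages for `p`, lift the decomposition of its
words to passages, apply the corresponding identity of `phraseSum`, and recognize the outcome as the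
sum of `q`. -/
theorem signSum_of_isShift (h : Nanophrase.IsShift id p q) : signSum p = signSum q := by
  obtain ⟨f, U, V, A, w, hp, hq, hs⟩ := h
  obtain ⟨vs, hv, hnd⟩ := exists_passages p
  rw [hp] at hv
  obtain ⟨U', w', V', rfl, rfl, hw, rfl⟩ := map_fst_eq_append_cons hv
  obtain ⟨a, w', rfl, rfl, rfl⟩ := List.map_eq_cons_iff.1 hw
  have hperm : (U' ++ (w' ++ [a]) :: V').flatten.Perm (U' ++ (a :: w') :: V').flatten := by
    simp only [List.flatten_append, List.flatten_cons]
    exact ((List.perm_append_singleton a w').append_right _).append_left _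
  rw [signSum_eq_self (List.Perm.refl _) (hp ▸ hv) hnd (by simp), normSum, phraseSum_shift]
  refine (signSum_eq_of_perm (p := p) f.toEmbedding (K := []) (fun B => by simpa using hs B)
    (List.Perm.refl _) ?_ ?_ (hperm.nodup_iff.2 hnd) (by simp)).symm
  · rw [hp, ← hv, ← List.map_flatten]
    exact (hperm.map _).symm
  · rw [Equiv.coe_toEmbedding, hq]
    simp

theorem signSum_of_isPermutation (h : Nanophrase.IsPermutation id p q) :
    signSum p = signSum q := by
  obtain ⟨f, U, V, v, w, hp, hq, hs⟩ := h
  obtain ⟨vs, hv, hnd⟩ := exists_passages p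
  rw [hp] at hv
  obtain ⟨U', v', V', rfl, rfl, rfl, hV⟩ := map_fst_eq_append_cons hv
  obtain ⟨w', V', rfl, rfl, rfl⟩ := List.map_eq_cons_iff.1 hV
  have hperm : (U' ++ w' :: v' :: V').flatten.Perm (U' ++ v' :: w' :: V').flatten :=
    ((List.Perm.swap v' w' V').append_left U').flatten
  rw [signSum_eq_self (List.Perm.refl _) (hp ▸ hv) hnd (by simp), normSum, phraseSum_swap]
  refine (signSum_eq_of_perm (p := p) f.toEmbedding (K := []) (fun B => by simpa using hs B)
    (List.Perm.refl _) ?_ ?_ (hperm.nodup_iff.2 hnd) (by simp)).symm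
  · rw [hp, ← hv, ← List.map_flatten]
    exact (hperm.map _).symm
  · rw [Equiv.coe_toEmbedding, hq]
    simp

/-- A letter occurs exactly once in the word iff exactly one of its two passages does. -/
theorem flipSign_eq_twist {l : List (p.Letter × Bool)} (hl : l.Nodup) (A : p.Letter) :
    flipSign l p.proj A = p.twist (fun a => -a) id (l.map Prod.fst) A := by
  rw [Nanophrase.twist, count_map_fst, flipSign]
  have h1 := List.nodup_iff_count_le_one.1 hl (A, true)
  have h2 := List.nodup_iff_count_le_one.1 hl (A, false)
  simp only [← List.count_pos_iff, id]
  split_ifs <;> first | rfl | (exfalso; omega)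

theorem signSum_of_isInversion {w : List p.Letter}
    (h : Nanophrase.IsInversion (fun a => -a) id p q w) : signSum p = signSum q := by
  obtain ⟨f, U, V, hp, hq, hs⟩ := h
  obtain ⟨vs, hv, hnd⟩ := exists_passages p
  rw [hp] at hv
  obtain ⟨U', w', V', rfl, rfl, rfl, rfl⟩ := map_fst_eq_append_cons hv
  have hperm : (U' ++ w'.reverse :: V').flatten.Perm (U' ++ w' :: V').flatten := by
    simp only [List.flatten_append, List.flatten_cons]
    exact ((List.reverse_perm w').append_right _).append_left _
  have hw' : w'.Nodup := (List.nodup_flatten.1 hnd).1 _ (by simp)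
  rw [signSum_eq_self (List.Perm.refl _) (hp ▸ hv) hnd (by simp), normSum, phraseSum_inversion hnd]
  refine (signSum_eq_of_perm (p := p) f.toEmbedding (K := [])
    (fun B => (hs B).trans (flipSign_eq_twist hw' _).symm)
    (List.Perm.refl _) ?_ ?_ (hperm.nodup_iff.2 hnd) (by simp)).symm
  · rw [hp, ← hv, ← List.map_flatten]
    exact (hperm.map _).symm
  · rw [Equiv.coe_toEmbedding, hq]
    simp

theorem signSum_of_isEmptyWordDeletion (h : Nanophrase.IsEmptyWordDeletion p q) :
    signSum p = dd * signSum q := by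
  obtain ⟨f, U, V, h0, hp, hq, hs⟩ := h
  obtain ⟨vs, hv, hnd⟩ := exists_passages p
  rw [hp] at hv
  obtain ⟨U', w', V', rfl, rfl, hw, rfl⟩ := map_fst_eq_append_cons hv
  obtain rfl := List.map_eq_nil_iff.1 hw
  have hfl : (U' ++ [] :: V').flatten = (U' ++ V').flatten := by simp
  have hq' : signSum q = normSum p.proj Finset.univ.toList (U' ++ V') := by
    refine signSum_eq_of_perm (p := p) f.toEmbedding (K := []) hs
      (List.Perm.refl _) ?_ ?_ (hfl ▸ hnd) ?_
    · rw [hp, ← hv, ← List.map_flatten, hfl]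
      exact List.Perm.refl _
    · rw [Equiv.coe_toEmbedding, hq]
      simp
    -- A word must remain: the sum of the phrase without words is `1` by convention and does not
    -- follow the general formula.
    · rintro h
      rw [← List.map_append, h] at h0
      exact h0 rfl
  rw [signSum_eq_self (List.Perm.refl _) (hp ▸ hv) hnd (by simp), hq', normSum, normSum,
    phraseSum_nil_word]
  ring

theorem signSum_of_words_eq (h : p.words = [[]]) : signSum p = 1 := by
  have hE : IsEmpty p.Letter := isEmpty_letter (by rw [h]; rfl)
  rw [signSum_eq_self (l := []) (vs := [[]]) (by simp) h.symm (by simp) (by simp), normSum,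
    phraseSum]
  have : dd⁻¹ * dd = 1 := inv_mul_cancel₀ dd_ne_zero
  simpa [cyc, nb, rank] using this

end Operations

end StateSum

namespace StateSum

open Nanophrase (passagesWord passages code)

/-! ### Homotopy moves and expansions of nanophrases over `{1, -1}` -/

theorem map_code {L M : Type*} (g : L → M) (ws : List (List L)) :
    (code ws).map (Option.map g) = code (ws.map (List.map g)) := by
  induction ws with
  | nil => rfl
  | cons w ws ih =>
    rw [code_cons, List.map_append, List.map_cons, List.map_cons, code_cons, ih]
    simp [Function.comp_def]

theorem map_fst_eq_pair {L : Type u} {m : List (Option (L × Bool))} {A B : L}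
    (h : m.map (Option.map Prod.fst) = [some A, some B]) :
    ∃ b b', m = [some (A, b), some (B, b')] := by
  obtain ⟨a, m, rfl, ha, hm⟩ := List.map_eq_cons_iff.1 h
  obtain ⟨c, m, rfl, hc, hm⟩ := List.map_eq_cons_iff.1 hm
  obtain rfl := List.map_eq_nil_iff.1 hm
  obtain ⟨⟨A, b⟩, rfl, rfl⟩ := Option.map_eq_some_iff.1 ha
  obtain ⟨⟨B, b'⟩, rfl, rfl⟩ := Option.map_eq_some_iff.1 hc
  exact ⟨b, b', rfl⟩

/-- Two occurrences of a letter are different passages through the same crossing. -/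
theorem eq_not_of_code {L : Type u} {vs : List (List (L × Bool))} (hnd : vs.flatten.Nodup)
    {x y : List (Option (L × Bool))} {A : L} {b b' : Bool}
    (h : code vs = x ++ some (A, b) :: y) (h' : some (A, b') ∈ y) : b' = !b := by
  rw [← reduceOption_code, h, List.reduceOption_append, List.reduceOption_cons_of_some,
    List.nodup_append, List.nodup_cons, List.reduceOption_mem_iff] at hnd
  rw [Bool.eq_not]
  rintro rfl
  exact hnd.2.1.1 h'

theorem ne_nil_of_code {L M : Type*} {vs : List (List L)} {ws : List (List M)}
    (h : (code vs).countP Option.isNone = (code ws).countP Option.isNone) (hw : ws ≠ []) :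
    vs ≠ [] := by
  rintro rfl
  rw [countP_isNone_code, countP_isNone_code] at h
  exact hw (List.length_eq_zero_iff.1 h.symm)

section Moves

variable {p q r : Nanophrase.{u} ℤˣ}

theorem signSum_eq_of_removal (f : q.Letter ↪ p.Letter) {s : p.Letter → ℤˣ}
    (hs : ∀ B, q.proj B = s (f B)) {vs vs' : List (List (p.Letter × Bool))}
    {M : List (p.Letter × Bool)} {K l : List p.Letter} (hl : (K ++ l).Perm Finset.univ.toList)
    (hv : vs.map (List.map Prod.fst) = p.words) (hnd : vs.flatten.Nodup)
    (hM : (M.map Prod.fst).Perm (K ++ K)) (hperm : vs.flatten.Perm (M ++ vs'.flatten))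
    (hv' : vs'.map (List.map Prod.fst) = q.words.map (List.map f)) (h0 : vs' ≠ []) :
    signSum q = normSum s l vs' := by
  refine signSum_eq_of_perm f hs hl ?_ hv' (List.nodup_append.1 (hperm.nodup_iff.1 hnd)).2.1 h0
  rw [← hv, ← List.map_flatten]
  refine (hperm.map _).trans ?_
  rw [List.map_append]
  exact hM.append_right _

theorem signSum_of_isFirstMove {A : p.Letter} (h : Nanophrase.IsFirstMove p q A) :
    signSum q = -tt ^ (-3 * (p.proj A : ℤ)) * signSum p := by
  obtain ⟨f, x, y, hp, hq, hs⟩ := h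
  obtain ⟨vs, hv, hnd⟩ := exists_passages p
  rw [← hv, ← map_code] at hp
  obtain ⟨x', y', hc, hx, rfl⟩ := List.map_eq_append_iff.1 hp
  obtain ⟨x', m, rfl, rfl, hm⟩ := List.map_eq_append_iff.1 hx
  obtain ⟨b, b', rfl⟩ := map_fst_eq_pair hm
  have hc : code vs = x' ++ some (A, b) :: some (A, b') :: y' := by rw [hc]; simp
  obtain rfl := eq_not_of_code hnd hc (b' := b') (by simp)
  rw [← List.map_append] at hq
  obtain ⟨vs', hc', hv'⟩ := exists_code_eq_of_map hq.symm
  obtain ⟨l, hl⟩ := exists_perm_univ (List.nodup_singleton A)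
  have hA : A ∉ l := (List.nodup_cons.1 (hl.nodup_iff.2 (Finset.nodup_toList _))).1
  have h0 : vs ≠ [] := by rintro rfl; simp [code] at hc
  have hperm : vs.flatten.Perm ([(A, b), (A, !b)] ++ vs'.flatten) := by
    rw [← reduceOption_code, ← reduceOption_code, hc, ← hc', List.perm_iff_count]
    intro c
    simp [List.reduceOption_append, List.count_cons]
    omega
  have h0' : vs' ≠ [] := ne_nil_of_code (by rw [hc, ← hc']; simp) h0
  rw [signSum_eq_of_removal f hs hl hv hnd (List.Perm.refl _) hperm hv' h0',
    signSum_eq_self hl hv hnd h0, normSum, normSum, List.singleton_append,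
    phraseSum_first_move hA hnd hc hc'.symm, List.length_cons]
  -- The four half-edges of the deleted letter are matched by the factor `dd ^ 4` per letter in
  -- `normSum`.
  have h1 : dd⁻¹ ^ 4 * dd ^ 4 = 1 := by rw [← mul_pow, inv_mul_cancel₀ dd_ne_zero, one_pow]
  have h2 : tt ^ (-3 * (p.proj A : ℤ)) * tt ^ (3 * (p.proj A : ℤ)) = 1 := by
    rw [← zpow_add₀ tt_ne_zero, neg_mul, neg_add_cancel, zpow_zero]
  linear_combination (-dd⁻¹ * dd ^ (4 * l.length) * phraseSum p.proj l vs') *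
    (h1 * (tt ^ (-3 * (p.proj A : ℤ)) * tt ^ (3 * (p.proj A : ℤ))) + h2)

theorem signSum_of_isSecondMove (h : Nanophrase.IsSecondMove (fun a => -a) p q) :
    signSum p = signSum q := by
  obtain ⟨f, A, B, x, y, z, hAB, hsAB, hp, hq, hs⟩ := h
  obtain ⟨vs, hv, hnd⟩ := exists_passages p
  rw [← hv, ← map_code] at hp
  obtain ⟨_, z', hc, hx₁, rfl⟩ := List.map_eq_append_iff.1 hp
  obtain ⟨_, m₂, rfl, hx₂, hm₂⟩ := List.map_eq_append_iff.1 hx₁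
  obtain ⟨_, y', rfl, hx₃, rfl⟩ := List.map_eq_append_iff.1 hx₂
  obtain ⟨x', m₁, rfl, rfl, hm₁⟩ := List.map_eq_append_iff.1 hx₃
  obtain ⟨b, b', rfl⟩ := map_fst_eq_pair hm₁
  obtain ⟨c', c, rfl⟩ := map_fst_eq_pair hm₂
  have hc : code vs = x' ++ some (A, b) :: some (B, b') ::
      (y' ++ some (B, c') :: some (A, c) :: z') := by rw [hc]; simp
  obtain rfl := eq_not_of_code hnd hc (b' := c) (by simp)
  obtain rfl := eq_not_of_code hnd (x := x' ++ [some (A, b)]) (A := B) (b := b') (b' := c')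
    (by rw [hc, List.append_assoc]; rfl) (by simp)
  rw [← List.map_append, ← List.map_append] at hq
  obtain ⟨vs', hc', hv'⟩ := exists_code_eq_of_map hq.symm
  obtain ⟨l, hl⟩ := exists_perm_univ (K := [A, B]) (by simp [hAB])
  have hnl : (A :: B :: l).Nodup := hl.nodup_iff.2 (Finset.nodup_toList _)
  simp only [List.nodup_cons, List.mem_cons, not_or] at hnl
  have h0 : vs ≠ [] := by rintro rfl; simp [code] at hc
  have hperm : vs.flatten.Perm ([(A, b), (B, b'), (A, !b), (B, !b')] ++ vs'.flatten) := by
    rw [← reduceOption_code, ← reduceOption_code, hc, ← hc', List.perm_iff_count]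
    intro c
    simp [List.reduceOption_append, List.count_cons]
    omega
  have h0' : vs' ≠ [] := ne_nil_of_code (by rw [hc, ← hc']; simp) h0
  rw [signSum_eq_of_removal f hs hl hv hnd (List.Perm.refl _) hperm hv' h0',
    signSum_eq_self hl hv hnd h0, normSum, normSum, List.cons_append, List.singleton_append,
    phraseSum_second_move hnl.1.2 hnl.2.1 hAB hsAB hnd hc hc'.symm, List.length_cons,
    List.length_cons]
  have h1 : dd⁻¹ ^ 8 * dd ^ 8 = 1 := by rw [← mul_pow, inv_mul_cancel₀ dd_ne_zero, one_pow]
  linear_combination (dd⁻¹ * dd ^ (4 * l.length) * phraseSum p.proj l vs') * h1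

theorem signSum_of_isThirdMove (h : Nanophrase.IsThirdMove Nanophrase.S₁ p q) :
    signSum p = signSum q := by
  obtain ⟨f, A, B, C, x, y, z, t, hAB, hAC, hBC, hS, hp, hq, hs⟩ := h
  -- Every triple of `S₁` satisfies the condition of the local identity; the excluded triples are
  -- `(1, -1, 1)` and `(-1, 1, -1)`.
  have hS : p.proj A = p.proj B ∨ p.proj B = p.proj C := by
    simp only [Nanophrase.S₁, Set.mem_insert_iff, Set.mem_singleton_iff, Prod.mk.injEq] at hS
    rcases hS with h | h | h | h | h | h <;> simp [h]
  obtain ⟨vs, hv, hnd⟩ := exists_passages p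
  rw [← hv, ← map_code] at hp
  obtain ⟨_, t', hc, hx₁, rfl⟩ := List.map_eq_append_iff.1 hp
  obtain ⟨_, m₃, rfl, hx₂, hm₃⟩ := List.map_eq_append_iff.1 hx₁
  obtain ⟨_, z', rfl, hx₃, rfl⟩ := List.map_eq_append_iff.1 hx₂
  obtain ⟨_, m₂, rfl, hx₄, hm₂⟩ := List.map_eq_append_iff.1 hx₃
  obtain ⟨_, y', rfl, hx₅, rfl⟩ := List.map_eq_append_iff.1 hx₄
  obtain ⟨x', m₁, rfl, rfl, hm₁⟩ := List.map_eq_append_iff.1 hx₅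
  obtain ⟨b₁, b₂, rfl⟩ := map_fst_eq_pair hm₁
  obtain ⟨c₁, b₃, rfl⟩ := map_fst_eq_pair hm₂
  obtain ⟨c₂, c₃, rfl⟩ := map_fst_eq_pair hm₃
  have hc : code vs = x' ++ some (A, b₁) :: some (B, b₂) :: (y' ++ some (A, c₁) :: some (C, b₃) ::
      (z' ++ some (B, c₂) :: some (C, c₃) :: t')) := by rw [hc]; simp
  obtain rfl := eq_not_of_code hnd hc (b' := c₁) (by simp)
  obtain rfl := eq_not_of_code hnd (x := x' ++ [some (A, b₁)]) (A := B) (b := b₂) (b' := c₂)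
    (by rw [hc, List.append_assoc]; rfl) (by simp)
  obtain rfl := eq_not_of_code hnd
    (x := x' ++ some (A, b₁) :: some (B, b₂) :: (y' ++ [some (A, !b₁)]))
    (A := C) (b := b₃) (b' := c₃) (by rw [hc]; simp; rfl) (by simp)
  have hq' : (x' ++ some (B, b₂) :: some (A, b₁) :: (y' ++ some (C, b₃) :: some (A, !b₁) ::
      (z' ++ some (C, !b₃) :: some (B, !b₂) :: t'))).map (Option.map Prod.fst) =
      code (q.words.map (List.map f)) := by rw [hq]; simp
  obtain ⟨vs', hc', hv'⟩ := exists_code_eq_of_map hq'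
  obtain ⟨l, hl⟩ := exists_perm_univ (K := [A, B, C]) (by simp [hAB, hAC, hBC])
  have hnl : (A :: B :: C :: l).Nodup := hl.nodup_iff.2 (Finset.nodup_toList _)
  simp only [List.nodup_cons, List.mem_cons, not_or] at hnl
  have h0 : vs ≠ [] := by rintro rfl; simp [code] at hc
  have hperm : vs.flatten.Perm ([] ++ vs'.flatten) := by
    rw [← reduceOption_code, List.nil_append, ← reduceOption_code, hc, ← hc', List.perm_iff_count]
    intro c
    simp [List.reduceOption_append, List.count_cons]
    omega
  have h0' : vs' ≠ [] := ne_nil_of_code (by rw [hc, ← hc']; simp) h0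
  rw [signSum_eq_of_removal f.toEmbedding (K := []) hs hl hv hnd (List.Perm.refl _) hperm hv' h0',
    signSum_eq_self hl hv hnd h0, normSum, normSum, List.cons_append, List.cons_append,
    List.singleton_append,
    phraseSum_third_move hnl.1.2.2 hnl.2.1.2 hnl.2.2.1 hAB hAC hBC hS hnd hc hc'.symm]
  rfl

theorem flatten_perm_reverse {X : Type*} (U V : List (List X)) (w z : List X) :
    (U ++ (w.reverse ++ z) :: V).flatten.Perm (U ++ (w ++ z) :: V).flatten := by
  simp only [List.flatten_append, List.flatten_cons]
  exact (((List.reverse_perm w).append_right z).append_right _).append_left _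

theorem signSum_of_isSelfExpansion {A : p.Letter}
    (h : Nanophrase.IsSelfExpansion (fun a => -a) id p q r A) :
    signSum p = tt ^ (p.proj A : ℤ) * signSum q + tt ^ (-(p.proj A : ℤ)) * signSum r := by
  obtain ⟨f, g, U, V, w, z, hp, hq, hr, hsq, hsr⟩ := h
  obtain ⟨vs, hv, hnd⟩ := exists_passages p
  obtain ⟨U', w', V', rfl, rfl, hw, rfl⟩ := map_fst_eq_append_cons (hv.trans hp)
  obtain ⟨w', z', rfl, hw, hz⟩ := List.map_eq_append_iff.1 hw
  obtain ⟨⟨A, b⟩, w', rfl, rfl, rfl⟩ := List.map_eq_cons_iff.1 hw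
  obtain ⟨⟨A', b'⟩, z', rfl, hA', rfl⟩ := List.map_eq_cons_iff.1 hz
  dsimp only at hA'
  subst hA'
  have hb : b' = !b := by
    have h1 := (List.nodup_flatten.1 hnd).1 _ (List.mem_append_right _ List.mem_cons_self)
    rw [List.cons_append, List.nodup_cons] at h1
    rw [Bool.eq_not]
    rintro rfl
    exact h1.1 (by simp)
  subst hb
  obtain ⟨l, hl⟩ := exists_perm_univ (List.nodup_singleton A')
  have hA : A' ∉ l := (List.nodup_cons.1 (hl.nodup_iff.2 (Finset.nodup_toList _))).1
  have hw' : w'.Nodup := by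
    have h1 := (List.nodup_flatten.1 hnd).1 _ (List.mem_append_right _ List.mem_cons_self)
    exact (List.nodup_append.1 (List.nodup_cons.1 h1).2).1
  have hpq : (U' ++ ((A', b) :: w' ++ (A', !b) :: z') :: V').flatten.Perm
      ([(A', b), (A', !b)] ++ (U' ++ w' :: z' :: V').flatten) := by
    rw [List.perm_iff_count]
    intro c
    simp [List.count_cons]
    omega
  have hpr : (U' ++ ((A', b) :: w' ++ (A', !b) :: z') :: V').flatten.Perm
      ([(A', b), (A', !b)] ++ (U' ++ (w'.reverse ++ z') :: V').flatten) := by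
    refine hpq.trans ?_
    have := (flatten_perm_reverse U' V' w' z').symm.append_left [(A', b), (A', !b)]
    simpa using this
  rw [signSum_eq_of_removal (s := p.proj) f hsq hl hv hnd (List.Perm.refl _) hpq
      (by rw [hq]; simp) (by simp),
    signSum_eq_of_removal g (fun B => (hsr B).trans (flipSign_eq_twist hw' _).symm) hl hv hnd
      (List.Perm.refl _) hpr (by rw [hr]; simp) (by simp),
    signSum_eq_self hl hv hnd (by simp), normSum, normSum, normSum, List.singleton_append,
    phraseSum_self_expansion hA hnd, List.length_cons]
  have h1 : dd⁻¹ ^ 4 * dd ^ 4 = 1 := by rw [← mul_pow, inv_mul_cancel₀ dd_ne_zero, one_pow]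
  linear_combination (dd⁻¹ * dd ^ (4 * l.length) *
    (tt ^ (p.proj A' : ℤ) * phraseSum p.proj l (U' ++ w' :: z' :: V') + tt ^ (-(p.proj A' : ℤ)) *
      phraseSum (flipSign w' p.proj) l (U' ++ (w'.reverse ++ z') :: V'))) * h1

theorem signSum_of_isMixedExpansion {A : p.Letter}
    (h : Nanophrase.IsMixedExpansion (fun a => -a) id p q r A) :
    signSum p = tt ^ (p.proj A : ℤ) * signSum q + tt ^ (-(p.proj A : ℤ)) * signSum r := by
  obtain ⟨f, g, U, V, w, z, hp, hq, hr, hsq, hsr⟩ := h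
  obtain ⟨vs, hv, hnd⟩ := exists_passages p
  obtain ⟨U', w', V', rfl, rfl, hw, hV⟩ := map_fst_eq_append_cons (hv.trans hp)
  obtain ⟨z', V', rfl, hz, rfl⟩ := List.map_eq_cons_iff.1 hV
  obtain ⟨⟨A, b⟩, w', rfl, rfl, rfl⟩ := List.map_eq_cons_iff.1 hw
  obtain ⟨⟨A', b'⟩, z', rfl, hA', rfl⟩ := List.map_eq_cons_iff.1 hz
  dsimp only at hA'
  subst hA'
  have hb : b' = !b := by
    have h1 := hnd
    rw [List.flatten_append, List.flatten_cons, List.cons_append, List.nodup_append,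
      List.nodup_cons] at h1
    rw [Bool.eq_not]
    rintro rfl
    exact h1.2.1.1 (by simp)
  subst hb
  obtain ⟨l, hl⟩ := exists_perm_univ (List.nodup_singleton A')
  have hA : A' ∉ l := (List.nodup_cons.1 (hl.nodup_iff.2 (Finset.nodup_toList _))).1
  have hw' : w'.Nodup := by
    have h1 := (List.nodup_flatten.1 hnd).1 _ (List.mem_append_right _ List.mem_cons_self)
    exact (List.nodup_cons.1 h1).2
  have hpq : (U' ++ ((A', b) :: w') :: ((A', !b) :: z') :: V').flatten.Perm
      ([(A', b), (A', !b)] ++ (U' ++ (w' ++ z') :: V').flatten) := by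
    rw [List.perm_iff_count]
    intro c
    simp [List.count_cons]
    omega
  have hpr : (U' ++ ((A', b) :: w') :: ((A', !b) :: z') :: V').flatten.Perm
      ([(A', b), (A', !b)] ++ (U' ++ (w'.reverse ++ z') :: V').flatten) :=
    hpq.trans ((flatten_perm_reverse U' V' w' z').symm.append_left _)
  rw [signSum_eq_of_removal (s := p.proj) f hsq hl hv hnd (List.Perm.refl _) hpq
      (by rw [hq]; simp) (by simp),
    signSum_eq_of_removal g (fun B => (hsr B).trans (flipSign_eq_twist hw' _).symm) hl hv hnd
      (List.Perm.refl _) hpr (by rw [hr]; simp) (by simp),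
    signSum_eq_self hl hv hnd (by simp), normSum, normSum, normSum, List.singleton_append,
    phraseSum_mixed_expansion hA hnd, List.length_cons]
  have h1 : dd⁻¹ ^ 4 * dd ^ 4 = 1 := by rw [← mul_pow, inv_mul_cancel₀ dd_ne_zero, one_pow]
  linear_combination (dd⁻¹ * dd ^ (4 * l.length) *
    (tt ^ (p.proj A' : ℤ) * phraseSum p.proj l (U' ++ (w' ++ z') :: V') + tt ^ (-(p.proj A' : ℤ)) *
      phraseSum (flipSign w' p.proj) l (U' ++ (w'.reverse ++ z') :: V'))) * h1

end Moves

end StateSum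

namespace StateSum

open Nanophrase (code)
open LaurentPolynomial (T C)

/-! ### The bracket and the Jones polynomial of a pseudo-link -/

section PseudoLinks

variable {p q r : Nanophrase.{u} ℤˣ}

/-- The chosen lift projects to a phrase linked to `p` by a chain of isomorphisms, shifts and
permutations, all of which preserve `signSum`. Identities of brackets thus become identities of
`signSum`. -/
theorem algebraMap_bracket_pseudoLink (p : Nanophrase.{u} ℤˣ) :
    algebraMap _ FracField p.toPseudoLink.bracket = signSum p := by
  have key : ∀ a b : Nanophrase.{u} ℤˣ, Relation.EqvGen PseudoLinkRel a b →
      signSum a = signSum b := by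
    intro a b h
    induction h with
    | rel a b h =>
      rcases h with h | h | h
      · exact signSum_of_isIsomorphic h
      · exact signSum_of_isShift h
      · exact signSum_of_isPermutation h
    | refl a => rfl
    | symm a b _ ih => exact ih.symm
    | trans a b c _ _ ih ih' => exact ih.trans ih'
  rw [PseudoLink.bracket, algebraMap_bracket_eq_signSum]
  exact key _ _ (Quot.eqvGen_exact p.toPseudoLink.exists_lift.choose_spec)

theorem bracket_toPseudoLink (P : Nanophrase.{u} AlphaStar) :
    P.toSigns.toPseudoLink.bracket = P.bracket :=
  algebraMap_injective (by rw [algebraMap_bracket_pseudoLink, algebraMap_bracket_eq_signSum])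

theorem bracket_eq_of_signSum_eq (h : signSum p = signSum q) :
    p.toPseudoLink.bracket = q.toPseudoLink.bracket :=
  algebraMap_injective (by rw [algebraMap_bracket_pseudoLink, algebraMap_bracket_pseudoLink, h])

theorem bracket_of_isFirstMove {A : p.Letter} (h : Nanophrase.IsFirstMove p q A) :
    q.toPseudoLink.bracket = -T (-3 * (p.proj A : ℤ)) * p.toPseudoLink.bracket :=
  algebraMap_injective (by
    rw [map_mul, map_neg, algebraMap_T, algebraMap_bracket_pseudoLink,
      algebraMap_bracket_pseudoLink, signSum_of_isFirstMove h])

theorem bracket_of_isExpansion {A : p.Letter}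
    (h : Nanophrase.IsSelfExpansion (fun a => -a) id p q r A ∨
      Nanophrase.IsMixedExpansion (fun a => -a) id p q r A) :
    p.toPseudoLink.bracket = T (p.proj A : ℤ) * q.toPseudoLink.bracket +
      T (-(p.proj A : ℤ)) * r.toPseudoLink.bracket :=
  algebraMap_injective (by
    rw [map_add, map_mul, map_mul, algebraMap_T, algebraMap_T, algebraMap_bracket_pseudoLink,
      algebraMap_bracket_pseudoLink, algebraMap_bracket_pseudoLink]
    exact h.elim signSum_of_isSelfExpansion signSum_of_isMixedExpansion)

theorem bracket_of_isEmptyWordDeletion (h : Nanophrase.IsEmptyWordDeletion p q) :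
    p.toPseudoLink.bracket = -(T 2 + T (-2)) * q.toPseudoLink.bracket :=
  algebraMap_injective (by
    rw [map_mul, algebraMap_circle, algebraMap_bracket_pseudoLink,
      algebraMap_bracket_pseudoLink, signSum_of_isEmptyWordDeletion h])

theorem bracket_of_words_eq (h : p.words = [[]]) : p.toPseudoLink.bracket = 1 :=
  algebraMap_injective (by
    rw [map_one, algebraMap_bracket_pseudoLink, signSum_of_words_eq h])

theorem perm_univ_of_perm (f : q.Letter ↪ p.Letter) {K : List p.Letter}
    (hp : p.words.flatten.Perm (K ++ K ++ (q.words.map (List.map f)).flatten)) :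
    (K ++ (Finset.univ : Finset q.Letter).toList.map f).Perm Finset.univ.toList := by
  rw [List.perm_iff_count]
  intro A
  have h1 := p.gauss A
  rw [hp.count_eq, ← List.map_flatten] at h1
  rw [List.count_eq_one_of_mem (Finset.nodup_toList _) (Finset.mem_toList.2 (Finset.mem_univ A))]
  simp only [List.count_append] at h1 ⊢
  by_cases hA : ∃ B, f B = A
  · obtain ⟨B, rfl⟩ := hA
    rw [List.count_map_of_injective _ _ f.injective, q.gauss] at h1
    rw [List.count_map_of_injective _ _ f.injective,
      List.count_eq_one_of_mem (Finset.nodup_toList _) (Finset.mem_toList.2 (Finset.mem_univ B))]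
    omega
  · have h : ∀ l : List q.Letter, (l.map f).count A = 0 := fun l =>
      List.count_eq_zero.2 fun h => hA ((List.mem_map.1 h).imp fun _ h => h.2)
    rw [h] at h1 ⊢
    omega

theorem writhe_eq_of_perm (f : q.Letter ↪ p.Letter) (hs : ∀ B, q.proj B = p.proj (f B))
    {K : List p.Letter}
    (hp : p.words.flatten.Perm (K ++ K ++ (q.words.map (List.map f)).flatten)) :
    p.writhe = (K.map fun A => (p.proj A : ℤ)).sum + q.writhe := by
  rw [Nanophrase.writhe, Nanophrase.writhe, ← Finset.sum_map_toList, ← Finset.sum_map_toList,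
    ← ((perm_univ_of_perm f hp).map _).sum_eq, List.map_append, List.sum_append, List.map_map]
  simp only [hs, Function.comp_def]

theorem writhe_of_isFirstMove {A : p.Letter} (h : Nanophrase.IsFirstMove p q A) :
    p.writhe = (p.proj A : ℤ) + q.writhe := by
  obtain ⟨f, x, y, hp, hq, hs⟩ := h
  rw [writhe_eq_of_perm f hs (K := [A])]
  · simp
  · rw [← reduceOption_code, ← reduceOption_code, hp, hq, List.perm_iff_count]
    intro c
    simp [List.reduceOption_append, List.count_cons]
    omega

theorem writhe_of_isSecondMove (h : Nanophrase.IsSecondMove (fun a => -a) p q) :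
    p.writhe = q.writhe := by
  obtain ⟨f, A, B, x, y, z, hAB, hsAB, hp, hq, hs⟩ := h
  rw [writhe_eq_of_perm f hs (K := [A, B])]
  · simp [hsAB]
  · rw [← reduceOption_code, ← reduceOption_code, hp, hq, List.perm_iff_count]
    intro c
    simp [List.reduceOption_append, List.count_cons]
    omega

theorem writhe_of_equiv (f : q.Letter ≃ p.Letter) (hs : ∀ B, q.proj B = p.proj (f B)) :
    p.writhe = q.writhe := by
  simp only [Nanophrase.writhe, hs]
  exact (Equiv.sum_comp f fun A => (p.proj A : ℤ)).symm

theorem writhe_of_isThirdMove (h : Nanophrase.IsThirdMove Nanophrase.S₁ p q) :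
    p.writhe = q.writhe := by
  obtain ⟨f, _, _, _, _, _, _, _, _, _, _, _, _, _, hs⟩ := h
  exact writhe_of_equiv f hs

theorem writhe_of_isInversion {w : List p.Letter}
    (h : Nanophrase.IsInversion (fun a => -a) id p q w) :
    q.writhe = p.writhe + -2 * p.writheOnce w := by
  obtain ⟨f, _, _, _, _, hs⟩ := h
  simp only [Nanophrase.writhe, Nanophrase.writheOnce, hs]
  rw [Equiv.sum_comp f fun A => ((p.twist (fun a => -a) id w A : ℤˣ) : ℤ), Finset.mul_sum,
    ← Finset.sum_add_distrib]
  refine Finset.sum_congr rfl fun A _ => ?_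
  rw [Nanophrase.twist]
  split_ifs
  · push_cast
    ring
  · simp
  · simp

/-- The factor `(-t)^{-3 w}`. -/
noncomputable def writheFactor (w : ℤ) : ℤ[T;T⁻¹] := C ((-3 * w).negOnePow : ℤ) * T (-3 * w)

theorem writheFactor_add (v w : ℤ) : writheFactor (v + w) = writheFactor v * writheFactor w := by
  rw [writheFactor, writheFactor, writheFactor, mul_add, Int.negOnePow_add, LaurentPolynomial.T_add,
    Units.val_mul, map_mul]
  ring

theorem writheFactor_unit (e : ℤˣ) : writheFactor e = -T (-3 * (e : ℤ)) := by
  have h : (-3 * (e : ℤ)).negOnePow = -1 := by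
    refine Int.negOnePow_odd _ ?_
    rcases Int.units_eq_one_or e with rfl | rfl <;> decide
  rw [writheFactor, h, Units.val_neg, Units.val_one, map_neg, map_one, neg_one_mul]

theorem writheFactor_neg_two_mul (w : ℤ) : writheFactor (-2 * w) = T (6 * w) := by
  have h : (-3 * (-2 * w)).negOnePow = 1 := Int.negOnePow_even _ ⟨3 * w, by ring⟩
  rw [writheFactor, h, Units.val_one, map_one, one_mul]
  congr 1
  ring

theorem jones_toPseudoLink (p : Nanophrase.{u} ℤˣ) :
    p.toPseudoLink.jones = writheFactor p.writhe * p.toPseudoLink.bracket := rfl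

theorem jones_eq_of_signSum_eq (h : signSum p = signSum q) (hw : p.writhe = q.writhe) :
    p.toPseudoLink.jones = q.toPseudoLink.jones := by
  rw [jones_toPseudoLink, jones_toPseudoLink, hw, bracket_eq_of_signSum_eq h]

/-- The deleted letter contributes `-t^(-3|A|)` to the writhe factor of `p`, exactly the factor
relating the two brackets. -/
theorem jones_of_isFirstMove {A : p.Letter} (h : Nanophrase.IsFirstMove p q A) :
    p.toPseudoLink.jones = q.toPseudoLink.jones := by
  rw [jones_toPseudoLink, jones_toPseudoLink, bracket_of_isFirstMove h, writhe_of_isFirstMove h,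
    writheFactor_add, writheFactor_unit]
  ring

theorem jones_of_isInversion {w : List p.Letter}
    (h : Nanophrase.IsInversion (fun a => -a) id p q w) :
    q.toPseudoLink.jones = T (6 * p.writheOnce w) * p.toPseudoLink.jones := by
  rw [jones_toPseudoLink, jones_toPseudoLink, writhe_of_isInversion h, writheFactor_add,
    writheFactor_neg_two_mul, bracket_eq_of_signSum_eq (signSum_of_isInversion h)]
  ring

theorem jones_of_homotopic (h : Nanophrase.Homotopic₁ p q) :
    p.toPseudoLink.jones = q.toPseudoLink.jones := by
  induction h with
  | rel p q h =>
    cases h with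
    | iso h =>
      exact jones_eq_of_signSum_eq (signSum_of_isIsomorphic h)
        (Nanophrase.writhe_eq_of_rel p q (Or.inl h))
    | first A h => exact jones_of_isFirstMove h
    | second h =>
      exact jones_eq_of_signSum_eq (signSum_of_isSecondMove h) (writhe_of_isSecondMove h)
    | third h =>
      exact jones_eq_of_signSum_eq (signSum_of_isThirdMove h) (writhe_of_isThirdMove h)
  | refl p => rfl
  | symm p q _ ih => exact ih.symm
  | trans p q r _ _ ih ih' => exact ih.trans ih'

end PseudoLinks

end StateSum

namespace StateSum

open Nanophrase (passagesWord passages)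
open LaurentPolynomial (T C)

/-! ### Every diagram is the diagram of a nanophrase -/

theorem exists_words_of_cycles {X : Type*} [Fintype X] [DecidableEq X]
    {l : List (Equiv.Perm X)} (hl : ∀ g ∈ l, g.IsCycle) (hd : l.Pairwise Equiv.Perm.Disjoint) :
    ∃ ws : List (List X), ws.map List.formPerm = l ∧ ws.flatten.Nodup ∧
      ws.countP List.isEmpty = 0 ∧ ∀ x ∈ ws.flatten, ∃ g ∈ l, g x ≠ x := by
  induction l with
  | nil => exact ⟨[], rfl, List.nodup_nil, rfl, by simp⟩
  | cons g l ih =>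
    rw [List.pairwise_cons] at hd
    obtain ⟨ws, h1, h2, h3, h4⟩ := ih (fun g hg => hl g (List.mem_cons_of_mem _ hg)) hd.2
    have hg := hl g List.mem_cons_self
    obtain ⟨x, hx, -⟩ := id hg
    have hmem : ∀ y ∈ g.toList x, g y ≠ y := fun y hy => by
      rw [Equiv.Perm.mem_toList_iff] at hy
      rw [← Equiv.Perm.mem_support, ← hy.1.mem_support_iff]
      exact hy.2
    -- The cycle `g` is cut open at a point `x` that it moves.
    refine ⟨g.toList x :: ws, ?_, ?_, ?_, ?_⟩
    · rw [List.map_cons, h1, Equiv.Perm.formPerm_toList, hg.cycleOf_eq hx]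
    · rw [List.flatten_cons, List.nodup_append]
      refine ⟨Equiv.Perm.nodup_toList _ _, h2, ?_⟩
      rintro y hy z hz rfl
      obtain ⟨g', hg', hz'⟩ := h4 y hz
      exact (hd.1 g' hg' y).elim (hmem y hy) hz'
    · have h : (g.toList x).isEmpty = false := by
        rw [List.isEmpty_eq_false_iff]
        intro h
        have : x ∈ g.toList x :=
          Equiv.Perm.mem_toList_iff.2 ⟨Equiv.Perm.SameCycle.refl _ _, Equiv.Perm.mem_support.2 hx⟩
        simp [h] at this
      rw [List.countP_cons, h3, h]
      rfl
    · intro y hy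
      rw [List.flatten_cons, List.mem_append] at hy
      rcases hy with hy | hy
      · exact ⟨g, List.mem_cons_self, hmem y hy⟩
      · obtain ⟨g', hg', hz'⟩ := h4 y hy
        exact ⟨g', List.mem_cons_of_mem _ hg', hz'⟩

theorem exists_words {X : Type*} [Fintype X] [DecidableEq X] (f : Equiv.Perm X) (n : ℕ) :
    ∃ ws : List (List X), (ws.map List.formPerm).prod = f ∧ ws.flatten.Nodup ∧
      (∀ x, x ∈ ws.flatten) ∧ ws.countP List.isEmpty = n := by
  obtain ⟨⟨l, hl, hc, hd⟩, -⟩ := f.truncCycleFactors.exists_rep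
  obtain ⟨ws, h1, h2, h3, -⟩ := exists_words_of_cycles hc hd
  -- Fixed points of `f` lie in no cycle factor. They become words of length one, and the circles
  -- without crossings become empty words; neither affects the product.
  let F := Finset.univ.toList.filter (· ∉ ws.flatten)
  have hF : (F.map fun x => [x]).flatten = F := by
    rw [← List.flatMap_def, List.flatMap_singleton']
  have hflat : (ws ++ (F.map (fun x => [x]) ++ List.replicate n [])).flatten = ws.flatten ++ F := by
    rw [List.flatten_append, List.flatten_append, hF]
    simp
  refine ⟨ws ++ (F.map (fun x => [x]) ++ List.replicate n []), ?_, ?_, ?_, ?_⟩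
  · rw [List.map_append, List.prod_append, h1, hl, List.map_append, List.map_map]
    simp [Function.comp_def]
  · rw [hflat, List.nodup_append]
    refine ⟨h2, (Finset.nodup_toList _).filter _, ?_⟩
    rintro x hx y hy rfl
    exact of_decide_eq_true (List.mem_filter.1 hy).2 hx
  · intro x
    rw [hflat, List.mem_append, List.mem_filter, decide_eq_true_iff]
    exact (em _).imp_right fun h => ⟨Finset.mem_toList.2 (Finset.mem_univ x), h⟩
  · rw [List.countP_append, List.countP_append, h3, List.countP_map]
    simp [Function.comp_def, List.countP_replicate]

theorem map_flipPassage_passagesWord {L : Type u} [DecidableEq L] (φ fst : L → Bool)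
    (seen w : List L) : (passagesWord fst seen w).map (flipPassage φ) =
      passagesWord (fun A => xor (fst A) (φ A)) seen w := by
  induction w generalizing seen with
  | nil => rfl
  | cons A w ih =>
    rw [passagesWord, passagesWord, List.map_cons, ih]
    congr 1
    rw [flipPassage]
    split_ifs <;> simp

/-- Every phrase of pairwise different passages is given by a choice of first passages. -/
theorem exists_passages_eq {L : Type u} [DecidableEq L] {ws : List (List (L × Bool))}
    (hnd : ws.flatten.Nodup) :
    ∃ fst : L → Bool, passages fst [] (ws.map (List.map Prod.fst)) = ws := by
  have hc : ∀ A, (ws.flatten.map Prod.fst).count A + (if A ∈ ([] : List L) then 1 else 0) ≤ 2 := by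
    intro A
    rw [count_map_fst]
    have h1 := List.nodup_iff_count_le_one.1 hnd (A, true)
    have h2 := List.nodup_iff_count_le_one.1 hnd (A, false)
    simp only [List.not_mem_nil, if_false]
    omega
  obtain ⟨φ, hφ⟩ := exists_flipPassage
    (map_fst_passagesWord (fun _ => true) [] (ws.flatten.map Prod.fst))
    (nodup_passagesWord _ hc) hnd
  rw [map_flipPassage_passagesWord] at hφ
  refine ⟨fun A => xor true (φ A), List.eq_iff_flatten_eq.2 ⟨?_, ?_⟩⟩
  · rw [flatten_passages, ← List.map_flatten]
    exact hφ.symm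
  · have h : ∀ vs : List (List (L × Bool)),
        vs.map List.length = (vs.map (List.map Prod.fst)).map List.length := fun vs => by simp
    rw [h, map_fst_passages, ← h]

theorem exists_alphaStar (e : ℤˣ) (b : Bool) :
    ∃ a : AlphaStar, a.sign = e ∧ a.firstOver = b := by
  rcases Int.units_eq_one_or e with rfl | rfl <;> cases b
  · exact ⟨.bPlus, rfl, rfl⟩
  · exact ⟨.aPlus, rfl, rfl⟩
  · exact ⟨.aMinus, rfl, rfl⟩
  · exact ⟨.bMinus, rfl, rfl⟩

/-- The cycles of `next`, cut open, are the words. The sign of a crossing and its first passage in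
this order determine its letter in `α_*`. -/
theorem exists_nanophrase (D : LinkDiagram.{u}) :
    ∃ P : Nanophrase.{u} AlphaStar, D.IsHomeomorphic P.diagram := by
  obtain ⟨ws, h1, h2, h3, h4⟩ := exists_words D.next D.circles
  obtain ⟨fst, hfst⟩ := exists_passages_eq h2
  choose a ha ha' using fun A => exists_alphaStar (D.sign A) (fst A)
  let P : Nanophrase.{u} AlphaStar :=
    { Letter := D.Crossing
      proj := a
      words := ws.map (List.map Prod.fst)
      gauss := fun A => by
        rw [← List.map_flatten, count_map_fst, List.count_eq_one_of_mem h2 (h3 _),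
          List.count_eq_one_of_mem h2 (h3 _)] }
  have hn : P.diagram.next = D.next := by
    have h : (fun A => (a A).firstOver) = fst := funext ha'
    change ((passages (fun A => (a A).firstOver) [] (ws.map (List.map Prod.fst))).map
      List.formPerm).prod = D.next
    rw [h, hfst, h1]
  refine ⟨P, Equiv.refl _, ha, fun c o => ?_, (countP_isEmpty_map Prod.fst ws).trans h4⟩
  rw [hn]
  rfl

/-! ### The Jones polynomial of a diagram -/

section Homeomorphic

variable {D E : LinkDiagram.{u}}

theorem exists_halfEdge_equiv (h : D.IsHomeomorphic E) :
    ∃ e : D.Crossing ≃ E.Crossing, (∀ c, E.sign (e c) = D.sign c) ∧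
      ∀ s : E.Crossing → Bool, E.loops s = D.loops (s ∘ e) := by
  obtain ⟨e, hs, hn, hc⟩ := h
  refine ⟨e, hs, fun s => ?_⟩
  let φ : D.HalfEdge ≃ E.HalfEdge := e.prodCongr (Equiv.refl _)
  have hφ : ∀ x, φ x = (e x.1, x.2) := fun _ => rfl
  have hrot : ∀ x, E.rot (φ x) = φ (D.rot x) := by
    intro x
    simp only [LinkDiagram.rot, hφ, hs]
    split_ifs <;> rfl
  have hsymm : ∀ c o, E.next.symm (e c, o) =
      (e (D.next.symm (c, o)).1, (D.next.symm (c, o)).2) := by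
    intro c o
    rw [Equiv.symm_apply_eq, hn]
    simp
  have hopp : ∀ x, E.opp (φ x) = φ (D.opp x) := by
    intro x
    simp only [LinkDiagram.opp, hφ, hn, hsymm]
    split_ifs <;> rfl
  rw [LinkDiagram.loops, LinkDiagram.loops, hc]
  congr 1
  refine (Nat.card_congr (Quot.congr φ fun x y => ?_)).symm
  rw [LinkDiagram.Joined, LinkDiagram.Joined, hopp, hrot, hrot, φ.apply_eq_iff_eq,
    φ.apply_eq_iff_eq, φ.apply_eq_iff_eq]
  rfl

theorem writhe_eq_of_isHomeomorphic (h : D.IsHomeomorphic E) : D.writhe = E.writhe := by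
  obtain ⟨e, hs, -⟩ := h
  rw [LinkDiagram.writhe, LinkDiagram.writhe, ← Equiv.sum_comp e]
  simp only [hs]

theorem bracket_eq_of_isHomeomorphic (h : D.IsHomeomorphic E) : D.bracket = E.bracket := by
  obtain ⟨e, -, hl⟩ := exists_halfEdge_equiv h
  rw [LinkDiagram.bracket, LinkDiagram.bracket]
  refine (Fintype.sum_equiv (Equiv.arrowCongr e.symm (Equiv.refl Bool)) _ _ fun s => ?_).symm
  have hs : Equiv.arrowCongr e.symm (Equiv.refl Bool) s = s ∘ e := rfl
  rw [hs, hl, LinkDiagram.weight, LinkDiagram.weight, ← Equiv.sum_comp e]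
  rfl

end Homeomorphic

theorem substInvSq_C (a : ℤ) : substInvSq (C a) = C a := LaurentPolynomial.eval₂_C _ _ _

theorem substInvSq_T (n : ℤ) : substInvSq (T n) = T (-2 * n) := by
  have h : ((tInvSq ^ n : ℤ[T;T⁻¹]ˣ) : ℤ[T;T⁻¹]) = T (-2 * n) := by
    have h1 : ((tInvSq : ℤ[T;T⁻¹]ˣ) : ℤ[T;T⁻¹]) = T (-2) := rfl
    have h2 : ((tInvSq⁻¹ : ℤ[T;T⁻¹]ˣ) : ℤ[T;T⁻¹]) = T 2 := by
      rw [← Units.mul_right_inj tInvSq, Units.mul_inv, h1, ← LaurentPolynomial.T_add]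
      exact LaurentPolynomial.T_zero.symm
    induction n with
    | zero => simp
    | succ n ih =>
      rw [zpow_add_one, Units.val_mul, ih, h1, ← LaurentPolynomial.T_add]
      congr 1
      ring
    | pred n ih =>
      rw [zpow_sub_one, Units.val_mul, ih, h2, ← LaurentPolynomial.T_add]
      congr 1
      ring
  rw [← h]
  exact LaurentPolynomial.eval₂_T _ _ _

/-- Each crossing contributes `±3 ± 1`. This makes the halved exponent in `LinkDiagram.jones` exact,
so that substituting `t⁻²` recovers it. -/
theorem even_writhe_sub_weight (D : LinkDiagram.{u}) (s : D.Crossing → Bool) :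
    Even (3 * D.writhe - D.weight s) := by
  rw [LinkDiagram.writhe, LinkDiagram.weight, Finset.mul_sum, ← Finset.sum_sub_distrib]
  refine Finset.even_sum _ fun c _ => ?_
  rcases Int.units_eq_one_or (D.sign c) with h | h <;> rw [h] <;> split_ifs <;> decide

theorem substInvSq_jones (D : LinkDiagram.{u}) :
    substInvSq D.jones = writheFactor D.writhe * D.bracket := by
  rw [LinkDiagram.jones, LinkDiagram.bracket, map_sum, Finset.mul_sum]
  refine Finset.sum_congr rfl fun s _ => ?_
  have h1 : -2 * ((3 * D.writhe - D.weight s) / 2) = -3 * D.writhe + D.weight s := by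
    have := Int.two_mul_ediv_two_of_even (even_writhe_sub_weight D s)
    linarith
  -- The two signs are written with exponents `-3 w` and `w`, which have the same parity.
  have h2 : (-3 * D.writhe).negOnePow = D.writhe.negOnePow := by
    rw [Int.negOnePow_eq_iff]
    exact ⟨-2 * D.writhe, by ring⟩
  rw [map_mul, map_mul, map_pow, map_neg, map_add, substInvSq_C, substInvSq_T, substInvSq_T,
    substInvSq_T, h1, writheFactor, h2, LaurentPolynomial.T_add, add_comm (T (-2 * 1)),
    show (-2 * 1 : ℤ) = -2 from rfl, show (-2 * -1 : ℤ) = 2 from rfl]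
  simp only [mul_assoc]

theorem jones_eq_substInvSq {D : LinkDiagram.{u}} {P : Nanophrase.{u} AlphaStar}
    (h : D.IsHomeomorphic P.diagram) :
    P.toSigns.toPseudoLink.jones = substInvSq D.jones := by
  rw [substInvSq_jones, jones_toPseudoLink, bracket_toPseudoLink, writhe_eq_of_isHomeomorphic h,
    bracket_eq_of_isHomeomorphic h]
  rfl

end StateSum

/-! ### The theorem on the bracket and the Jones polynomial of pseudo-links -/

theorem mainTheorem7 :
    -- the bracket of a nanophrase over `α_*` depends only on its projection to `α₁`,
    -- and every pseudo-link has a well-defined bracket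
    (∀ P Q : Nanophrase.{u} AlphaStar, Nanophrase.IsIsomorphic P.toSigns Q.toSigns →
      P.bracket = Q.bracket) ∧
    (∀ P : Nanophrase.{u} AlphaStar, P.toSigns.toPseudoLink.bracket = P.bracket) ∧
    -- invariance of the bracket under shifts, permutations and inversions of words
    (∀ p q : Nanophrase.{u} ℤˣ, Nanophrase.IsShift id p q →
      p.toPseudoLink.bracket = q.toPseudoLink.bracket) ∧
    (∀ p q : Nanophrase.{u} ℤˣ, Nanophrase.IsPermutation id p q →
      p.toPseudoLink.bracket = q.toPseudoLink.bracket) ∧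
    (∀ (p q : Nanophrase.{u} ℤˣ) (w : List p.Letter),
      Nanophrase.IsInversion (fun a => -a) id p q w →
      p.toPseudoLink.bracket = q.toPseudoLink.bracket) ∧
    -- behaviour of the bracket under the homotopy moves
    (∀ (p q : Nanophrase.{u} ℤˣ) (A : p.Letter), Nanophrase.IsFirstMove p q A →
      q.toPseudoLink.bracket =
        -LaurentPolynomial.T (-3 * (p.proj A : ℤ)) * p.toPseudoLink.bracket) ∧
    (∀ p q : Nanophrase.{u} ℤˣ, Nanophrase.IsSecondMove (fun a => -a) p q →
      p.toPseudoLink.bracket = q.toPseudoLink.bracket) ∧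
    (∀ p q : Nanophrase.{u} ℤˣ, Nanophrase.IsThirdMove Nanophrase.S₁ p q →
      p.toPseudoLink.bracket = q.toPseudoLink.bracket) ∧
    -- the relations that determine the bracket recursively
    (∀ (p q r : Nanophrase.{u} ℤˣ) (A : p.Letter),
      (Nanophrase.IsSelfExpansion (fun a => -a) id p q r A ∨
        Nanophrase.IsMixedExpansion (fun a => -a) id p q r A) →
      p.toPseudoLink.bracket =
        LaurentPolynomial.T (p.proj A : ℤ) * q.toPseudoLink.bracket +
        LaurentPolynomial.T (-(p.proj A : ℤ)) * r.toPseudoLink.bracket) ∧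
    (∀ p q : Nanophrase.{u} ℤˣ, Nanophrase.IsEmptyWordDeletion p q →
      p.toPseudoLink.bracket =
        -(LaurentPolynomial.T 2 + LaurentPolynomial.T (-2)) * q.toPseudoLink.bracket) ∧
    (∀ p : Nanophrase.{u} ℤˣ, p.words = [[]] → p.toPseudoLink.bracket = 1) ∧
    -- invariance of the Jones polynomial under homotopy, shifts and permutations,
    -- and its behaviour under inversions
    (∀ p q : Nanophrase.{u} ℤˣ, Nanophrase.Homotopic₁ p q →
      p.toPseudoLink.jones = q.toPseudoLink.jones) ∧
    (∀ p q : Nanophrase.{u} ℤˣ, Nanophrase.IsShift id p q →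
      p.toPseudoLink.jones = q.toPseudoLink.jones) ∧
    (∀ p q : Nanophrase.{u} ℤˣ, Nanophrase.IsPermutation id p q →
      p.toPseudoLink.jones = q.toPseudoLink.jones) ∧
    (∀ (p q : Nanophrase.{u} ℤˣ) (w : List p.Letter),
      Nanophrase.IsInversion (fun a => -a) id p q w →
      q.toPseudoLink.jones =
        LaurentPolynomial.T (6 * p.writheOnce w) * p.toPseudoLink.jones) ∧
    -- for classical links it is the Jones polynomial `V(q)` with `q^{1/2} = t⁻²`
    (∀ D : LinkDiagram.{u}, D.IsClassical →
      (∃ P : Nanophrase.{u} AlphaStar, LinkDiagram.IsHomeomorphic D P.diagram) ∧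
      ∀ P : Nanophrase.{u} AlphaStar, LinkDiagram.IsHomeomorphic D P.diagram →
        P.toSigns.toPseudoLink.jones = substInvSq D.jones) :=
  ⟨fun P Q h => StateSum.algebraMap_injective (by
      rw [StateSum.algebraMap_bracket_eq_signSum, StateSum.algebraMap_bracket_eq_signSum,
        StateSum.signSum_of_isIsomorphic h]),
    StateSum.bracket_toPseudoLink,
    fun _ _ h => StateSum.bracket_eq_of_signSum_eq (StateSum.signSum_of_isShift h),
    fun _ _ h => StateSum.bracket_eq_of_signSum_eq (StateSum.signSum_of_isPermutation h),
    fun _ _ _ h => StateSum.bracket_eq_of_signSum_eq (StateSum.signSum_of_isInversion h),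
    fun _ _ _ h => StateSum.bracket_of_isFirstMove h,
    fun _ _ h => StateSum.bracket_eq_of_signSum_eq (StateSum.signSum_of_isSecondMove h),
    fun _ _ h => StateSum.bracket_eq_of_signSum_eq (StateSum.signSum_of_isThirdMove h),
    fun _ _ _ _ h => StateSum.bracket_of_isExpansion h,
    fun _ _ h => StateSum.bracket_of_isEmptyWordDeletion h,
    fun _ h => StateSum.bracket_of_words_eq h,
    fun _ _ h => StateSum.jones_of_homotopic h,
    fun p q h => StateSum.jones_eq_of_signSum_eq (StateSum.signSum_of_isShift h)
      (Nanophrase.writhe_eq_of_rel p q (Or.inr (Or.inl h))),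
    fun p q h => StateSum.jones_eq_of_signSum_eq (StateSum.signSum_of_isPermutation h)
      (Nanophrase.writhe_eq_of_rel p q (Or.inr (Or.inr h))),
    fun _ _ _ h => StateSum.jones_of_isInversion h,
    fun D _ => ⟨StateSum.exists_nanophrase D, fun _ h => StateSum.jones_eq_substInvSq h⟩⟩
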